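/- Let $\Bbbk$ be a commutative unital ring, $b,r,N\ge 0$ integers and $\underline N=(N_1,\dots,N_r)\in\mathbb N^r$. **Algebras.** Consider braid-like diagrams with $b$ black strands, which may carry dots and may cross each other, and $r$ red strands labeled $N_1,\dots,N_r$ from left to right, which black strands may cross but which do not cross each other. The affine KLRW algebra $\widetilde T_b^{\underline N}$ is the $\Bbbk$-algebra of such diagrams up to braid-like planar isotopy, with vertical concatenation as product ($xy$ is $x$ on top of $y$, and is zero if the strands do not match), modulo the following local relations. Write $\tau$ for a black/black crossing, $x_1,x_2$ for a dot on the left or right one of two neighbouring black strands, and $1$ for vertical strands. * $\tau^2=0$, the braid relation for three black strands, $\tau x_1=x_2\tau+1$ and $x_1\tau=\tau x_2+1$. * Dots slide through black/red crossings. A double crossing of a black strand with the red strand labeled $N_i$ equals $N_i$ dots on the vertical black strand next to the vertical red strand. Black/black crossings slide through red strands lying on either side of them. * For neighbouring strands black, red (labeled $N_i$), black, the diagram in which the two black strands cross to the right of the red one equals the diagram in which they cross to the left of it, plus $\sum_{k+\ell=N_i-1}$ of vertical strands with $k$ dots on the left black strand and $\ell$ dots on the right one. The KLRW algebra $T_b^{\underline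 N}$ is the quotient of $\widetilde T_b^{\underline N}$ by the diagrams that have a black strand to the left of all red strands at some height. It is $\mathbb Z$-graded by $\deg_q(\tau)=-2$, $\deg_q(\text{dot})=2$, and $\deg_q=N_i$ for a crossing of a black strand with the red strand labeled $N_i$. The dg-enhanced KLRW algebra $T_b^{\lambda,\underline N}$ is defined by the same diagrams and local relations as $\widetilde T_b^{\underline N}$, with in addition a vertical blue strand labeled $\lambda$ to the left of everything, on which the leftmost black strand may be nailed. Writing $\omega$ for a nail, the additional local relations are $x_1\omega=\omega x_1$, $\tau\omega\tau\omega=-\omega\tau\omega\tau$ and $\omega^2=0$. The nail has homological degree $1$ and $(q,\lambda)$-degree $(0,2)$; the other generators have homological degree $0$, $\lambda$-degree $0$ and the $q$-degree above. Specialize $\lambda=q^N$, that is, collapse the $(q,\lambda)$-degree $(a,c)$ to the single $q$-degree $a+cN$. Let $d_N$ be the differential on $T_b^{\lambda,\underline N}$ that is zero on diagrams without nails, sends a nail to $N$ dots on the leftmost black strand, and is extended by the graded Leibniz rule $d_N(xy)=d_N(x)y+(-1)^{\deg_h x}x\,d_N(y)$; it lowers the homological degree $\deg_h$ by one and preserves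 the $q$-degree. **Theorem.** The $\mathbb Z$-graded dg-algebra $(T_b^{\lambda,\underline N},d_N)$ is formal, that is, there is a quasi-isomorphism of $\mathbb Z$-graded dg-algebras $(T_b^{\lambda,\underline N},d_N)\to(H(T_b^{\lambda,\underline N},d_N),0)$. Moreover $$H(T_b^{\lambda,\underline N},d_N)\cong T_b^{(N,\underline N)},\qquad (N,\underline N)=(N,N_1,\dots,N_r)\in\mathbb N^{r+1},$$ as graded $\Bbbk$-algebras, where $T_b^{(N,\underline N)}$ carries its $q$-grading and is concentrated in homological degree $0$. -/

import Mathlib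

noncomputable section

open scoped DirectSum

/-! ## Graded dg-algebras, homology, formality -/

/-- A `ℤ`-graded dg-algebra structure on the `k`-algebra `A`.  The first component of the
`ℤ × ℤ`-grading is the homological degree; the differential lowers it by one and preserves the
second (internal) degree. -/
structure DGAlgebra (k : Type*) (A : Type*) [CommRing k] [Ring A] [Algebra k A] where
  /-- the homogeneous components -/
  gr : ℤ × ℤ → Submodule k A
  /-- `A` is the direct sum of its homogeneous components, as a graded algebra -/
  graded : GradedAlgebra gr
  /-- the differential -/
  d : A →ₗ[k] A
  d_mem : ∀ (h g : ℤ) (a : A), a ∈ gr (h, g) → d a ∈ gr (h - 1, g)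
  leibniz : ∀ (h g : ℤ) (a b : A), a ∈ gr (h, g) →
    d (a * b) = d a * b + h.negOnePow • (a * d b)
  d_d : ∀ a, d (d a) = 0

namespace DGAlgebra

variable {k A B : Type*} [CommRing k] [Ring A] [Algebra k A] [Ring B] [Algebra k B]

/-- The dg-algebra given by a graded algebra and the zero differential. -/
def ofGraded (𝒜 : ℤ × ℤ → Submodule k A) (h : GradedAlgebra 𝒜) : DGAlgebra k A where
  gr := 𝒜
  graded := h
  d := 0
  d_mem := by intro h g a _; simp
  leibniz := by intro h g a b _; simp
  d_d := by simp

variable (D : DGAlgebra k A)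

/-- Every element is a sum of homogeneous ones. -/
theorem homogeneous_induction {p : A → Prop} (h0 : p 0)
    (hom : ∀ h g a, a ∈ D.gr (h, g) → p a) (hadd : ∀ a b, p a → p b → p (a + b)) (a : A) :
    p a := by
  let := D.graded
  refine DirectSum.Decomposition.inductionOn D.gr h0 ?_ hadd a
  rintro ⟨h, g⟩ m
  exact hom h g m m.2

theorem d_one : D.d 1 = 0 := by
  let := D.graded
  have h1 : (1 : A) ∈ D.gr (0, 0) := SetLike.GradedOne.one_mem
  have := D.leibniz 0 0 1 1 h1
  simpa using this

/-- The sign operator `a ↦ (-1) ^ h • a` for `a` of homological degree `h`. -/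
def sgn : A →ₗ[k] A :=
  letI := D.graded
  (DirectSum.toModule k (ℤ × ℤ) A (fun i => (i.1.negOnePow : ℤˣ) • (D.gr i).subtype)) ∘ₗ
    (DirectSum.decomposeLinearEquiv D.gr).toLinearMap

theorem sgn_of_mem {h g : ℤ} {a : A} (ha : a ∈ D.gr (h, g)) :
    D.sgn a = h.negOnePow • a := by
  let := D.graded
  have e : DirectSum.decompose D.gr a = DirectSum.lof k _ (fun i => D.gr i) (h, g) ⟨a, ha⟩ :=
    DirectSum.decompose_of_mem _ ha
  rw [sgn, LinearMap.comp_apply, LinearEquiv.coe_coe, DirectSum.decomposeLinearEquiv_apply, e,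
    DirectSum.toModule_lof]
  rfl

theorem leibniz' (a b : A) : D.d (a * b) = D.d a * b + D.sgn a * D.d b := by
  induction a using D.homogeneous_induction with
  | h0 => simp
  | hom h g a ha => rw [D.leibniz h g a b ha, D.sgn_of_mem ha, smul_mul_assoc]
  | hadd x y hx hy => simp only [add_mul, map_add, hx, hy]; abel

theorem sgn_sgn (a : A) : D.sgn (D.sgn a) = a := by
  induction a using D.homogeneous_induction with
  | h0 => simp
  | hom h g a ha =>
    have h2 : h.negOnePow • a ∈ D.gr (h, g) := by
      rw [Units.smul_def]; exact zsmul_mem ha _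
    rw [D.sgn_of_mem ha, D.sgn_of_mem h2, smul_smul, ← Int.negOnePow_add,
      Int.negOnePow_even _ (Even.add_self h), one_smul]
  | hadd x y hx hy => simp only [map_add, hx, hy]

theorem d_sgn (a : A) : D.d (D.sgn a) = - D.sgn (D.d a) := by
  induction a using D.homogeneous_induction with
  | h0 => simp
  | hom h g a ha =>
    rw [D.sgn_of_mem ha, D.sgn_of_mem (D.d_mem h g a ha), Units.smul_def, Units.smul_def, map_zsmul,
      Int.negOnePow_sub]
    simp
  | hadd x y hx hy => simp only [map_add, hx, hy]; abel

/-- The subalgebra `ker d` of cycles. -/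
def cycles : Subalgebra k A where
  carrier := {a | D.d a = 0}
  mul_mem' := by
    intro a b ha hb
    change D.d a = 0 at ha
    change D.d b = 0 at hb
    change D.d (a * b) = 0
    rw [D.leibniz', ha, hb]; simp
  add_mem' := by
    intro a b ha hb
    change D.d a = 0 at ha
    change D.d b = 0 at hb
    change D.d (a + b) = 0
    rw [map_add, ha, hb, add_zero]
  algebraMap_mem' := by
    intro r
    change D.d _ = 0
    simp only [Algebra.algebraMap_eq_smul_one, map_smul, D.d_one, smul_zero]

theorem mem_cycles {a : A} : a ∈ D.cycles ↔ D.d a = 0 := Iff.rfl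

/-- The two-sided ideal `im d` of boundaries in the algebra of cycles. -/
def boundaries : Ideal D.cycles where
  carrier := {z | ∃ a, D.d a = z}
  add_mem' := by
    rintro x y ⟨a, ha⟩ ⟨b, hb⟩
    exact ⟨a + b, by simp [ha, hb]⟩
  zero_mem' := ⟨0, by simp⟩
  smul_mem' := by
    rintro ⟨c, hc⟩ x ⟨a, ha⟩
    refine ⟨D.sgn c * a, ?_⟩
    rw [mem_cycles] at hc
    rw [D.leibniz', D.d_sgn, hc, D.sgn_sgn, ha]; simp

instance : D.boundaries.IsTwoSided where
  mul_mem_of_left := by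
    rintro x ⟨c, hc⟩ ⟨a, ha⟩
    refine ⟨a * c, ?_⟩
    rw [mem_cycles] at hc
    rw [D.leibniz', hc, ha]; simp

theorem mem_boundaries {z : D.cycles} : z ∈ D.boundaries ↔ ∃ a, D.d a = z := Iff.rfl

/-- The homology algebra `H(A, d) = ker d / im d`. -/
abbrev Homology : Type _ := D.cycles ⧸ D.boundaries

/-- The homogeneous components of the homology: the classes of the homogeneous cycles. -/
def homologyGr (i : ℤ × ℤ) : Submodule k D.Homology :=
  ((D.gr i).comap D.cycles.val.toLinearMap).map
    (Ideal.Quotient.mkₐ k D.boundaries).toLinearMap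

theorem mem_homologyGr {i : ℤ × ℤ} {x : D.Homology} :
    x ∈ D.homologyGr i ↔
      ∃ z : D.cycles, (z : A) ∈ D.gr i ∧ Ideal.Quotient.mk D.boundaries z = x := by
  simp [homologyGr, Submodule.mem_map]

/-- The projection of `A` onto a homogeneous component. -/
def proj (i : ℤ × ℤ) : A →ₗ[k] A :=
  letI := D.graded
  GradedAlgebra.proj D.gr i

theorem proj_of_mem {i : ℤ × ℤ} {a : A} (ha : a ∈ D.gr i) : D.proj i a = a := by
  let := D.graded
  simp [proj, GradedAlgebra.proj_apply, DirectSum.decompose_of_mem_same _ ha]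

theorem proj_of_mem_ne {i j : ℤ × ℤ} (hij : i ≠ j) {a : A} (ha : a ∈ D.gr i) :
    D.proj j a = 0 := by
  let := D.graded
  simp [proj, GradedAlgebra.proj_apply, DirectSum.decompose_of_mem_ne _ ha hij]

theorem proj_mem (i : ℤ × ℤ) (a : A) : D.proj i a ∈ D.gr i := by
  let := D.graded
  simp [proj, GradedAlgebra.proj_apply]

theorem d_proj (h g : ℤ) (a : A) : D.d (D.proj (h, g) a) = D.proj (h - 1, g) (D.d a) := by
  induction a using D.homogeneous_induction with
  | h0 => simp
  | hom h' g' a ha =>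
    have hd := D.d_mem h' g' a ha
    by_cases e : (h', g') = (h, g)
    · obtain ⟨rfl, rfl⟩ := Prod.mk.inj e
      rw [D.proj_of_mem ha, D.proj_of_mem hd]
    · have e' : (h' - 1, g') ≠ (h - 1, g) := by
        intro e'; apply e
        simp only [Prod.mk.injEq, sub_left_inj] at e' ⊢; exact e'
      rw [D.proj_of_mem_ne e ha, D.proj_of_mem_ne e' hd, map_zero]
  | hadd x y hx hy => simp only [map_add, hx, hy]

theorem sum_proj (a : A) : ∃ s : Finset (ℤ × ℤ), a = ∑ i ∈ s, D.proj i a := by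
  classical
  let := D.graded
  refine ⟨(DirectSum.decompose D.gr a).support, ?_⟩
  simpa [proj, GradedAlgebra.proj_apply] using (DirectSum.sum_support_decompose D.gr a).symm

/-- The projections on the homogeneous components of the homology. -/
def homologyProj (i : ℤ × ℤ) : D.Homology →+ D.Homology :=
  QuotientAddGroup.map D.boundaries.toAddSubgroup D.boundaries.toAddSubgroup
    { toFun := fun z => ⟨D.proj i z, by
        have hz := z.2
        rw [mem_cycles] at hz ⊢
        rw [show i = (i.1, i.2) from rfl, D.d_proj, hz, map_zero]⟩
      map_zero' := by ext; simp
      map_add' := by intro x y; ext; simp }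
    (by
      rintro ⟨z, hz⟩ ⟨a, ha⟩
      refine ⟨D.proj (i.1 + 1, i.2) a, ?_⟩
      rw [D.d_proj, ha]; simp)

theorem homologyProj_mk (i : ℤ × ℤ) (z z' : D.cycles) (h : (z' : A) = D.proj i z) :
    D.homologyProj i (Ideal.Quotient.mk D.boundaries z) = Ideal.Quotient.mk D.boundaries z' := by
  obtain ⟨z', hz'⟩ := z'
  subst h
  rfl

theorem homologyProj_of_mem {i : ℤ × ℤ} {x : D.Homology} (hx : x ∈ D.homologyGr i) :
    D.homologyProj i x = x := by
  obtain ⟨z, hz, rfl⟩ := D.mem_homologyGr.1 hx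
  exact D.homologyProj_mk i z z (D.proj_of_mem hz).symm

theorem homologyProj_of_mem_ne {i j : ℤ × ℤ} (hij : i ≠ j) {x : D.Homology}
    (hx : x ∈ D.homologyGr i) : D.homologyProj j x = 0 := by
  obtain ⟨z, hz, rfl⟩ := D.mem_homologyGr.1 hx
  rw [D.homologyProj_mk j z 0 (by simp [D.proj_of_mem_ne hij hz]), map_zero]

instance : SetLike.GradedMonoid D.homologyGr where
  one_mem := by
    let := D.graded
    exact D.mem_homologyGr.2 ⟨1, SetLike.GradedOne.one_mem, map_one _⟩
  mul_mem := by
    let := D.graded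
    rintro i j x y hx hy
    obtain ⟨z, hz, rfl⟩ := D.mem_homologyGr.1 hx
    obtain ⟨w, hw, rfl⟩ := D.mem_homologyGr.1 hy
    exact D.mem_homologyGr.2 ⟨z * w, SetLike.GradedMul.mul_mem hz hw, map_mul _ _ _⟩

theorem homologyGr_isInternal : DirectSum.IsInternal D.homologyGr := by
  classical
  constructor
  · intro x x' hx
    ext j
    have key : ∀ y : ⨁ i, D.homologyGr i,
        D.homologyProj j (DirectSum.coeAddMonoidHom D.homologyGr y) = y j := by
      intro y
      induction y using DirectSum.induction_on with
      | zero => rw [AddMonoidHom.map_zero, AddMonoidHom.map_zero]; rfl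
      | of i y =>
        rw [DirectSum.coeAddMonoidHom_of]
        by_cases e : i = j
        · subst e
          rw [D.homologyProj_of_mem y.2, DirectSum.of_eq_same]
        · rw [D.homologyProj_of_mem_ne e y.2, DirectSum.of_eq_of_ne _ _ _ (Ne.symm e)]
          simp
      | add x y hx hy =>
        rw [AddMonoidHom.map_add, AddMonoidHom.map_add, hx, hy]; rfl
    rw [← key, ← key]; exact congrArg _ hx
  · intro x
    obtain ⟨z, rfl⟩ := Ideal.Quotient.mk_surjective x
    obtain ⟨s, hs⟩ := D.sum_proj (z : A)
    have hc : ∀ i, D.proj i z ∈ D.cycles := by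
      intro i
      have hz := z.2
      rw [mem_cycles] at hz ⊢
      rw [show i = (i.1, i.2) from rfl, D.d_proj, hz, map_zero]
    have hz : z = ∑ i ∈ s, (⟨D.proj i z, hc i⟩ : D.cycles) := by
      ext; rw [AddSubmonoidClass.coe_finsetSum]; exact hs
    refine ⟨∑ i ∈ s, DirectSum.of (fun i => D.homologyGr i) i
      ⟨Ideal.Quotient.mk _ ⟨D.proj i z, hc i⟩, D.mem_homologyGr.2 ⟨_, D.proj_mem i z, rfl⟩⟩, ?_⟩
    rw [map_sum]
    simp only [DirectSum.coeAddMonoidHom_of]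
    conv_rhs => rw [hz]
    rw [map_sum]

/-- The homology is a graded algebra. -/
@[reducible]
def homologyGraded : GradedAlgebra D.homologyGr :=
  letI := D.homologyGr_isInternal.chooseDecomposition
  { }

/-- The homology as a dg-algebra with zero differential. -/
def homologyDG : DGAlgebra k D.Homology := ofGraded D.homologyGr D.homologyGraded

/-- A morphism of dg-algebras: an algebra map preserving the grading and commuting with the
differentials. -/
structure Hom (D : DGAlgebra k A) (E : DGAlgebra k B) where
  toAlgHom : A →ₐ[k] B
  map_gr : ∀ i a, a ∈ D.gr i → toAlgHom a ∈ E.gr i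
  map_d : ∀ a, toAlgHom (D.d a) = E.d (toAlgHom a)

variable {D} {E : DGAlgebra k B}

/-- The map induced on cycles. -/
def Hom.cyclesMap (f : Hom D E) : D.cycles →ₐ[k] E.cycles :=
  (f.toAlgHom.comp D.cycles.val).codRestrict E.cycles (by
    intro z
    have hz := z.2
    rw [mem_cycles] at hz ⊢
    simp [← f.map_d, hz])

/-- The map induced on homology. -/
def Hom.homologyMap (f : Hom D E) : D.Homology →ₐ[k] E.Homology :=
  Ideal.Quotient.liftₐ D.boundaries ((Ideal.Quotient.mkₐ k E.boundaries).comp f.cyclesMap) (by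
    rintro z ⟨a, ha⟩
    rw [AlgHom.comp_apply, Ideal.Quotient.mkₐ_eq_mk, Ideal.Quotient.eq_zero_iff_mem]
    refine ⟨f.toAlgHom a, ?_⟩
    rw [← f.map_d, ha]; rfl)

/-- A quasi-isomorphism: the induced map on homology is an isomorphism. -/
def Hom.IsQuasiIso (f : Hom D E) : Prop := Function.Bijective f.homologyMap

/-- Formality: there is a quasi-isomorphism `(A, d) → (H(A, d), 0)`. -/
def Formal (D : DGAlgebra k A) : Prop := ∃ f : Hom D D.homologyDG, f.IsQuasiIso

end DGAlgebra

/-! ## Graded algebras given by generators and relations -/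

section Presentation

variable {k : Type*} [CommRing k] {X : Type*} {A : Type*} [Ring A] [Algebra k A]

/-- The span of the words of total degree `i` in the elements `g x`, with `g x` of degree
`deg x`. -/
def wordGr (k : Type*) [CommRing k] {X : Type*} {A : Type*} [Ring A] [Algebra k A]
    (g : X → A) (deg : X → ℤ × ℤ) (i : ℤ × ℤ) : Submodule k A :=
  Submodule.span k {a | ∃ l : List X, (l.map deg).sum = i ∧ (l.map g).prod = a}

theorem word_mem_wordGr (g : X → A) (deg : X → ℤ × ℤ) (l : List X) :
    (l.map g).prod ∈ wordGr k g deg (l.map deg).sum :=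
  Submodule.subset_span ⟨l, rfl, rfl⟩

theorem gen_mem_wordGr (g : X → A) (deg : X → ℤ × ℤ) (x : X) : g x ∈ wordGr k g deg (deg x) := by
  simpa using word_mem_wordGr (k := k) g deg [x]

instance wordGr_gradedMonoid (g : X → A) (deg : X → ℤ × ℤ) :
    SetLike.GradedMonoid (wordGr k g deg) where
  one_mem := by simpa using word_mem_wordGr (k := k) g deg []
  mul_mem := by
    intro i j a b ha hb
    have h := Submodule.mul_mem_mul ha hb
    rw [wordGr, wordGr, Submodule.span_mul_span] at h
    refine Submodule.span_mono ?_ h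
    rintro _ ⟨_, ⟨l, rfl, rfl⟩, _, ⟨m, rfl, rfl⟩, rfl⟩
    exact ⟨l ++ m, by simp, by simp⟩

/-- `x` and `y` lie in a common homogeneous component. -/
def SameDegree (𝒜 : ℤ × ℤ → Submodule k A) (x y : A) : Prop := ∃ i, x ∈ 𝒜 i ∧ y ∈ 𝒜 i

/-- The algebra generated by `X` with relations `R`. -/
def Pres (k : Type*) [CommRing k] {X : Type*} (R : FreeAlgebra k X → FreeAlgebra k X → Prop) :
    Type _ := RingQuot R

namespace Pres

variable (R : FreeAlgebra k X → FreeAlgebra k X → Prop)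

instance : Ring (Pres k R) := inferInstanceAs (Ring (RingQuot R))

instance : Algebra k (Pres k R) := inferInstanceAs (Algebra k (RingQuot R))

/-- The quotient map. -/
def mk : FreeAlgebra k X →ₐ[k] Pres k R := RingQuot.mkAlgHom k R

/-- The generators. -/
def gen (x : X) : Pres k R := mk R (FreeAlgebra.ι k x)

variable {R} {C : Type*} [Semiring C] [Algebra k C]

theorem mk_rel {a b : FreeAlgebra k X} (h : R a b) : mk R a = mk R b :=
  RingQuot.mkAlgHom_rel k h

theorem mk_surjective : Function.Surjective (mk R) := RingQuot.mkAlgHom_surjective k R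

/-- The algebra map given by images of the generators that satisfy the relations. -/
def lift (F : FreeAlgebra k X →ₐ[k] C) (hF : ∀ ⦃a b⦄, R a b → F a = F b) : Pres k R →ₐ[k] C :=
  RingQuot.liftAlgHom k ⟨F, hF⟩

theorem lift_mk (F : FreeAlgebra k X →ₐ[k] C) (hF : ∀ ⦃a b⦄, R a b → F a = F b)
    (a : FreeAlgebra k X) : lift F hF (mk R a) = F a :=
  RingQuot.liftAlgHom_mkAlgHom_apply k F hF a

theorem lift_gen (F : FreeAlgebra k X →ₐ[k] C) (hF : ∀ ⦃a b⦄, R a b → F a = F b)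
    (x : X) : lift F hF (gen R x) = F (FreeAlgebra.ι k x) :=
  lift_mk F hF _

theorem hom_ext {f g : Pres k R →ₐ[k] C} (h : ∀ x, f (gen R x) = g (gen R x)) : f = g := by
  apply RingQuot.ringQuot_ext'
  apply FreeAlgebra.hom_ext
  funext x
  exact h x

end Pres

/-- The algebra with homogeneous relations `R` is graded. -/
@[reducible]
def Pres.graded (R : FreeAlgebra k X → FreeAlgebra k X → Prop) (deg : X → ℤ × ℤ)
    (hR : ∀ ⦃a b⦄, R a b → SameDegree (wordGr k (FreeAlgebra.ι k) deg) a b) :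
    GradedAlgebra (wordGr k (Pres.gen R) deg) := by
  classical
  let G := wordGr k (Pres.gen R) deg
  let F : FreeAlgebra k X →ₐ[k] ⨁ i, G i := FreeAlgebra.lift k fun x =>
    DirectSum.of (fun i => G i) (deg x) ⟨Pres.gen R x, gen_mem_wordGr _ _ x⟩
  have hw : ∀ l : List X, F (l.map (FreeAlgebra.ι k)).prod =
      DirectSum.of (fun i => G i) (l.map deg).sum
        ⟨(l.map (Pres.gen R)).prod, word_mem_wordGr _ _ l⟩ := by
    intro l
    induction l with
    | nil => rw [List.map_nil, List.prod_nil, map_one]; rfl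
    | cons x l ih =>
      rw [List.map_cons, List.prod_cons, map_mul, ih, FreeAlgebra.lift_ι_apply,
        DirectSum.of_mul_of]
      rfl
  have hm : ∀ i, ∀ a ∈ wordGr k (FreeAlgebra.ι k) deg i, ∃ h : Pres.mk R a ∈ G i,
      F a = DirectSum.of (fun i => G i) i ⟨Pres.mk R a, h⟩ := by
    intro i a ha
    induction ha using Submodule.span_induction with
    | mem a h =>
      obtain ⟨l, rfl, rfl⟩ := h
      have e : Pres.mk R (l.map (FreeAlgebra.ι k)).prod =
          (l.map (Pres.gen R)).prod := by
        rw [map_list_prod, List.map_map]; rfl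
      refine ⟨e ▸ word_mem_wordGr _ _ l, ?_⟩
      rw [hw]
      congr 1
      exact Subtype.ext e.symm
    | zero =>
      refine ⟨by rw [map_zero]; exact zero_mem _, ?_⟩
      rw [map_zero]
      exact ((congrArg _ (Subtype.ext (map_zero (Pres.mk R)))).trans
        (map_zero (DirectSum.of (fun i => G i) i))).symm
    | add a b _ _ ha hb =>
      obtain ⟨h1, e1⟩ := ha
      obtain ⟨h2, e2⟩ := hb
      refine ⟨by rw [map_add]; exact add_mem h1 h2, ?_⟩
      rw [map_add, e1, e2, ← map_add]
      exact congrArg _ (Subtype.ext (map_add (Pres.mk R) a b).symm)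
    | smul c a _ ha =>
      obtain ⟨h1, e1⟩ := ha
      refine ⟨by rw [map_smul]; exact Submodule.smul_mem _ c h1, ?_⟩
      rw [map_smul, e1, ← DirectSum.lof_eq_of k, ← DirectSum.lof_eq_of k, ← map_smul]
      exact congrArg _ (Subtype.ext (map_smul (Pres.mk R) c a).symm)
  have hF : ∀ ⦃a b⦄, R a b → F a = F b := by
    intro a b hab
    obtain ⟨i, ha, hb⟩ := hR hab
    obtain ⟨h1, e1⟩ := hm i a ha
    obtain ⟨h2, e2⟩ := hm i b hb
    rw [e1, e2]
    exact congrArg _ (Subtype.ext (Pres.mk_rel hab))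
  let f : Pres k R →ₐ[k] ⨁ i, G i := Pres.lift F hF
  have hf : ∀ a, f (Pres.mk R a) = F a := fun a => Pres.lift_mk F hF a
  refine GradedAlgebra.ofAlgHom G f ?_ ?_
  · apply Pres.hom_ext
    intro x
    simp only [AlgHom.comp_apply, Pres.gen, hf, F, FreeAlgebra.lift_ι_apply]
    rw [DirectSum.coeAlgHom_of]
    rfl
  · rintro i ⟨x, hx⟩
    change f x = _
    induction hx using Submodule.span_induction with
    | mem a h =>
      obtain ⟨l, rfl, rfl⟩ := h
      rw [← hw, ← hf, map_list_prod, map_list_prod, map_list_prod, List.map_map, List.map_map,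
        List.map_map]
      rfl
    | zero => rw [map_zero]; exact (map_zero (DirectSum.of (fun i => G i) i)).symm
    | add a b ha hb h1 h2 =>
      rw [map_add, h1, h2, ← map_add]; rfl
    | smul c a ha h1 =>
      rw [map_smul, h1, ← DirectSum.lof_eq_of k, ← DirectSum.lof_eq_of k, ← map_smul]; rfl

end Presentation

/-! ## Diagrams -/

namespace KLRW

/-- A strand is black, or red with a label `n : ℕ`. -/
inductive Strand
  | black
  | red (n : ℕ)
  deriving DecidableEq

/-- The label of a red strand. -/
def Strand.label? : Strand → Option ℕ
  | black => none
  | red n => some n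

open Strand

/-- `l` is a sequence of `b` black strands and of red strands labeled `Ns` from left to right. -/
def IsSeq (b : ℕ) (Ns : List ℕ) (l : List Strand) : Prop :=
  l.count black = b ∧ l.filterMap Strand.label? = Ns

/-- The sequences of `b` black strands and of red strands labeled `Ns` from left to right. -/
def seqs : ℕ → List ℕ → Finset (List Strand)
  | 0, [] => {[]}
  | b + 1, [] => (seqs b []).image (black :: ·)
  | 0, n :: Ns => (seqs 0 Ns).image (red n :: ·)
  | b + 1, n :: Ns => (seqs b (n :: Ns)).image (black :: ·) ∪ (seqs (b + 1) Ns).image (red n :: ·)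

theorem mem_seqs (l : List Strand) (b : ℕ) (Ns : List ℕ) : l ∈ seqs b Ns ↔ IsSeq b Ns l := by
  induction l generalizing b Ns with
  | nil => cases b <;> cases Ns <;> simp [seqs, IsSeq]
  | cons s l ih =>
    simp only [IsSeq] at ih
    cases s <;> cases b <;> cases Ns <;> simp [seqs, IsSeq, ih, Strand.label?]
    all_goals tauto

/-- The elementary diagrams without nails.  The lists `u` and `v` are the strands on the left
and on the right of the picture, which go straight up.  (The blue strand on the left of
everything is not recorded.) -/
inductive Gen
  /-- the identity diagram -/
  | idem (l : List Strand)
  /-- a dot on a black strand -/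
  | dot (u v : List Strand)
  /-- the crossing of two neighbouring black strands -/
  | bb (u v : List Strand)
  /-- the crossing of a black strand, on the left at the bottom, and a red strand -/
  | br (u : List Strand) (n : ℕ) (v : List Strand)
  /-- the crossing of a black strand, on the right at the bottom, and a red strand -/
  | rb (u : List Strand) (n : ℕ) (v : List Strand)

namespace Gen

/-- The strands at the bottom of a diagram. -/
def src : Gen → List Strand
  | idem l => l
  | dot u v => u ++ black :: v
  | bb u v => u ++ black :: black :: v
  | br u n v => u ++ black :: red n :: v
  | rb u n v => u ++ red n :: black :: v

/-- The strands at the top of a diagram. -/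
def tgt : Gen → List Strand
  | idem l => l
  | dot u v => u ++ black :: v
  | bb u v => u ++ black :: black :: v
  | br u n v => u ++ red n :: black :: v
  | rb u n v => u ++ black :: red n :: v

/-- Add vertical strands `w` on the left of a diagram. -/
def addLeft (w : List Strand) : Gen → Gen
  | idem l => idem (w ++ l)
  | dot u v => dot (w ++ u) v
  | bb u v => bb (w ++ u) v
  | br u n v => br (w ++ u) n v
  | rb u n v => rb (w ++ u) n v

/-- Add vertical strands `w` on the right of a diagram. -/
def addRight (w : List Strand) : Gen → Gen
  | idem l => idem (l ++ w)
  | dot u v => dot u (v ++ w)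
  | bb u v => bb u (v ++ w)
  | br u n v => br u n (v ++ w)
  | rb u n v => rb u n (v ++ w)

/-- The `q`-degree of a diagram. -/
def degQ : Gen → ℤ
  | idem _ => 0
  | dot _ _ => 2
  | bb _ _ => -2
  | br _ n _ => n
  | rb _ n _ => n

end Gen

open Gen

section Relations

variable {A : Type*} [Ring A]

/-- `k` dots on a black strand, with strands `u` on its left and `v` on its right. -/
def dots (x : Gen → A) (u : List Strand) (k : ℕ) (v : List Strand) : A :=
  x (idem (u ++ black :: v)) * x (dot u v) ^ k

/-- The defining relations of the (affine) KLRW algebra on `b` black strands and red strands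
labeled `Ns`, for elements `x g` of a ring.  A product is read from top to bottom: in
`x g * x h`, the diagram `g` is on top of `h`. -/
inductive LocalRel (b : ℕ) (Ns : List ℕ) (x : Gen → A) : A → A → Prop
  -- identity diagrams and composition
  | idem_mul_self (l : List Strand) : LocalRel b Ns x (x (idem l) * x (idem l)) (x (idem l))
  | idem_mul_ne (l m : List Strand) : l ≠ m → LocalRel b Ns x (x (idem l) * x (idem m)) 0
  | tgt_mul (g : Gen) : LocalRel b Ns x (x (idem g.tgt) * x g) (x g)
  | mul_src (g : Gen) : LocalRel b Ns x (x g * x (idem g.src)) (x g)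
  -- only diagrams with `b` black strands and red strands labeled `Ns`
  | one : LocalRel b Ns x (∑ l ∈ seqs b Ns, x (idem l)) 1
  | not_seq (l : List Strand) : ¬ IsSeq b Ns l → LocalRel b Ns x (x (idem l)) 0
  -- planar isotopy: diagrams side by side slide past each other
  | interchange (g h : Gen) : LocalRel b Ns x
      (x (g.addRight h.tgt) * x (h.addLeft g.src))
      (x (h.addLeft g.tgt) * x (g.addRight h.src))
  -- nilHecke relations
  | bb_sq (u v : List Strand) : LocalRel b Ns x (x (bb u v) * x (bb u v)) 0
  | braid (u v : List Strand) : LocalRel b Ns x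
      (x (bb u (black :: v)) * x (bb (u ++ [black]) v) * x (bb u (black :: v)))
      (x (bb (u ++ [black]) v) * x (bb u (black :: v)) * x (bb (u ++ [black]) v))
  | bb_dot (u v : List Strand) : LocalRel b Ns x
      (x (bb u v) * x (dot u (black :: v)))
      (x (dot (u ++ [black]) v) * x (bb u v) + x (idem (u ++ black :: black :: v)))
  | dot_bb (u v : List Strand) : LocalRel b Ns x
      (x (dot u (black :: v)) * x (bb u v))
      (x (bb u v) * x (dot (u ++ [black]) v) + x (idem (u ++ black :: black :: v)))
  -- dots slide through red strands
  | dot_rb (u : List Strand) (n : ℕ) (v : List Strand) : LocalRel b Ns x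
      (x (dot u (red n :: v)) * x (rb u n v))
      (x (rb u n v) * x (dot (u ++ [red n]) v))
  | br_dot (u : List Strand) (n : ℕ) (v : List Strand) : LocalRel b Ns x
      (x (br u n v) * x (dot u (red n :: v)))
      (x (dot (u ++ [red n]) v) * x (br u n v))
  -- double black/red crossings
  | br_rb (u : List Strand) (n : ℕ) (v : List Strand) : LocalRel b Ns x (x (br u n v) * x (rb u n v)) (dots x (u ++ [red n]) n v)
  | rb_br (u : List Strand) (n : ℕ) (v : List Strand) : LocalRel b Ns x (x (rb u n v) * x (br u n v)) (dots x u n (red n :: v))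
  -- black/black crossings slide through red strands
  | bb_rb_rb (u : List Strand) (n : ℕ) (v : List Strand) : LocalRel b Ns x
      (x (bb u (red n :: v)) * x (rb (u ++ [black]) n v) * x (rb u n (black :: v)))
      (x (rb (u ++ [black]) n v) * x (rb u n (black :: v)) * x (bb (u ++ [red n]) v))
  | br_br_bb (u : List Strand) (n : ℕ) (v : List Strand) : LocalRel b Ns x
      (x (br u n (black :: v)) * x (br (u ++ [black]) n v) * x (bb u (red n :: v)))
      (x (bb (u ++ [red n]) v) * x (br u n (black :: v)) * x (br (u ++ [black]) n v))
  -- a red strand slides through a black/black crossing up to a sum of dots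
  | rb_bb_br (u : List Strand) (n : ℕ) (v : List Strand) : LocalRel b Ns x
      (x (rb u n (black :: v)) * x (bb (u ++ [red n]) v) * x (br u n (black :: v)))
      (x (br (u ++ [black]) n v) * x (bb u (red n :: v)) * x (rb (u ++ [black]) n v) +
        ∑ i ∈ Finset.range n,
          dots x u i (red n :: black :: v) * dots x (u ++ [black, red n]) (n - 1 - i) v)

end Relations

/-! ## The KLRW algebra -/

/-- The relations of the KLRW algebra: the local ones and the violating condition, that a black
strand in the leftmost region is zero. -/
inductive Rel (k : Type*) [CommRing k] (b : ℕ) (Ns : List ℕ) :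
    FreeAlgebra k Gen → FreeAlgebra k Gen → Prop
  | loc {x y} : LocalRel b Ns (FreeAlgebra.ι k) x y → Rel k b Ns x y
  | violating (v : List Strand) : Rel k b Ns (FreeAlgebra.ι k (idem (black :: v))) 0

/-- The KLRW algebra `T_b^{Ns}` on `b` black strands and red strands labeled `Ns`. -/
abbrev Alg (k : Type*) [CommRing k] (b : ℕ) (Ns : List ℕ) : Type _ := Pres k (Rel k b Ns)

/-- The bidegree of a diagram without nails: the homological degree is zero. -/
def deg (g : Gen) : ℤ × ℤ := (0, g.degQ)

/-- The component of the KLRW algebra of homological degree `i.1` (nonzero only for `i.1 = 0`)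
and of `q`-degree `i.2`. -/
def gr (k : Type*) [CommRing k] (b : ℕ) (Ns : List ℕ) : ℤ × ℤ → Submodule k (Alg k b Ns) :=
  wordGr k (Pres.gen (Rel k b Ns)) deg

/-! ## The dg-enhanced KLRW algebra -/

/-- The elementary diagrams of the dg-enhanced KLRW algebra. -/
inductive DGGen
  /-- a diagram without nail -/
  | plain (g : Gen)
  /-- the leftmost black strand nailed on the blue strand, with strands `v` on its right -/
  | nail (v : List Strand)

open DGGen

/-- The relations of the dg-enhanced KLRW algebra. -/
inductive DGRel (k : Type*) [CommRing k] (b : ℕ) (Ns : List ℕ) :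
    FreeAlgebra k DGGen → FreeAlgebra k DGGen → Prop
  | loc {x y} : LocalRel b Ns (fun g => FreeAlgebra.ι k (plain g)) x y → DGRel k b Ns x y
  | tgt_nail (v : List Strand) : DGRel k b Ns
      (FreeAlgebra.ι k (plain (idem (black :: v))) * FreeAlgebra.ι k (nail v))
      (FreeAlgebra.ι k (nail v))
  | nail_src (v : List Strand) : DGRel k b Ns
      (FreeAlgebra.ι k (nail v) * FreeAlgebra.ι k (plain (idem (black :: v))))
      (FreeAlgebra.ι k (nail v))
  -- planar isotopy
  | interchange (g : Gen) : DGRel k b Ns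
      (FreeAlgebra.ι k (nail g.tgt) * FreeAlgebra.ι k (plain (g.addLeft [black])))
      (FreeAlgebra.ι k (plain (g.addLeft [black])) * FreeAlgebra.ι k (nail g.src))
  | dot_nail (v : List Strand) : DGRel k b Ns
      (FreeAlgebra.ι k (plain (dot [] v)) * FreeAlgebra.ι k (nail v))
      (FreeAlgebra.ι k (nail v) * FreeAlgebra.ι k (plain (dot [] v)))
  | nail_anticomm (v : List Strand) : DGRel k b Ns
      (FreeAlgebra.ι k (plain (bb [] v)) * FreeAlgebra.ι k (nail (black :: v)) *
        FreeAlgebra.ι k (plain (bb [] v)) * FreeAlgebra.ι k (nail (black :: v)))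
      (-(FreeAlgebra.ι k (nail (black :: v)) * FreeAlgebra.ι k (plain (bb [] v)) *
        FreeAlgebra.ι k (nail (black :: v)) * FreeAlgebra.ι k (plain (bb [] v))))
  | nail_sq (v : List Strand) : DGRel k b Ns (FreeAlgebra.ι k (nail v) * FreeAlgebra.ι k (nail v)) 0

/-- The dg-enhanced KLRW algebra `T_b^{λ,Ns}` on a blue strand, `b` black strands and red strands
labeled `Ns`. -/
abbrev DGAlg (k : Type*) [CommRing k] (b : ℕ) (Ns : List ℕ) : Type _ := Pres k (DGRel k b Ns)

namespace DGGen

/-- The homological degree. -/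
def degH : DGGen → ℤ
  | plain _ => 0
  | nail _ => 1

/-- The `(q, λ)`-degree. -/
def degQL : DGGen → ℤ × ℤ
  | plain g => (g.degQ, 0)
  | nail _ => (0, 2)

/-- The homological degree, and the `q`-degree after setting `λ = q ^ N`. -/
def deg (N : ℕ) (g : DGGen) : ℤ × ℤ := (g.degH, g.degQL.1 + g.degQL.2 * N)

end DGGen

/-- The homogeneous components of the dg-enhanced KLRW algebra, for `λ = q ^ N`. -/
def dgGr (k : Type*) [CommRing k] (b : ℕ) (Ns : List ℕ) (N : ℕ) :
    ℤ × ℤ → Submodule k (DGAlg k b Ns) :=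
  wordGr k (Pres.gen (DGRel k b Ns)) (DGGen.deg N)

instance (k : Type*) [CommRing k] (b : ℕ) (Ns : List ℕ) : SetLike.GradedMonoid (gr k b Ns) :=
  wordGr_gradedMonoid _ _

instance (k : Type*) [CommRing k] (b : ℕ) (Ns : List ℕ) (N : ℕ) :
    SetLike.GradedMonoid (dgGr k b Ns N) :=
  wordGr_gradedMonoid _ _

/-! ### The relations are homogeneous -/

section Homogeneous

variable {k : Type*} [CommRing k] {A : Type*} [Ring A] [Algebra k A]

theorem dots_mem (𝒜 : ℤ × ℤ → Submodule k A) [SetLike.GradedMonoid 𝒜] (x : Gen → A)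
    (hx : ∀ g, x g ∈ 𝒜 (deg g)) (u : List Strand) (m : ℕ) (v : List Strand) :
    dots x u m v ∈ 𝒜 (0, 2 * m) := by
  have h := SetLike.mul_mem_graded (hx (idem (u ++ black :: v)))
    (SetLike.pow_mem_graded m (hx (dot u v)))
  rw [dots]
  convert h using 2
  simp [deg, degQ, mul_comm]

theorem LocalRel.sameDegree (𝒜 : ℤ × ℤ → Submodule k A) [SetLike.GradedMonoid 𝒜] (x : Gen → A)
    (hx : ∀ g, x g ∈ 𝒜 (deg g)) {b Ns y z} (h : LocalRel b Ns x y z) : SameDegree 𝒜 y z := by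
  have h2 : ∀ {i : ℤ × ℤ} (g h), deg g + deg h = i → x g * x h ∈ 𝒜 i := by
    rintro i g h rfl; exact SetLike.mul_mem_graded (hx g) (hx h)
  have h3 : ∀ {i : ℤ × ℤ} (g h l), deg g + deg h + deg l = i → x g * x h * x l ∈ 𝒜 i := by
    rintro i g h l rfl
    exact SetLike.mul_mem_graded (SetLike.mul_mem_graded (hx g) (hx h)) (hx l)
  have h1 : ∀ {i : ℤ × ℤ} (g), deg g = i → x g ∈ 𝒜 i := by
    rintro i g rfl; exact hx g
  have hL : ∀ w (g : Gen), deg (g.addLeft w) = deg g := by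
    intro w g; cases g <;> rfl
  have hR : ∀ w (g : Gen), deg (g.addRight w) = deg g := by
    intro w g; cases g <;> rfl
  cases h with
  | idem_mul_self l => exact ⟨0, h2 _ _ rfl, h1 _ rfl⟩
  | idem_mul_ne l m _ => exact ⟨0, h2 _ _ rfl, zero_mem _⟩
  | tgt_mul g => exact ⟨deg g, h2 _ _ (zero_add _), hx g⟩
  | mul_src g => exact ⟨deg g, h2 _ _ (add_zero _), hx g⟩
  | one => exact ⟨0, sum_mem fun l _ => h1 _ rfl, SetLike.GradedOne.one_mem⟩
  | not_seq l _ => exact ⟨0, h1 _ rfl, zero_mem _⟩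
  | interchange g h =>
    exact ⟨deg g + deg h, h2 _ _ (by rw [hL, hR]), h2 _ _ (by rw [hL, hR, add_comm])⟩
  | bb_sq u v => exact ⟨_, h2 _ _ rfl, zero_mem _⟩
  | braid u v => exact ⟨_, h3 _ _ _ rfl, h3 _ _ _ rfl⟩
  | bb_dot u v => exact ⟨0, h2 _ _ rfl, add_mem (h2 _ _ rfl) (h1 _ rfl)⟩
  | dot_bb u v => exact ⟨0, h2 _ _ rfl, add_mem (h2 _ _ rfl) (h1 _ rfl)⟩
  | dot_rb u n v => exact ⟨_, h2 _ _ rfl, h2 _ _ (add_comm _ _)⟩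
  | br_dot u n v => exact ⟨_, h2 _ _ rfl, h2 _ _ (add_comm _ _)⟩
  | br_rb u n v =>
    exact ⟨(0, 2 * n), h2 _ _ (by simp [deg, degQ, two_mul]), dots_mem 𝒜 x hx _ _ _⟩
  | rb_br u n v =>
    exact ⟨(0, 2 * n), h2 _ _ (by simp [deg, degQ, two_mul]), dots_mem 𝒜 x hx _ _ _⟩
  | bb_rb_rb u n v =>
    exact ⟨_, h3 _ _ _ rfl, h3 _ _ _ (by simp only [deg, degQ, Prod.mk_add_mk]; congr 1; ring)⟩
  | br_br_bb u n v =>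
    exact ⟨_, h3 _ _ _ rfl, h3 _ _ _ (by simp only [deg, degQ, Prod.mk_add_mk]; congr 1; ring)⟩
  | rb_bb_br u n v =>
    refine ⟨(0, 2 * n - 2), h3 _ _ _ ?_, add_mem (h3 _ _ _ ?_) (sum_mem fun i hi => ?_)⟩
    · simp only [deg, degQ, Prod.mk_add_mk]; congr 1; ring
    · simp only [deg, degQ, Prod.mk_add_mk]; congr 1; ring
    · have h := SetLike.mul_mem_graded (dots_mem 𝒜 x hx u i (red n :: black :: v))
        (dots_mem 𝒜 x hx (u ++ [black, red n]) (n - 1 - i) v)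
      have hi' := Finset.mem_range.1 hi
      convert h using 2
      simp only [Prod.mk_add_mk, add_zero]
      congr 1
      push_cast [show i ≤ n - 1 by omega, show 1 ≤ n by omega]
      ring

end Homogeneous

theorem Rel.sameDegree (k : Type*) [CommRing k] (b : ℕ) (Ns : List ℕ) ⦃y z⦄
    (h : Rel k b Ns y z) : SameDegree (wordGr k (FreeAlgebra.ι k) deg) y z := by
  cases h with
  | loc h => exact h.sameDegree _ _ (fun g => gen_mem_wordGr _ _ g)
  | violating v => exact ⟨0, gen_mem_wordGr _ deg (idem (black :: v)), zero_mem _⟩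

theorem DGRel.sameDegree (k : Type*) [CommRing k] (b : ℕ) (Ns : List ℕ) (N : ℕ) ⦃y z⦄
    (h : DGRel k b Ns y z) :
    SameDegree (wordGr k (FreeAlgebra.ι k) (DGGen.deg N)) y z := by
  have hp : ∀ g, FreeAlgebra.ι k (plain g) ∈ wordGr k (FreeAlgebra.ι k) (DGGen.deg N) (deg g) := by
    intro g
    convert gen_mem_wordGr (k := k) (FreeAlgebra.ι k) (DGGen.deg N) (plain g) using 2
    simp [deg, DGGen.deg, degH, degQL]
  have hn : ∀ v, FreeAlgebra.ι k (nail v) ∈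
      wordGr k (FreeAlgebra.ι k) (DGGen.deg N) (1, 2 * N) := by
    intro v
    convert gen_mem_wordGr (k := k) (FreeAlgebra.ι k) (DGGen.deg N) (nail v) using 2
    simp [DGGen.deg, degH, degQL]
  have hL : ∀ w (g : Gen), deg (g.addLeft w) = deg g := by
    intro w g; cases g <;> rfl
  cases h with
  | loc h => exact h.sameDegree _ _ hp
  | tgt_nail v =>
    refine ⟨(1, 2 * N), ?_, hn v⟩
    simpa [deg, degQ] using SetLike.mul_mem_graded (hp (idem (black :: v))) (hn v)
  | nail_src v =>
    refine ⟨(1, 2 * N), ?_, hn v⟩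
    simpa [deg, degQ] using SetLike.mul_mem_graded (hn v) (hp (idem (black :: v)))
  | interchange g =>
    refine ⟨_, SetLike.mul_mem_graded (hn _) (hp _), ?_⟩
    rw [add_comm]
    exact SetLike.mul_mem_graded (hp _) (hn _)
  | dot_nail v =>
    refine ⟨_, SetLike.mul_mem_graded (hp _) (hn _), ?_⟩
    rw [add_comm]
    exact SetLike.mul_mem_graded (hn _) (hp _)
  | nail_anticomm v =>
    refine ⟨_, SetLike.mul_mem_graded (SetLike.mul_mem_graded (SetLike.mul_mem_graded
      (hp _) (hn _)) (hp _)) (hn _), neg_mem ?_⟩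
    have h := SetLike.mul_mem_graded (SetLike.mul_mem_graded (SetLike.mul_mem_graded
      (hn (black :: v)) (hp (bb [] v))) (hn (black :: v))) (hp (bb [] v))
    convert h using 2
    abel
  | nail_sq v => exact ⟨_, SetLike.mul_mem_graded (hn _) (hn _), zero_mem _⟩

/-- The KLRW algebra is graded. -/
@[reducible]
def graded (k : Type*) [CommRing k] (b : ℕ) (Ns : List ℕ) : GradedAlgebra (gr k b Ns) :=
  Pres.graded (Rel k b Ns) deg (Rel.sameDegree k b Ns)

/-- The KLRW algebra is concentrated in homological degree zero. -/
theorem gr_eq_bot (k : Type*) [CommRing k] (b : ℕ) (Ns : List ℕ) (h q : ℤ) (hh : h ≠ 0) :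
    gr k b Ns (h, q) = ⊥ := by
  rw [gr, wordGr, Submodule.span_eq_bot]
  rintro _ ⟨l, hl, -⟩
  have e : ∀ l : List Gen, (l.map deg).sum.1 = 0 := by
    intro l
    induction l with
    | nil => rfl
    | cons g l ih => simp [ih, deg]
  exact absurd ((congrArg Prod.fst hl).symm.trans (e l)) hh

/-- The dg-enhanced KLRW algebra is graded. -/
@[reducible]
def dgGraded (k : Type*) [CommRing k] (b : ℕ) (Ns : List ℕ) (N : ℕ) :
    GradedAlgebra (dgGr k b Ns N) :=
  Pres.graded (DGRel k b Ns) (DGGen.deg N) (DGRel.sameDegree k b Ns N)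

/-! ### The differential -/

section Differential

variable (k : Type*) [CommRing k] (b : ℕ) (Ns : List ℕ) (N : ℕ)

/-- The class of a diagram without nails. -/
def dgPlain (g : Gen) : DGAlg k b Ns := Pres.gen (DGRel k b Ns) (plain g)

/-- The class of a nail. -/
def dgNail (v : List Strand) : DGAlg k b Ns := Pres.gen (DGRel k b Ns) (nail v)

variable {k b Ns}

theorem dgPlain_rel {y z : FreeAlgebra k DGGen}
    (h : LocalRel b Ns (fun g => FreeAlgebra.ι k (plain g)) y z) :
    Pres.mk (DGRel k b Ns) y = Pres.mk (DGRel k b Ns) z :=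
  Pres.mk_rel (DGRel.loc h)

theorem dgPlain_idem_mul_self (l : List Strand) :
    dgPlain k b Ns (idem l) * dgPlain k b Ns (idem l) = dgPlain k b Ns (idem l) := by
  simpa [dgPlain, Pres.gen] using dgPlain_rel (k := k) (b := b) (Ns := Ns) (.idem_mul_self l)

theorem dgPlain_tgt_mul (g : Gen) :
    dgPlain k b Ns (idem g.tgt) * dgPlain k b Ns g = dgPlain k b Ns g := by
  simpa [dgPlain, Pres.gen] using dgPlain_rel (k := k) (b := b) (Ns := Ns) (.tgt_mul g)

theorem dgPlain_mul_src (g : Gen) :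
    dgPlain k b Ns g * dgPlain k b Ns (idem g.src) = dgPlain k b Ns g := by
  simpa [dgPlain, Pres.gen] using dgPlain_rel (k := k) (b := b) (Ns := Ns) (.mul_src g)

theorem dgPlain_interchange (g h : Gen) :
    dgPlain k b Ns (g.addRight h.tgt) * dgPlain k b Ns (h.addLeft g.src) =
      dgPlain k b Ns (h.addLeft g.tgt) * dgPlain k b Ns (g.addRight h.src) := by
  simpa [dgPlain, Pres.gen] using dgPlain_rel (k := k) (b := b) (Ns := Ns) (.interchange g h)

theorem dgPlain_bb_sq (u v : List Strand) :
    dgPlain k b Ns (bb u v) * dgPlain k b Ns (bb u v) = 0 := by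
  simpa [dgPlain, Pres.gen] using dgPlain_rel (k := k) (b := b) (Ns := Ns) (.bb_sq u v)

theorem dgPlain_bb_dot (u v : List Strand) :
    dgPlain k b Ns (bb u v) * dgPlain k b Ns (dot u (black :: v)) =
      dgPlain k b Ns (dot (u ++ [black]) v) * dgPlain k b Ns (bb u v) +
        dgPlain k b Ns (idem (u ++ black :: black :: v)) := by
  simpa [dgPlain, Pres.gen] using dgPlain_rel (k := k) (b := b) (Ns := Ns) (.bb_dot u v)

theorem dgPlain_dot_bb (u v : List Strand) :
    dgPlain k b Ns (dot u (black :: v)) * dgPlain k b Ns (bb u v) =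
      dgPlain k b Ns (bb u v) * dgPlain k b Ns (dot (u ++ [black]) v) +
        dgPlain k b Ns (idem (u ++ black :: black :: v)) := by
  simpa [dgPlain, Pres.gen] using dgPlain_rel (k := k) (b := b) (Ns := Ns) (.dot_bb u v)

theorem dgNail_tgt (v : List Strand) :
    dgPlain k b Ns (idem (black :: v)) * dgNail k b Ns v = dgNail k b Ns v := by
  simpa [dgPlain, dgNail, Pres.gen] using
    Pres.mk_rel (DGRel.tgt_nail (k := k) (b := b) (Ns := Ns) v)

theorem dgNail_src (v : List Strand) :
    dgNail k b Ns v * dgPlain k b Ns (idem (black :: v)) = dgNail k b Ns v := by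
  simpa [dgPlain, dgNail, Pres.gen] using
    Pres.mk_rel (DGRel.nail_src (k := k) (b := b) (Ns := Ns) v)

theorem dgNail_interchange (g : Gen) :
    dgNail k b Ns g.tgt * dgPlain k b Ns (g.addLeft [black]) =
      dgPlain k b Ns (g.addLeft [black]) * dgNail k b Ns g.src := by
  simpa [dgPlain, dgNail, Pres.gen] using
    Pres.mk_rel (DGRel.interchange (k := k) (b := b) (Ns := Ns) g)

theorem dgNail_dot (v : List Strand) :
    dgPlain k b Ns (dot [] v) * dgNail k b Ns v = dgNail k b Ns v * dgPlain k b Ns (dot [] v) := by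
  simpa [dgPlain, dgNail, Pres.gen] using
    Pres.mk_rel (DGRel.dot_nail (k := k) (b := b) (Ns := Ns) v)

theorem dgNail_anticomm (v : List Strand) :
    dgPlain k b Ns (bb [] v) * dgNail k b Ns (black :: v) * dgPlain k b Ns (bb [] v) *
        dgNail k b Ns (black :: v) =
      -(dgNail k b Ns (black :: v) * dgPlain k b Ns (bb [] v) * dgNail k b Ns (black :: v) *
        dgPlain k b Ns (bb [] v)) := by
  simpa [dgPlain, dgNail, Pres.gen] using
    Pres.mk_rel (DGRel.nail_anticomm (k := k) (b := b) (Ns := Ns) v)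

theorem dgNail_sq (v : List Strand) : dgNail k b Ns v * dgNail k b Ns v = 0 := by
  simpa [dgPlain, dgNail, Pres.gen] using
    Pres.mk_rel (DGRel.nail_sq (k := k) (b := b) (Ns := Ns) v)

variable (k b Ns)

/-- The value `d_N (nail)`: `N` dots on the leftmost strand. -/
def dgDots (v : List Strand) : DGAlg k b Ns := dots (dgPlain k b Ns) [] N v

variable {k b Ns}

theorem dgDots_interchange (g : Gen) :
    dgDots k b Ns N g.tgt * dgPlain k b Ns (g.addLeft [black]) =
      dgPlain k b Ns (g.addLeft [black]) * dgDots k b Ns N g.src := by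
  have h : ∀ m : ℕ, dgPlain k b Ns (dot [] g.tgt) ^ m * dgPlain k b Ns (g.addLeft [black]) =
      dgPlain k b Ns (g.addLeft [black]) * dgPlain k b Ns (dot [] g.src) ^ m := by
    intro m
    induction m with
    | zero => simp
    | succ m ih =>
      have := dgPlain_interchange (k := k) (b := b) (Ns := Ns) (dot [] []) g
      change dgPlain k b Ns (dot [] g.tgt) * dgPlain k b Ns (g.addLeft [black]) =
        dgPlain k b Ns (g.addLeft [black]) * dgPlain k b Ns (dot [] g.src) at this
      rw [pow_succ, mul_assoc, this, ← mul_assoc, ih, mul_assoc, ← pow_succ]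
  have ht : (black :: g.tgt) = (g.addLeft [black]).tgt := by cases g <;> rfl
  have hs : (black :: g.src) = (g.addLeft [black]).src := by cases g <;> rfl
  simp only [dgDots, dots, List.nil_append]
  rw [mul_assoc, h, ← mul_assoc, ← mul_assoc, ht, hs, dgPlain_tgt_mul, dgPlain_mul_src]

theorem dgDots_tgt (v : List Strand) :
    dgPlain k b Ns (idem (black :: v)) * dgDots k b Ns N v = dgDots k b Ns N v := by
  simp only [dgDots, dots, List.nil_append]
  rw [← mul_assoc, dgPlain_idem_mul_self]

theorem idem_dot_comm (u v : List Strand) :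
    Commute (dgPlain k b Ns (idem (u ++ black :: v))) (dgPlain k b Ns (dot u v)) := by
  have h1 := dgPlain_tgt_mul (k := k) (b := b) (Ns := Ns) (dot u v)
  have h2 := dgPlain_mul_src (k := k) (b := b) (Ns := Ns) (dot u v)
  exact h1.trans h2.symm

theorem dgDots_src (v : List Strand) :
    dgDots k b Ns N v * dgPlain k b Ns (idem (black :: v)) = dgDots k b Ns N v := by
  have h := (idem_dot_comm (k := k) (b := b) (Ns := Ns) [] v).pow_right N
  simp only [List.nil_append] at h
  simp only [dgDots, dots, List.nil_append]
  rw [mul_assoc, ← h.eq, ← mul_assoc, dgPlain_idem_mul_self]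

theorem dgDots_dot (v : List Strand) :
    Commute (dgDots k b Ns N v) (dgPlain k b Ns (dot [] v)) :=
  Commute.mul_left (idem_dot_comm [] v) ((Commute.refl _).pow_left N)

theorem dgDots_nail (v : List Strand) :
    dgNail k b Ns v * dgDots k b Ns N v = dgDots k b Ns N v * dgNail k b Ns v := by
  refine Commute.mul_right ?_ (Commute.pow_right ?_ N)
  · exact (dgNail_src v).trans (dgNail_tgt v).symm
  · exact (dgNail_dot v).symm

/-- An identity in rings that makes `d_N` compatible with the anticommutation of nails. -/
theorem nail_identity {A : Type*} [Ring A] (e t y x₁ x₂ : A) (ht : t * t = 0)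
    (het : e * t = t) (hte : t * e = t) (hey : e * y = y) (hye : y * e = y)
    (hex₁ : e * x₁ = x₁) (hex₂ : e * x₂ = x₂)
    (hxe₁ : x₁ * e = x₁) (hxe₂ : x₂ * e = x₂)
    (h1 : t * x₁ = x₂ * t + e) (h2 : x₁ * t = t * x₂ + e) (hx : x₁ * x₂ = x₂ * x₁)
    (hy₁ : y * x₁ = x₁ * y) (hy₂ : y * x₂ = x₂ * y) (N : ℕ) :
    t * (e * x₁ ^ N) * t * y - t * y * t * (e * x₁ ^ N) +
      ((e * x₁ ^ N) * t * y * t - y * t * (e * x₁ ^ N) * t) = 0 := by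
  obtain ⟨H, hH1, hH2, hHx, hHy⟩ : ∃ H : A, t * (e * x₁ ^ N) = (e * x₂ ^ N) * t + H ∧
      (e * x₁ ^ N) * t = t * (e * x₂ ^ N) + H ∧ x₁ * H = H * x₁ ∧ y * H = H * y := by
    induction N with
    | zero => exact ⟨0, by simp [het, hte], by simp [het, hte], by simp, by simp⟩
    | succ N ih =>
      obtain ⟨H, a1, a2, a3, a4⟩ := ih
      have c2 : Commute x₁ (e * x₂ ^ N) :=
        Commute.mul_right (hxe₁.trans hex₁.symm) (Commute.pow_right hx N)
      have c3 : Commute y (e * x₂ ^ N) :=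
        Commute.mul_right (hye.trans hey.symm) (Commute.pow_right hy₂ N)
      have c4 : Commute x₁ (e * x₁ ^ N) :=
        Commute.mul_right (hxe₁.trans hex₁.symm) (Commute.pow_right rfl N)
      have c5 : Commute x₂ (e * x₂ ^ N) :=
        Commute.mul_right (hxe₂.trans hex₂.symm) (Commute.pow_right rfl N)
      have c6 : (e * x₂ ^ N) * e = e * x₂ ^ N := by
        have c : Commute e (e * x₂ ^ N) :=
          Commute.mul_right rfl (Commute.pow_right (hex₂.trans hxe₂.symm) N)
        have hee : e * e * x₂ ^ N = e * x₂ ^ N := by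
          cases N with
          | zero =>
            have q : t * x₁ * e = t * x₁ := by rw [mul_assoc, hxe₁]
            rw [h1, add_mul, mul_assoc, hte] at q
            simpa using q
          | succ n => rw [pow_succ', mul_assoc, ← mul_assoc e x₂, hex₂, ← mul_assoc, hex₂]
        rw [← c.eq, ← mul_assoc, hee]
      have c7 : e * (e * x₂ ^ N) = e * x₂ ^ N := by
        have c : Commute e (e * x₂ ^ N) :=
          Commute.mul_right rfl (Commute.pow_right (hex₂.trans hxe₂.symm) N)
        rw [c.eq, c6]
      refine ⟨e * x₂ ^ N + H * x₁, ?_, ?_, ?_, ?_⟩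
      · rw [pow_succ, ← mul_assoc e, ← mul_assoc, a1, add_mul, mul_assoc, h1, mul_add, c6,
          ← mul_assoc, pow_succ, ← mul_assoc e]
        abel
      · rw [pow_succ, ← mul_assoc e, ← c4.eq, mul_assoc, a2, mul_add, ← mul_assoc, h2, add_mul, c7,
          mul_assoc, c5.eq, mul_assoc e, ← pow_succ, a3]
        abel
      · rw [mul_add, add_mul, c2.eq, ← mul_assoc, a3]
      · rw [mul_add, add_mul, c3.eq, ← mul_assoc, a4, mul_assoc H, hy₁, mul_assoc H]
  have hc : t * H = H * t := by
    have p1 : t * (e * x₁ ^ N) * t = H * t := by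
      rw [hH1, add_mul, mul_assoc, ht, mul_zero, zero_add]
    have p2 : t * (e * x₁ ^ N) * t = t * H := by
      rw [mul_assoc, hH2, mul_add, ← mul_assoc, ht, zero_mul, zero_add]
    rw [← p2, p1]
  have c3 : Commute y (e * x₂ ^ N) :=
    Commute.mul_right (hye.trans hey.symm) (Commute.pow_right hy₂ N)
  have q1 : t * (e * x₁ ^ N) * t * y = H * t * y := by
    rw [hH1, add_mul, mul_assoc _ t t, ht, mul_zero, zero_add]
  have q2 : t * y * t * (e * x₁ ^ N) = t * (e * x₂ ^ N) * y * t + H * t * y := by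
    rw [mul_assoc _ t, hH1, mul_add, ← mul_assoc, mul_assoc t y, c3.eq, ← mul_assoc t,
      mul_assoc t y H, hHy, ← mul_assoc t H, hc, ← mul_assoc]
  have q3 : (e * x₁ ^ N) * t * y * t = t * (e * x₂ ^ N) * y * t + H * y * t := by
    rw [hH2, add_mul, add_mul]
  have q4 : y * t * (e * x₁ ^ N) * t = H * y * t := by
    rw [mul_assoc y, hH1, mul_assoc, add_mul, mul_assoc _ t t, ht, mul_zero, zero_add, ← mul_assoc,
      hHy]
  rw [q1, q2, q3, q4]
  abel

theorem dgNail_anticomm_d (v : List Strand) :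
    dgPlain k b Ns (bb [] v) * dgDots k b Ns N (black :: v) * dgPlain k b Ns (bb [] v) *
        dgNail k b Ns (black :: v) -
      dgPlain k b Ns (bb [] v) * dgNail k b Ns (black :: v) * dgPlain k b Ns (bb [] v) *
        dgDots k b Ns N (black :: v) +
      (dgDots k b Ns N (black :: v) * dgPlain k b Ns (bb [] v) * dgNail k b Ns (black :: v) *
        dgPlain k b Ns (bb [] v) -
      dgNail k b Ns (black :: v) * dgPlain k b Ns (bb [] v) * dgDots k b Ns N (black :: v) *
        dgPlain k b Ns (bb [] v)) = 0 := by
  refine nail_identity (dgPlain k b Ns (idem (black :: black :: v))) _ _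
    (dgPlain k b Ns (dot [] (black :: v))) (dgPlain k b Ns (dot [black] v))
    (dgPlain_bb_sq _ _) (dgPlain_tgt_mul (bb [] v)) (dgPlain_mul_src (bb [] v))
    (dgNail_tgt _) (dgNail_src _) (dgPlain_tgt_mul (dot [] (black :: v)))
    (dgPlain_tgt_mul (dot [black] v)) (dgPlain_mul_src (dot [] (black :: v)))
    (dgPlain_mul_src (dot [black] v)) (dgPlain_bb_dot [] v) (dgPlain_dot_bb [] v)
    (dgPlain_interchange (dot [] []) (dot [] v)) (dgNail_dot _).symm
    (dgNail_interchange (dot [] v)) N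

/-- The images of the generators under `a ↦ [[(-1) ^ h a, d a], [0, a]]`, an algebra map whose
multiplicativity is the graded Leibniz rule. -/
def dgMatGen : DGGen → Matrix (Fin 2) (Fin 2) (DGAlg k b Ns)
  | plain g => !![dgPlain k b Ns g, 0; 0, dgPlain k b Ns g]
  | nail v => !![-dgNail k b Ns v, dgDots k b Ns N v; 0, dgNail k b Ns v]

theorem LocalRel.scalar {A F : Type*} [Ring A] [Ring F] (p : F →+* A)
    (q : F →+* Matrix (Fin 2) (Fin 2) A) (x : Gen → F)
    (h : ∀ g, q (x g) = Matrix.scalar (Fin 2) (p (x g))) {y z : F} (hr : LocalRel b Ns x y z) :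
    q y = Matrix.scalar (Fin 2) (p y) ∧ q z = Matrix.scalar (Fin 2) (p z) := by
  cases hr <;>
    simp only [dots, map_mul, map_add, map_sum, map_one, map_zero, map_pow, h, and_self]

theorem dgMat_rel ⦃y z : FreeAlgebra k DGGen⦄ (h : DGRel k b Ns y z) :
    FreeAlgebra.lift k (dgMatGen (k := k) (b := b) (Ns := Ns) N) y =
      FreeAlgebra.lift k (dgMatGen (k := k) (b := b) (Ns := Ns) N) z := by
  cases h with
  | loc h =>
    obtain ⟨h1, h2⟩ := LocalRel.scalar
      (Pres.mk (DGRel k b Ns) : FreeAlgebra k DGGen →+* DGAlg k b Ns)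
      (FreeAlgebra.lift k (dgMatGen (k := k) (b := b) (Ns := Ns) N) :
        FreeAlgebra k DGGen →+* _) _
      (fun g => by
        simp only [RingHom.coe_coe, FreeAlgebra.lift_ι_apply, dgMatGen]
        ext i j
        fin_cases i <;> fin_cases j <;> simp [dgPlain, Pres.gen]) h
    simp only [RingHom.coe_coe] at h1 h2
    rw [h1, h2, dgPlain_rel h]
  | tgt_nail v =>
    simp [dgMatGen, dgNail_tgt, dgDots_tgt]
  | nail_src v =>
    simp [dgMatGen, dgNail_src, dgDots_src]
  | interchange g =>
    simp [dgMatGen, dgNail_interchange, dgDots_interchange]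
  | dot_nail v =>
    simp [dgMatGen, dgNail_dot, (dgDots_dot N v).eq]
  | nail_anticomm v =>
    have h := dgNail_anticomm_d (k := k) (b := b) (Ns := Ns) N v
    have h' := dgNail_anticomm (k := k) (b := b) (Ns := Ns) v
    have e : dgPlain k b Ns (bb [] v) * dgDots k b Ns N (black :: v) * dgPlain k b Ns (bb [] v) *
        dgNail k b Ns (black :: v) -
      dgPlain k b Ns (bb [] v) * dgNail k b Ns (black :: v) * dgPlain k b Ns (bb [] v) *
        dgDots k b Ns N (black :: v) =
      -(dgDots k b Ns N (black :: v) * dgPlain k b Ns (bb [] v) * dgNail k b Ns (black :: v) *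
        dgPlain k b Ns (bb [] v) -
      dgNail k b Ns (black :: v) * dgPlain k b Ns (bb [] v) * dgDots k b Ns N (black :: v) *
        dgPlain k b Ns (bb [] v)) := eq_neg_of_add_eq_zero_left h
    simp only [map_mul, map_neg, FreeAlgebra.lift_ι_apply, dgMatGen, Matrix.mul_fin_two]
    ext i j
    fin_cases i <;> fin_cases j <;> simp
    · exact h'
    · rw [neg_add_eq_sub, e, add_mul]
      simp [sub_eq_add_neg, add_comm]
    · exact h'
  | nail_sq v =>
    simp [dgMatGen, dgNail_sq, dgDots_nail]
    ext i j
    fin_cases i <;> fin_cases j <;> simp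

variable (k b Ns)

/-- The algebra map `a ↦ [[(-1) ^ h a, d a], [0, a]]`. -/
def dgMat : DGAlg k b Ns →ₐ[k] Matrix (Fin 2) (Fin 2) (DGAlg k b Ns) :=
  Pres.lift (FreeAlgebra.lift k (dgMatGen N)) (dgMat_rel N)

/-- The differential `d_N` of the dg-enhanced KLRW algebra: zero on diagrams without nails, `N`
dots on a nail, and extended by the graded Leibniz rule. -/
def dgD : DGAlg k b Ns →ₗ[k] DGAlg k b Ns :=
  (Matrix.entryLinearMap k (DGAlg k b Ns) 0 1) ∘ₗ (dgMat k b Ns N).toLinearMap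

variable {k b Ns}

theorem dgD_apply (a : DGAlg k b Ns) : dgD k b Ns N a = dgMat k b Ns N a 0 1 := rfl

theorem dgMat_plain (g : Gen) : dgMat k b Ns N (dgPlain k b Ns g) =
    !![dgPlain k b Ns g, 0; 0, dgPlain k b Ns g] := by
  rw [dgMat, dgPlain, Pres.lift_gen, FreeAlgebra.lift_ι_apply]; rfl

theorem dgMat_nail (v : List Strand) : dgMat k b Ns N (dgNail k b Ns v) =
    !![-dgNail k b Ns v, dgDots k b Ns N v; 0, dgNail k b Ns v] := by
  rw [dgMat, dgNail, Pres.lift_gen, FreeAlgebra.lift_ι_apply]; rfl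

/-- `d_N` is zero on diagrams without nails. -/
theorem dgD_plain (g : Gen) : dgD k b Ns N (dgPlain k b Ns g) = 0 := by
  rw [dgD_apply, dgMat_plain]; rfl

/-- `d_N` sends a nail to `N` dots. -/
theorem dgD_nail (v : List Strand) :
    dgD k b Ns N (dgNail k b Ns v) = dots (dgPlain k b Ns) [] N v := by
  rw [dgD_apply, dgMat_nail]; rfl

theorem dgMat_gen (g : DGGen) :
    dgMat k b Ns N (Pres.gen (DGRel k b Ns) g) 1 0 = 0 ∧
    dgMat k b Ns N (Pres.gen (DGRel k b Ns) g) 1 1 = Pres.gen (DGRel k b Ns) g ∧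
    dgMat k b Ns N (Pres.gen (DGRel k b Ns) g) 0 0 =
      g.degH.negOnePow • Pres.gen (DGRel k b Ns) g := by
  cases g with
  | plain g =>
    have h := dgMat_plain (k := k) (b := b) (Ns := Ns) N g
    rw [dgPlain] at h
    rw [h]
    simp [degH]
  | nail v =>
    have h := dgMat_nail (k := k) (b := b) (Ns := Ns) N v
    rw [dgNail] at h
    rw [h]
    simp [degH, Units.smul_def]

theorem dgMat_word (l : List DGGen) :
    dgMat k b Ns N (l.map (Pres.gen (DGRel k b Ns))).prod 1 0 = 0 ∧
    dgMat k b Ns N (l.map (Pres.gen (DGRel k b Ns))).prod 1 1 =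
      (l.map (Pres.gen (DGRel k b Ns))).prod ∧
    dgMat k b Ns N (l.map (Pres.gen (DGRel k b Ns))).prod 0 0 =
      (l.map (DGGen.deg N)).sum.1.negOnePow • (l.map (Pres.gen (DGRel k b Ns))).prod := by
  induction l with
  | nil => simp
  | cons g l ih =>
    obtain ⟨h1, h2, h3⟩ := ih
    obtain ⟨g1, g2, g3⟩ := dgMat_gen (k := k) (b := b) (Ns := Ns) N g
    simp only [List.map_cons, List.prod_cons, map_mul, List.sum_cons, Prod.fst_add,
      Matrix.mul_apply, Fin.sum_univ_two]
    refine ⟨?_, ?_, ?_⟩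
    · rw [g1, h1]; simp
    · rw [g1, g2, h2]; simp
    · rw [h1, h3, g3, Int.negOnePow_add]
      rw [mul_zero, add_zero, smul_mul_smul_comm]
      rfl

theorem dgMat_of_mem {h q : ℤ} {a : DGAlg k b Ns} (ha : a ∈ dgGr k b Ns N (h, q)) :
    dgMat k b Ns N a 0 0 = h.negOnePow • a ∧ dgMat k b Ns N a 1 0 = 0 ∧
      dgMat k b Ns N a 1 1 = a := by
  induction ha using Submodule.span_induction with
  | mem a ha =>
    obtain ⟨l, hl, rfl⟩ := ha
    obtain ⟨h1, h2, h3⟩ := dgMat_word (k := k) (b := b) (Ns := Ns) N l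
    rw [hl] at h3
    exact ⟨h3, h1, h2⟩
  | zero => simp
  | add x y _ _ hx hy =>
    simp only [map_add, Matrix.add_apply, hx, hy, smul_add, add_zero, and_self]
  | smul c x _ hx =>
    simp only [map_smul, Matrix.smul_apply, hx, smul_zero, and_self, and_true]
    exact smul_comm _ _ _

/-- The graded Leibniz rule. -/
theorem dgD_mul (h q : ℤ) (x y : DGAlg k b Ns) (hx : x ∈ dgGr k b Ns N (h, q)) :
    dgD k b Ns N (x * y) = dgD k b Ns N x * y + h.negOnePow • (x * dgD k b Ns N y) := by
  obtain ⟨h1, -, -⟩ := dgMat_of_mem N hx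
  have h2 : dgMat k b Ns N y 1 1 = y := by
    let _ := dgGraded k b Ns N
    refine DirectSum.Decomposition.inductionOn (dgGr k b Ns N) ?_ ?_ ?_ y
    · simp
    · rintro ⟨h, q⟩ m
      exact (dgMat_of_mem N m.2).2.2
    · intro m m' e e'
      rw [map_add, Matrix.add_apply, e, e']
  simp only [dgD_apply, map_mul, Matrix.mul_apply, Fin.sum_univ_two, h1, h2]
  rw [add_comm, smul_mul_assoc]

theorem dgPlain_mem (g : Gen) : dgPlain k b Ns g ∈ dgGr k b Ns N (deg g) := by
  have h := gen_mem_wordGr (k := k) (Pres.gen (DGRel k b Ns)) (DGGen.deg N) (plain g)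
  have e : DGGen.deg N (plain g) = deg g := by simp [DGGen.deg, deg, degH, degQL]
  rw [e] at h
  exact h

theorem dgD_gen_mem (g : DGGen) : dgD k b Ns N (Pres.gen (DGRel k b Ns) g) ∈
    dgGr k b Ns N ((DGGen.deg N g).1 - 1, (DGGen.deg N g).2) := by
  cases g with
  | plain g =>
    have h := dgD_plain (k := k) (b := b) (Ns := Ns) N g
    rw [dgPlain] at h
    rw [h]
    exact zero_mem _
  | nail v =>
    have h := dgD_nail (k := k) (b := b) (Ns := Ns) N v
    rw [dgNail] at h
    rw [h]
    have h := dots_mem (dgGr k b Ns N) (dgPlain k b Ns) (dgPlain_mem N) [] N v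
    simpa [DGGen.deg, degH, degQL] using h

theorem dgD_one : dgD k b Ns N 1 = 0 := by
  rw [dgD_apply, map_one]; rfl

theorem dgD_mem (h q : ℤ) (a : DGAlg k b Ns) (ha : a ∈ dgGr k b Ns N (h, q)) :
    dgD k b Ns N a ∈ dgGr k b Ns N (h - 1, q) := by
  have hw : ∀ l : List DGGen, dgD k b Ns N (l.map (Pres.gen (DGRel k b Ns))).prod ∈
      dgGr k b Ns N ((l.map (DGGen.deg N)).sum.1 - 1, (l.map (DGGen.deg N)).sum.2) := by
    intro l
    induction l with
    | nil =>
      simp only [List.map_nil, List.prod_nil, dgD_one]; exact zero_mem _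
    | cons g l ih =>
      have hg := gen_mem_wordGr (k := k) (Pres.gen (DGRel k b Ns)) (DGGen.deg N) g
      have hl := word_mem_wordGr (k := k) (Pres.gen (DGRel k b Ns)) (DGGen.deg N) l
      simp only [List.map_cons, List.prod_cons, List.sum_cons]
      rw [dgD_mul N (DGGen.deg N g).1 (DGGen.deg N g).2 _ _ hg]
      refine add_mem ?_ ?_
      · have := SetLike.mul_mem_graded (A := dgGr k b Ns N) (dgD_gen_mem N g) hl
        convert this using 2
        ext <;> simp
        ring
      · rw [Units.smul_def]
        refine zsmul_mem ?_ _
        have := SetLike.mul_mem_graded (A := dgGr k b Ns N) hg ih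
        convert this using 2
        ext <;> simp
        ring
  induction ha using Submodule.span_induction with
  | mem a ha =>
    obtain ⟨l, hl, rfl⟩ := ha
    have := hw l
    rw [hl] at this
    exact this
  | zero => rw [map_zero]; exact zero_mem _
  | add x y _ _ hx hy => rw [map_add]; exact add_mem hx hy
  | smul c x _ hx => rw [map_smul]; exact Submodule.smul_mem _ c hx

theorem dgD_dots (u : List Strand) (m : ℕ) (v : List Strand) :
    dgD k b Ns N (dots (dgPlain k b Ns) u m v) = 0 := by
  have h : ∀ g, dgMat k b Ns N (dgPlain k b Ns g) =
      Matrix.scalar (Fin 2) (dgPlain k b Ns g) := by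
    intro g
    rw [dgMat_plain]
    ext i j
    fin_cases i <;> fin_cases j <;> simp
  rw [dgD_apply, dots, map_mul, map_pow, h, h, ← map_pow, ← map_mul]
  simp

theorem dgD_dgD (a : DGAlg k b Ns) : dgD k b Ns N (dgD k b Ns N a) = 0 := by
  have hg : ∀ g, dgD k b Ns N (dgD k b Ns N (Pres.gen (DGRel k b Ns) g)) = 0 := by
    intro g
    cases g with
    | plain g =>
      have h := dgD_plain (k := k) (b := b) (Ns := Ns) N g
      rw [dgPlain] at h
      rw [h, map_zero]
    | nail v =>
      have h := dgD_nail (k := k) (b := b) (Ns := Ns) N v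
      rw [dgNail] at h
      rw [h, dgD_dots]
  have hw : ∀ l : List DGGen,
      dgD k b Ns N (dgD k b Ns N (l.map (Pres.gen (DGRel k b Ns))).prod) = 0 := by
    intro l
    induction l with
    | nil => rw [List.map_nil, List.prod_nil, dgD_one, map_zero]
    | cons g l ih =>
      have hg' := gen_mem_wordGr (k := k) (Pres.gen (DGRel k b Ns)) (DGGen.deg N) g
      rw [List.map_cons, List.prod_cons,
        dgD_mul N (DGGen.deg N g).1 (DGGen.deg N g).2 _ _ hg', map_add,
        dgD_mul N _ _ _ _ (dgD_gen_mem N g), hg, Units.smul_def, Units.smul_def, map_zsmul,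
        dgD_mul N (DGGen.deg N g).1 (DGGen.deg N g).2 _ _ hg', ih, Int.negOnePow_sub]
      simp
  let _ := dgGraded k b Ns N
  refine DirectSum.Decomposition.inductionOn (dgGr k b Ns N) (by simp) ?_ ?_ a
  · rintro i ⟨m, hm⟩
    change dgD k b Ns N (dgD k b Ns N m) = 0
    induction hm using Submodule.span_induction with
    | mem a ha =>
      obtain ⟨l, -, rfl⟩ := ha
      exact hw l
    | zero => simp
    | add x y _ _ hx hy => rw [map_add, map_add, hx, hy, add_zero]
    | smul c x _ hx => rw [map_smul, map_smul, hx, smul_zero]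
  · intro m m' e e'
    rw [map_add, map_add, e, e', add_zero]

end Differential

/-- The dg-algebra `(T_b^{λ,Ns}, d_N)`. -/
def dgKLRW (k : Type*) [CommRing k] (b : ℕ) (Ns : List ℕ) (N : ℕ) :
    DGAlgebra k (DGAlg k b Ns) where
  gr := dgGr k b Ns N
  graded := dgGraded k b Ns N
  d := dgD k b Ns N
  d_mem := dgD_mem N
  leibniz := dgD_mul N
  d_d := dgD_dgD N

end KLRW

end

/-!
The algebra `T` with blue strand `λ` is cut into columns `T * e_l`, one for each sequence `l` of
strands at the bottom.  A column is a complex of right modules over the polynomial ring in the dots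
on the black strands of `l`, since these dots are cycles of homological degree zero.  The homology
vanishes in nonzero degrees for three reasons.

* The column is free over this polynomial ring.  A basis is given by words in crossings and nails,
  in which each strand in turn goes left, possibly via a nail.  The words span because the relations
  reorder any product up to products with fewer crossings (`CrossingRelations.mem_span`).  They are
  independent because the algebra acts by divided difference operators and exterior multiplications
  on functions on the arrangements of the strands, with coefficients in the total fraction ring of a
  polynomial ring (`linearIndependent_word`, `linearIndependent_wordVec`).  In the basis words each
  black strand is nailed at most once, so the complex is bounded.
* Some power of every dot is a boundary (`exists_dots_mem`).  On the leftmost strand, `N` dots are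
  the boundary of a nail.  This passes to the next black strand by divided differences, and across a
  red strand by a double crossing.
* The dots form a regular sequence on a free module.  A bounded complex on whose homology each
  member of a regular sequence acts nilpotently is exact in degrees above its top degree minus the
  length of the sequence, by induction on this length (`exact_of_isWeaklyRegular_of_nilpotent`).  As
  the degrees in the column are at most the number of dots, it is exact in positive degrees.

So the homology consists of the diagrams without nails, modulo `N` dots on the leftmost strand
(`dg_exact`).  Turning the blue strand into a red strand labeled `N` gives a map to the KLRW algebra
of `(N, N_1, …, N_r)` (`toAlg`), where `N` dots on the leftmost black strand are a double crossing
with the new red strand, hence zero.  Conversely the KLRW algebra maps to the homology by removal of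
its leftmost red strand (`algToHomology`), and this is inverse to the map induced by `toAlg`.  The
composite `toHomology` of `toAlg` and `algToHomology` is a map of dg-algebras which sends
each cycle to its class, so that the dg-algebra is formal.
-/

noncomputable section

/-! ### Complexes with nilpotent homology -/

open RingTheory.Sequence in
/-- Distinct variables form a weakly regular sequence: the ideal of the earlier ones is monomial,
and a monomial that contains one of them after multiplication by another variable contained it
before. -/
theorem MvPolynomial.isWeaklyRegular_map_X {k σ : Type*} [CommRing k] (l : List σ)
    (hl : l.Nodup) : IsWeaklyRegular (MvPolynomial σ k)
      (l.map (MvPolynomial.X : σ → MvPolynomial σ k)) := by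
  constructor
  intro i hi
  rw [List.length_map] at hi
  rw [isSMulRegular_quotient_iff_mem_of_smul_mem]
  have hI : (Ideal.ofList ((l.map (X : σ → MvPolynomial σ k)).take i) • ⊤ :
      Submodule (MvPolynomial σ k) (MvPolynomial σ k)) =
      Ideal.span ((X : σ → MvPolynomial σ k) '' {s | s ∈ l.take i}) := by
    rw [smul_eq_mul, Ideal.mul_top, Ideal.ofList]
    congr 1
    ext x
    simp only [← List.map_take, Set.mem_ofPred_eq, List.mem_map, Set.mem_image]
  rw [hI]
  intro p hp
  rw [mem_ideal_span_X_image] at hp ⊢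
  intro m hm
  simp only [List.getElem_map, smul_eq_mul] at hp
  have h1 : m + Finsupp.single l[i] 1 ∈ (X l[i] * p).support := by
    rw [mem_support_iff] at hm ⊢
    rwa [mul_comm, coeff_mul_X]
  obtain ⟨s, hs, hs'⟩ := hp _ h1
  refine ⟨s, hs, ?_⟩
  have hne : l[i] ≠ s := by
    rintro rfl
    obtain ⟨j, hj, e⟩ := List.mem_take_iff_getElem.1 hs
    have := (hl.getElem_inj_iff).1 e
    omega
  simpa [Finsupp.single_apply, hne] using hs'

open RingTheory.Sequence in
theorem RingTheory.Sequence.IsWeaklyRegular.of_flat_module {R M : Type*} [CommRing R]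
    [AddCommGroup M] [Module R M] [Module.Flat R M] {rs : List R}
    (h : IsWeaklyRegular R rs) : IsWeaklyRegular M rs :=
  (LinearEquiv.isWeaklyRegular_congr (TensorProduct.lid R M) rs).1
    (IsWeaklyRegular.isWeaklyRegular_rTensor h)

open RingTheory.Sequence in
/-- A complex `M`, zero in degrees above `c + n`, is exact in degrees above `c` if a sequence of
length `n` is weakly regular on each term and some power of each member annihilates each homology
class. The complex `M / r M` for the first member `r` satisfies the same assumptions for `c + 1` and
the remaining members, so it is exact in degrees above `c + 1`. Hence `r` is injective on the
homology of `M` in degrees above `c`, and being nilpotent there, it shows that this homology is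
zero. -/
theorem exact_of_isWeaklyRegular_of_nilpotent {R : Type*} [CommRing R] (rs : List R) :
    ∀ (M : ℤ → Type*) [∀ i, AddCommGroup (M i)] [∀ i, Module R (M i)]
      (d : ∀ i, M (i + 1) →ₗ[R] M i) (_ : ∀ i x, d i (d (i + 1) x) = 0) (c : ℤ)
      (_ : ∀ i, c + rs.length < i → Subsingleton (M i))
      (_ : ∀ i, IsWeaklyRegular (M i) rs)
      (_ : ∀ r ∈ rs, ∀ i z, d i z = 0 → ∃ (t : ℕ) (y : M (i + 1 + 1)), r ^ t • z = d (i + 1) y)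
      (i : ℤ) (_ : c < i + 1) (z : M (i + 1)) (_ : d i z = 0), ∃ y, z = d (i + 1) y := by
  induction rs with
  | nil =>
    intro M _ _ d hd c hc _ _ i hi z _
    have := hc (i + 1) (by simpa using hi)
    exact ⟨0, Subsingleton.elim _ _⟩
  | cons r rs ih =>
    intro M _ _ d hd c hc hreg hnil i hi z hz
    simp only [isWeaklyRegular_cons_iff] at hreg
    have ih' := ih (fun i => QuotSMulTop r (M i)) (fun i => QuotSMulTop.map r (d i)) ?_ (c + 1) ?_
      (fun i => (hreg i).2) ?_
    · -- multiplication by `r` is injective on the homology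
      have inj : ∀ w : M (i + 1), d i w = 0 → (∃ y, r • w = d (i + 1) y) →
          ∃ y, w = d (i + 1) y := by
        rintro w hw ⟨y, hy⟩
        obtain ⟨y', hy'⟩ := ih' (i + 1) (by linarith) (Submodule.Quotient.mk y) (by
          change Submodule.Quotient.mk (d (i + 1) y) = _
          rw [← hy, Submodule.Quotient.mk_eq_zero]
          exact Submodule.smul_mem_pointwise_smul w r ⊤ trivial)
        obtain ⟨y'', rfl⟩ := Submodule.Quotient.mk_surjective _ y'
        change _ = Submodule.Quotient.mk (d (i + 1 + 1) y'') at hy'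
        rw [Submodule.Quotient.eq] at hy'
        obtain ⟨v, -, hv⟩ := (Submodule.mem_smul_pointwise_iff_exists _ _ _).1 hy'
        refine ⟨v, (hreg (i + 1)).1 ?_⟩
        change r • w = r • d (i + 1) v
        rw [← map_smul, hv, map_sub, hd, sub_zero, hy]
      obtain ⟨t, ht⟩ := hnil r (by simp) i z hz
      induction t with
      | zero => simpa using ht
      | succ t iht =>
        refine iht (inj (r ^ t • z) (by rw [map_smul, hz, smul_zero]) ?_)
        rwa [smul_smul, ← pow_succ']
    · intro i x
      obtain ⟨x, rfl⟩ := Submodule.Quotient.mk_surjective _ x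
      change Submodule.Quotient.mk (d i (d (i + 1) x)) = _
      rw [hd]; rfl
    · intro i hi
      have := hc i (by simp at *; linarith)
      exact (Submodule.Quotient.mk_surjective _).subsingleton
    · -- A cycle `z` of `M / r M` has `d z = r b` with a cycle `b`.  A power of `s` kills the class
      -- of `b`, so a power of `s` times `z` lifts to a cycle of `M`, and a further power kills it.
      intro s hs i z hz
      obtain ⟨z, rfl⟩ := Submodule.Quotient.mk_surjective _ z
      change Submodule.Quotient.mk (d i z) = _ at hz
      rw [Submodule.Quotient.mk_eq_zero] at hz
      obtain ⟨b, -, hb⟩ := (Submodule.mem_smul_pointwise_iff_exists _ _ _).1 hz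
      obtain ⟨j, rfl⟩ : ∃ j, i = j + 1 := ⟨i - 1, by ring⟩
      have hdb : d j b = 0 := (hreg j).1 (by
        change r • d j b = r • 0
        rw [← map_smul, hb, hd, smul_zero])
      obtain ⟨t, y, hy⟩ := hnil s (by simp [hs]) j b hdb
      obtain ⟨t', y', hy'⟩ := hnil s (by simp [hs]) (j + 1) (s ^ t • z - r • y) (by
        rw [map_sub, map_smul, map_smul, ← hy, ← hb, smul_comm, sub_self])
      refine ⟨t' + t, Submodule.Quotient.mk y', ?_⟩
      change Submodule.Quotient.mk (s ^ (t' + t) • z) = Submodule.Quotient.mk (d (j + 1 + 1) y')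
      rw [← hy', Submodule.Quotient.eq, smul_sub, smul_smul, ← pow_add, sub_sub_cancel,
        smul_comm]
      exact Submodule.smul_mem_pointwise_smul _ r ⊤ trivial

/-! ### Words in crossings and nails -/

namespace KLRW

/-- The letters of the words from which a basis is formed: `T i` crosses the strands at the
positions `i` and `i + 1`, and `W` nails the leftmost strand. -/
inductive Letter
  | T (i : ℕ)
  | W

namespace Letter

/-- The value of a letter in a monoid. -/
def val {M : Type*} (T : ℕ → M) (W : M) : Letter → M
  | .T i => T i
  | .W => W

/-- The number of crossings in a letter. -/
def crossings : Letter → ℕ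
  | .T _ => 1
  | .W => 0

/-- The number of nails in a letter. -/
def nails : Letter → ℕ
  | .T _ => 0
  | .W => 1

end Letter

/-- The value of a word in a monoid. -/
def eval {M : Type*} [Monoid M] (T : ℕ → M) (W : M) (w : List Letter) : M :=
  (w.map (Letter.val T W)).prod

/-- The number of crossings in a word. -/
def crossings (w : List Letter) : ℕ := (w.map Letter.crossings).sum

/-- The number of nails in a word. -/
def nails (w : List Letter) : ℕ := (w.map Letter.nails).sum

/-- The word `T p ⋯ T (p + c - 1)`: the strand at position `p + c` goes left to position `p`. -/
def leftPath (p : ℕ) : ℕ → List Letter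
  | 0 => []
  | c + 1 => .T p :: leftPath (p + 1) c

/-- The word `T (p - 1) ⋯ T 0`: the strand at position `0` goes right to position `p`. -/
def rightPath : ℕ → List Letter
  | 0 => []
  | p + 1 => .T p :: rightPath p

/-- The path of the strand at position `n` to the position `p`: straight if `t = false`, and via
a nail if `t = true`. -/
def path (n p : ℕ) : Bool → List Letter
  | false => leftPath p (n - p)
  | true => rightPath p ++ .W :: leftPath 0 n

/-- The codes of the basis words on `n` strands: for each strand, at position `m` say, a position
`p ≤ m` to which it goes after the strands on its left have been arranged, and whether it is nailed
on its way. -/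
def Code : ℕ → Type
  | 0 => Unit
  | n + 1 => (Fin (n + 1) × Bool) × Code n

/-- The basis word of a code.  Words are read from top to bottom, so the path of the last strand
comes first. -/
def Code.word : {n : ℕ} → Code n → List Letter
  | 0, _ => []
  | n + 1, c => path n c.1.1 c.1.2 ++ Code.word c.2

section Eval

variable {M : Type*} [Monoid M] (T : ℕ → M) (W : M)

@[simp] theorem eval_nil : eval T W [] = 1 := rfl

@[simp] theorem eval_T_cons (i : ℕ) (w : List Letter) :
    eval T W (.T i :: w) = T i * eval T W w := by simp [eval, Letter.val]

@[simp] theorem eval_W_cons (w : List Letter) : eval T W (.W :: w) = W * eval T W w := by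
  simp [eval, Letter.val]

@[simp] theorem eval_append (w w' : List Letter) :
    eval T W (w ++ w') = eval T W w * eval T W w' := by simp [eval]

@[simp] theorem crossings_nil : crossings [] = 0 := rfl

@[simp] theorem crossings_T_cons (i : ℕ) (w : List Letter) :
    crossings (.T i :: w) = crossings w + 1 := by simp [crossings, Letter.crossings, add_comm]

@[simp] theorem crossings_W_cons (w : List Letter) : crossings (.W :: w) = crossings w := by
  simp [crossings, Letter.crossings]

@[simp] theorem crossings_append (w w' : List Letter) :
    crossings (w ++ w') = crossings w + crossings w' := by simp [crossings]

@[simp] theorem crossings_leftPath (p c : ℕ) : crossings (leftPath p c) = c := by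
  induction c generalizing p with
  | zero => rfl
  | succ c ih => simp [leftPath, ih]

@[simp] theorem crossings_rightPath (p : ℕ) : crossings (rightPath p) = p := by
  induction p with
  | zero => rfl
  | succ p ih => simp [rightPath, ih]

end Eval

variable {k : Type*} [CommRing k] {R : Type*} [Ring R] [Algebra k R]

/-- A filtration `F` by the number of crossings of an algebra with elements `T i`, `W` and a set
`G` of crossingless elements, where `F m` stands for the elements with less than `m` crossings.
The relations of the dg-enhanced KLRW algebra hold up to terms with fewer crossings. -/
structure CrossingFiltration (T : ℕ → R) (W : R) (G : Set R) (F : ℕ → Submodule k R) : Prop where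
  zero : F 0 = ⊥
  mono : Monotone F
  mul_mem : ∀ {i j a b}, a ∈ F (i + 1) → b ∈ F (j + 1) → a * b ∈ F (i + j + 1)
  one_mem : 1 ∈ F 1
  T_mem : ∀ i, T i ∈ F 2
  W_mem : W ∈ F 1
  G_mem : ∀ g ∈ G, g ∈ F 1
  sq : ∀ i, T i * T i ∈ F 2
  braid : ∀ i, T i * T (i + 1) * T i - T (i + 1) * T i * T (i + 1) ∈ F 3
  far : ∀ i j, i + 2 ≤ j → T i * T j = T j * T i
  W_T : ∀ i, T (i + 1) * W = W * T (i + 1)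
  W_sq : W * W = 0
  W_anticomm : T 0 * W * T 0 * W = -(W * T 0 * W * T 0)
  G_T : ∀ g ∈ G, ∀ i, ∃ g' ∈ G, g * T i - T i * g' ∈ F 1
  G_W : ∀ g ∈ G, ∃ g' ∈ G, g * W = W * g'

namespace CrossingFiltration

variable {T : ℕ → R} {W : R} {G : Set R} {F : ℕ → Submodule k R}

section

variable (H : CrossingFiltration T W G F)
include H

theorem mul_mem_left {i j : ℕ} {a b : R} (ha : a ∈ F (i + 1)) (hb : b ∈ F j) :
    a * b ∈ F (i + j) := by
  cases j with
  | zero =>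
    rw [H.zero, Submodule.mem_bot] at hb
    rw [hb, mul_zero]; exact zero_mem _
  | succ j => exact H.mul_mem ha hb

theorem mul_mem_right {i j : ℕ} {a b : R} (ha : a ∈ F i) (hb : b ∈ F (j + 1)) :
    a * b ∈ F (i + j) := by
  cases i with
  | zero =>
    rw [H.zero, Submodule.mem_bot] at ha
    rw [ha, zero_mul]; exact zero_mem _
  | succ i =>
    have := H.mul_mem ha hb
    rwa [add_right_comm] at this

theorem eval_mem (w : List Letter) : eval T W w ∈ F (crossings w + 1) := by
  induction w with
  | nil => exact H.one_mem
  | cons a w ih =>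
    cases a with
    | T i =>
      rw [eval_T_cons, crossings_T_cons, add_comm _ 1]
      exact H.mul_mem_left (i := 1) (H.T_mem i) ih
    | W =>
      rw [eval_W_cons, crossings_W_cons]
      simpa using H.mul_mem_left (i := 0) H.W_mem ih

theorem far_leftPath {j p : ℕ} (h : j + 2 ≤ p) (c : ℕ) :
    T j * eval T W (leftPath p c) = eval T W (leftPath p c) * T j := by
  induction c generalizing p with
  | zero => simp [leftPath]
  | succ c ih =>
    rw [leftPath, eval_T_cons, ← mul_assoc, H.far _ _ h, mul_assoc, ih (by omega), mul_assoc]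

theorem W_leftPath (p c : ℕ) :
    W * eval T W (leftPath (p + 1) c) = eval T W (leftPath (p + 1) c) * W := by
  induction c generalizing p with
  | zero => simp [leftPath]
  | succ c ih =>
    rw [leftPath, eval_T_cons, ← mul_assoc, ← H.W_T, mul_assoc, ih, mul_assoc]

/-- A crossing of two strands that a left path crosses slides below the path, up to terms with fewer
crossings; the two strands are one position further to the left there. -/
theorem T_leftPath (p i c : ℕ) (h : i + 1 < c) :
    T (p + i + 1) * eval T W (leftPath p c) - eval T W (leftPath p c) * T (p + i) ∈
      F (c + 1) := by
  induction i generalizing p c with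
  | zero =>
    obtain ⟨c, rfl⟩ : ∃ c', c = c' + 2 := ⟨c - 2, by omega⟩
    have h1 := H.far_leftPath (j := p) (p := p + 2) le_rfl c
    simp only [leftPath, eval_T_cons, add_zero]
    have e : T (p + 1) * (T p * (T (p + 1) * eval T W (leftPath (p + 1 + 1) c))) -
        T p * (T (p + 1) * eval T W (leftPath (p + 1 + 1) c)) * T p =
        -(T p * T (p + 1) * T p - T (p + 1) * T p * T (p + 1)) *
          eval T W (leftPath (p + 2) c) := by
      rw [neg_sub, sub_mul, mul_assoc (T p * _) (T p), h1]
      simp only [mul_assoc]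
    rw [e]
    have := H.mul_mem_right (neg_mem (H.braid p)) (H.eval_mem (leftPath (p + 2) c))
    convert this using 2
    rw [crossings_leftPath]; ring
  | succ i ih =>
    obtain ⟨c, rfl⟩ : ∃ c', c = c' + 1 := ⟨c - 1, by omega⟩
    have h1 := ih (p + 1) c (by omega)
    simp only [leftPath, eval_T_cons]
    have e : T (p + (i + 1) + 1) * (T p * eval T W (leftPath (p + 1) c)) -
        T p * eval T W (leftPath (p + 1) c) * T (p + (i + 1)) =
        T p * (T (p + 1 + i + 1) * eval T W (leftPath (p + 1) c) -
          eval T W (leftPath (p + 1) c) * T (p + 1 + i)) := by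
      rw [← mul_assoc, ← H.far p (p + (i + 1) + 1) (by omega), mul_sub]
      simp only [mul_assoc]
      rw [show p + (i + 1) = p + 1 + i by ring]
    rw [e]
    convert H.mul_mem_left (H.T_mem p) h1 using 2
    ring

theorem T_leftPath_self (p c : ℕ) : T p * eval T W (leftPath p (c + 1)) ∈ F (c + 2) := by
  rw [leftPath, eval_T_cons, ← mul_assoc]
  convert H.mul_mem_right (H.sq p) (H.eval_mem (leftPath (p + 1) c)) using 2
  rw [crossings_leftPath]; ring

theorem G_leftPath {g : R} (hg : g ∈ G) (p c : ℕ) :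
    ∃ g' ∈ G, g * eval T W (leftPath p c) - eval T W (leftPath p c) * g' ∈ F c := by
  induction c generalizing p g with
  | zero => exact ⟨g, hg, by simp [leftPath]⟩
  | succ c ih =>
    obtain ⟨g₁, hg₁, h₁⟩ := H.G_T g hg p
    obtain ⟨g₂, hg₂, h₂⟩ := ih hg₁ (p + 1)
    refine ⟨g₂, hg₂, ?_⟩
    have a := H.mul_mem_right h₁ (H.eval_mem (leftPath (p + 1) c))
    have b := H.mul_mem_left (H.T_mem p) h₂
    rw [crossings_leftPath, add_comm] at a
    rw [add_comm] at b
    convert add_mem a b using 1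
    rw [leftPath, eval_T_cons]
    noncomm_ring

theorem far_rightPath {j p : ℕ} (h : p + 1 ≤ j) :
    T j * eval T W (rightPath p) = eval T W (rightPath p) * T j := by
  induction p with
  | zero => simp [rightPath]
  | succ p ih =>
    rw [rightPath, eval_T_cons, ← mul_assoc, ← H.far _ _ (by omega), mul_assoc, ih (by omega),
      mul_assoc]

/-- A crossing of two strands that a right path crosses slides below the path, where the two strands
are one position further to the right. -/
theorem T_rightPath (j p : ℕ) (h : j + 1 < p) :
    T j * eval T W (rightPath p) - eval T W (rightPath p) * T (j + 1) ∈ F (p + 1) := by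
  induction p with
  | zero => omega
  | succ p ih =>
    obtain hj | rfl := (Nat.lt_succ_iff.1 h).lt_or_eq
    · have h1 := ih hj
      rw [rightPath, eval_T_cons]
      have e : T j * (T p * eval T W (rightPath p)) -
          T p * eval T W (rightPath p) * T (j + 1) =
          T p * (T j * eval T W (rightPath p) - eval T W (rightPath p) * T (j + 1)) := by
        rw [← mul_assoc, H.far _ _ (by omega), mul_sub]
        simp only [mul_assoc]
      rw [e]
      convert H.mul_mem_left (H.T_mem p) h1 using 2
      ring
    · simp only [rightPath, eval_T_cons]
      have h1 := H.far_rightPath (j := j + 1) (p := j) le_rfl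
      have e : T j * (T (j + 1) * (T j * eval T W (rightPath j))) -
          T (j + 1) * (T j * eval T W (rightPath j)) * T (j + 1) =
          (T j * T (j + 1) * T j - T (j + 1) * T j * T (j + 1)) * eval T W (rightPath j) := by
        rw [sub_mul, mul_assoc (T (j + 1) * _) (T (j + 1)), h1]
        simp only [mul_assoc]
      rw [e]
      have := H.mul_mem_right (H.braid j) (H.eval_mem (rightPath j))
      convert this using 2
      rw [crossings_rightPath]; ring

theorem T_rightPath_self (p : ℕ) : T p * eval T W (rightPath (p + 1)) ∈ F (p + 2) := by
  rw [rightPath, eval_T_cons, ← mul_assoc]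
  convert H.mul_mem_right (H.sq p) (H.eval_mem (rightPath p)) using 2
  rw [crossings_rightPath]; ring

theorem G_rightPath {g : R} (hg : g ∈ G) (p : ℕ) :
    ∃ g' ∈ G, g * eval T W (rightPath p) - eval T W (rightPath p) * g' ∈ F p := by
  induction p generalizing g with
  | zero => exact ⟨g, hg, by simp [rightPath]⟩
  | succ p ih =>
    obtain ⟨g₁, hg₁, h₁⟩ := H.G_T g hg p
    obtain ⟨g₂, hg₂, h₂⟩ := ih hg₁
    refine ⟨g₂, hg₂, ?_⟩
    have a := H.mul_mem_right h₁ (H.eval_mem (rightPath p))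
    have b := H.mul_mem_left (H.T_mem p) h₂
    rw [crossings_rightPath, add_comm] at a
    rw [add_comm] at b
    convert add_mem a b using 1
    rw [rightPath, eval_T_cons]
    noncomm_ring

/-- A right path ends at the bottom with `T 0`, and the rest of it commutes with the nail. This
reduces the product of two nailed paths to the relation `W_anticomm`. -/
theorem W_rightPath (p : ℕ) :
    ∃ r, eval T W (rightPath (p + 1)) = r * T 0 ∧ W * r = r * W := by
  induction p with
  | zero => exact ⟨1, by simp [rightPath], by simp⟩
  | succ p ih =>
    obtain ⟨r, hr, h⟩ := ih
    refine ⟨T (p + 1) * r, ?_, ?_⟩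
    · rw [rightPath, eval_T_cons, hr, mul_assoc]
    · rw [← mul_assoc, ← H.W_T, mul_assoc, h, mul_assoc]

end

variable (T W G k) in
/-- The span of the basis words on `n` strands with less than `m` crossings, multiplied by
crossingless elements. -/
def wordSpan (n m : ℕ) : Submodule k R :=
  Submodule.span k {x | ∃ (c : Code n) (g : R), g ∈ Algebra.adjoin k G ∧ crossings c.word < m ∧
    x = eval T W c.word * g}

theorem wordSpan_mono (n : ℕ) : Monotone (wordSpan k T W G n) := by
  intro m m' h
  refine Submodule.span_mono ?_
  rintro x ⟨c, g, hg, hm, rfl⟩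
  exact ⟨c, g, hg, hm.trans_le h, rfl⟩

theorem path_mul_mem_wordSpan {n m : ℕ} (p : Fin (n + 1)) (t : Bool) {a : R}
    (ha : a ∈ wordSpan k T W G n m) :
    eval T W (path n p t) * a ∈ wordSpan k T W G (n + 1) (crossings (path n p t) + m) := by
  induction ha using Submodule.span_induction with
  | mem x h =>
    obtain ⟨c, g, hg, hm, rfl⟩ := h
    refine Submodule.subset_span ⟨((p, t), c), g, hg, ?_, ?_⟩
    · simp only [Code.word, crossings_append]; omega
    · simp only [Code.word, eval_append, mul_assoc]
  | zero => rw [mul_zero]; exact zero_mem _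
  | add x y _ _ hx hy => rw [mul_add]; exact add_mem hx hy
  | smul r x _ hx => rw [mul_smul_comm]; exact Submodule.smul_mem _ _ hx

variable (H : CrossingFiltration T W G F)
include H

theorem adjoin_le : Subalgebra.toSubmodule (Algebra.adjoin k G) ≤ F 1 := by
  intro x hx
  induction hx using Algebra.adjoin_induction with
  | mem x hx => exact H.G_mem x hx
  | algebraMap r => rw [Algebra.algebraMap_eq_smul_one]; exact Submodule.smul_mem _ _ H.one_mem
  | add x y _ _ hx hy => exact add_mem hx hy
  | mul x y _ _ hx hy => simpa using H.mul_mem_left (i := 0) hx hy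

theorem path_mul_mem {n m r : ℕ} (p : Fin (n + 1)) (t : Bool) {a : R}
    (hr : crossings (path n p t) + m = r) (ha : a ∈ wordSpan k T W G n (m + 1) ⊔ F m) :
    eval T W (path n p t) * a ∈ wordSpan k T W G (n + 1) (r + 1) ⊔ F r := by
  obtain ⟨x, hx, y, hy, rfl⟩ := Submodule.mem_sup.1 ha
  subst hr
  have h₁ := path_mul_mem_wordSpan p t hx
  have h₂ := H.mul_mem_left (H.eval_mem (path n p t)) hy
  rw [mul_add]
  exact Submodule.add_mem_sup h₁ h₂

omit H in
theorem mem_of_sub_mem {n r : ℕ} {a b : R} (h : a - b ∈ F r)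
    (hb : b ∈ wordSpan k T W G n (r + 1) ⊔ F r) : a ∈ wordSpan k T W G n (r + 1) ⊔ F r := by
  rw [← sub_add_cancel a b]
  exact add_mem (Submodule.mem_sup_right h) hb

/-- A basis word times a crossingless element, multiplied from the left by a generator, is a
combination of basis words with at most as many crossings as the product, up to terms with fewer
crossings.  The generator either changes the path of the last strand into another path, or slides
below this path, where the induction hypothesis applies, or creates a double
crossing or a double nail. -/
theorem gen_mul_mem (n : ℕ) (c : Code n) (g : R) (hg : g ∈ Algebra.adjoin k G) :
    (∀ x ∈ G, x * (eval T W c.word * g) ∈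
      wordSpan k T W G n (crossings c.word + 1) ⊔ F (crossings c.word)) ∧
    (∀ j, j + 1 < n → T j * (eval T W c.word * g) ∈
      wordSpan k T W G n (crossings c.word + 1 + 1) ⊔ F (crossings c.word + 1)) ∧
    (0 < n → W * (eval T W c.word * g) ∈
      wordSpan k T W G n (crossings c.word + 1) ⊔ F (crossings c.word)) := by
  induction n with
  | zero =>
    refine ⟨fun x hx => Submodule.mem_sup_left (Submodule.subset_span
      ⟨c, x * g, MulMemClass.mul_mem (Algebra.subset_adjoin hx) hg, by simp, ?_⟩), by simp, by simp⟩
    simp [Code.word]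
  | succ n ih =>
    obtain ⟨⟨p, t⟩, c⟩ := c
    obtain ⟨ihG, ihT, ihW⟩ := ih c
    set w := eval T W c.word * g with hw
    set r := crossings c.word with hr
    have hwF : w ∈ F (r + 1) := by
      simpa using H.mul_mem_left (H.eval_mem c.word) (H.adjoin_le hg)
    have hwS : w ∈ wordSpan k T W G n (r + 1) ⊔ F r :=
      Submodule.mem_sup_left (Submodule.subset_span ⟨c, g, hg, by simp [hr], rfl⟩)
    -- terms with fewer crossings remain so after multiplication by `w`
    have low : ∀ {s q x y}, x ∈ F s → y = x * w → q = s + r → y ∈ F q := by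
      rintro s q x y hx rfl rfl
      exact H.mul_mem_right hx hwF
    have hp := p.2
    simp only [Code.word, eval_append, crossings_append, mul_assoc _ _ g, ← hw, ← hr]
    cases t with
    | false =>
      have hcr : crossings (path n p false) = n - p := by simp [path]
      rw [hcr]
      refine ⟨fun x hx => ?_, fun j hj => ?_, fun _ => ?_⟩
      · obtain ⟨x', hx', h⟩ := H.G_leftPath hx p (n - p)
        refine mem_of_sub_mem (b := eval T W (path n p false) * (x' * w)) ?_
          (H.path_mul_mem p false (by rw [hcr]) (ihG x' hx'))
        refine low h ?_ rfl
        simp only [path]; noncomm_ring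
      · rcases lt_trichotomy (j + 1) p with h | h | h
        · have := H.far_leftPath (j := j) (p := p) (by omega) (n - p)
          rw [path, ← mul_assoc, this, mul_assoc]
          exact H.path_mul_mem p false (by rw [hcr]; ring) (ihT j (by omega))
        · -- the crossing extends the left path
          have e : T j * (eval T W (path n p false) * w) =
              eval T W (path n (⟨j, by omega⟩ : Fin (n + 1)) false) * w := by
            simp only [path]
            rw [← h, show n - j = (n - (j + 1)) + 1 by omega, leftPath, eval_T_cons, mul_assoc]
          rw [e]
          exact H.path_mul_mem _ false (by simp [path]; omega) hwS
        · obtain h | h := (Nat.lt_succ_iff.1 h).lt_or_eq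
          · have h1 := H.T_leftPath p (j - p - 1) (n - p) (by omega)
            rw [show (p : ℕ) + (j - p - 1) + 1 = j by omega,
              show (p : ℕ) + (j - p - 1) = j - 1 by omega] at h1
            refine mem_of_sub_mem (b := eval T W (path n p false) * (T (j - 1) * w)) ?_
              (H.path_mul_mem p false (by rw [hcr]; ring) (ihT (j - 1) (by omega)))
            refine low h1 ?_ (by ring)
            simp only [path]; noncomm_ring
          · have h1 := H.T_leftPath_self p (n - p - 1)
            rw [show n - (p : ℕ) - 1 + 1 = n - p by omega] at h1
            refine Submodule.mem_sup_right ?_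
            rw [← h, path]
            exact low h1 (mul_assoc _ _ _).symm (by omega)
      · obtain ⟨p, hp⟩ := p
        cases p with
        | zero =>
          -- a left path to the position `0` becomes a nailed path
          have e : W * (eval T W (path n 0 false) * w) =
              eval T W (path n (⟨0, by omega⟩ : Fin (n + 1)) true) * w := by
            simp [path, rightPath, mul_assoc]
          rw [e]
          exact H.path_mul_mem _ true (by simp [path, rightPath]) hwS
        | succ p =>
          simp only [path] at hcr ⊢
          rw [← mul_assoc, H.W_leftPath, mul_assoc]
          exact H.path_mul_mem ⟨p + 1, hp⟩ false (by simp [path]) (ihW (by omega))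
    | true =>
      have hcr : crossings (path n p true) = p + n := by simp [path]
      rw [hcr]
      have hWL : W * eval T W (leftPath 0 n) ∈ F (n + 1) := by
        simpa using H.eval_mem (.W :: leftPath 0 n)
      have hRW : eval T W (rightPath p) * W ∈ F (p + 1) := by
        have := H.eval_mem (rightPath p ++ [.W])
        rwa [eval_append, eval_W_cons, eval_nil, mul_one, crossings_append, crossings_W_cons,
          crossings_nil, add_zero, crossings_rightPath] at this
      refine ⟨fun x hx => ?_, fun j hj => ?_, fun _ => ?_⟩
      · obtain ⟨x₁, hx₁, h₁⟩ := H.G_rightPath hx p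
        obtain ⟨x₂, hx₂, h₂⟩ := H.G_W x₁ hx₁
        obtain ⟨x₃, hx₃, h₃⟩ := H.G_leftPath hx₂ 0 n
        refine mem_of_sub_mem (b := eval T W (path n p true) * (x₃ * w)) ?_
          (H.path_mul_mem p true (by rw [hcr]) (ihG x₃ hx₃))
        refine low (add_mem (H.mul_mem_right h₁ hWL) (H.mul_mem_left hRW h₃)) ?_ rfl
        simp only [path, eval_append, eval_W_cons]
        have : eval T W (rightPath p) * x₁ * (W * eval T W (leftPath 0 n)) =
            eval T W (rightPath p) * W * (x₂ * eval T W (leftPath 0 n)) := by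
          rw [mul_assoc _ x₁, ← mul_assoc x₁, h₂]; simp only [mul_assoc]
        rw [sub_mul, mul_sub, this]
        noncomm_ring
      · rcases lt_trichotomy (j + 1) p with h | h | h
        · -- the crossing slides below the right path, then below the left path
          have h₁ := H.T_rightPath j p h
          have h₂ := H.T_leftPath 0 j n (by omega)
          rw [zero_add] at h₂
          refine mem_of_sub_mem (b := eval T W (path n p true) * (T j * w)) ?_
            (H.path_mul_mem p true (by rw [hcr]; ring) (ihT j (by omega)))
          have a := H.mul_mem_right h₁ hWL
          have b := H.mul_mem_left hRW h₂
          rw [show (p : ℕ) + 1 + n = p + n + 1 by ring] at a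
          rw [show (p : ℕ) + (n + 1) = p + n + 1 by ring] at b
          refine low (add_mem a b) ?_ (by ring)
          simp only [path, eval_append, eval_W_cons]
          have : eval T W (rightPath p) * T (j + 1) * (W * eval T W (leftPath 0 n)) =
              eval T W (rightPath p) * W * (T (j + 1) * eval T W (leftPath 0 n)) := by
            rw [mul_assoc _ (T _), ← mul_assoc (T _), H.W_T]; simp only [mul_assoc]
          rw [sub_mul _ _ (W * _), mul_sub, this]
          noncomm_ring
        · have h₁ := H.T_rightPath_self j
          rw [h] at h₁
          refine Submodule.mem_sup_right ?_
          refine low (H.mul_mem_right h₁ hWL) ?_ (by omega)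
          simp only [path, eval_append, eval_W_cons, mul_assoc]
        · obtain h | h := (Nat.lt_succ_iff.1 h).lt_or_eq
          · have h₁ := H.far_rightPath (j := j) (p := p) (by omega)
            obtain ⟨j, rfl⟩ : ∃ j', j = j' + 1 := ⟨j - 1, by omega⟩
            have h₂ := H.T_leftPath 0 j n (by omega)
            rw [zero_add] at h₂
            refine mem_of_sub_mem (b := eval T W (path n p true) * (T j * w)) ?_
              (H.path_mul_mem p true (by rw [hcr]; ring) (ihT j (by omega)))
            have b := H.mul_mem_left hRW h₂
            rw [show (p : ℕ) + (n + 1) = p + n + 1 by ring] at b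
            refine low b ?_ (by ring)
            simp only [path, eval_append, eval_W_cons]
            have : T (j + 1) * (eval T W (rightPath p) * (W * eval T W (leftPath 0 n)) * w) =
                eval T W (rightPath p) * W * (T (j + 1) * eval T W (leftPath 0 n)) * w := by
              simp only [← mul_assoc]
              rw [h₁, mul_assoc _ (T (j + 1)) W, H.W_T]
              simp only [mul_assoc]
            rw [this]
            noncomm_ring
          · -- the crossing extends the right path
            have e : T j * (eval T W (path n p true) * w) =
                eval T W (path n (⟨j + 1, by omega⟩ : Fin (n + 1)) true) * w := by
              simp [path, rightPath, mul_assoc, h]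
            rw [e]
            exact H.path_mul_mem _ true (by simp [path]; omega) hwS
      · obtain ⟨p, hp⟩ := p
        cases p with
        | zero =>
          have e : W * (eval T W (path n 0 true) * w) = 0 := by
            simp only [path, rightPath, List.nil_append, eval_W_cons, ← mul_assoc, H.W_sq,
              zero_mul]
          rw [e]; exact zero_mem _
        | succ p =>
          obtain ⟨r', hr', hW⟩ := H.W_rightPath p
          obtain ⟨n, rfl⟩ : ∃ n', n = n' + 1 := ⟨n - 1, by omega⟩
          have e : W * (eval T W (path (n + 1) (p + 1) true) * w) =
              -(eval T W (path (n + 1) (p + 1) true) * (W * w)) := by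
            simp only [path, eval_append, eval_W_cons, hr', leftPath, eval_T_cons, zero_add]
            have h := H.W_leftPath 0 n
            rw [zero_add] at h
            calc _ = W * r' * (T 0 * W * T 0) * eval T W (leftPath 1 n) * w := by
                  simp only [mul_assoc]
              _ = -(r' * (T 0 * W * T 0 * W) * eval T W (leftPath 1 n) * w) := by
                  rw [hW, H.W_anticomm]; noncomm_ring
              _ = -(r' * (T 0 * W * T 0) * (W * eval T W (leftPath 1 n)) * w) := by
                  simp only [mul_assoc]
              _ = _ := by rw [h]; simp only [mul_assoc]
          rw [e]
          exact neg_mem (H.path_mul_mem (⟨p + 1, hp⟩ : Fin (n + 1 + 1)) true (by simp [path])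
            (ihW (by omega)))

end CrossingFiltration

end KLRW

/-! ### The words span -/

namespace KLRW

variable (k : Type*) [CommRing k] {R : Type*} [Ring R] [Algebra k R]

/-- The relations of the dg-enhanced KLRW algebra between elements `T i`, `W` and a set `G` of
crossingless elements of an algebra, up to crossingless error terms. -/
structure CrossingRelations (T : ℕ → R) (W : R) (G : Set R) : Prop where
  sq : ∀ i, T i * T i ∈ Algebra.adjoin k G
  braid : ∀ i, T i * T (i + 1) * T i - T (i + 1) * T i * T (i + 1) ∈ Algebra.adjoin k G
  far : ∀ i j, i + 2 ≤ j → T i * T j = T j * T i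
  W_T : ∀ i, T (i + 1) * W = W * T (i + 1)
  W_sq : W * W = 0
  W_anticomm : T 0 * W * T 0 * W = -(W * T 0 * W * T 0)
  G_T : ∀ g ∈ G, ∀ i, ∃ g' ∈ G, g * T i - T i * g' ∈ Algebra.adjoin k G
  G_W : ∀ g ∈ G, ∃ g' ∈ G, g * W = W * g'

/-- The value of a letter or of an element of `G`. -/
def genVal (T : ℕ → R) (W : R) (G : Set R) : Letter ⊕ G → R :=
  Sum.elim (Letter.val T W) Subtype.val

/-- The number of crossings in a letter or in an element of `G`. -/
def genCrossings (G : Set R) : Letter ⊕ G → ℕ := Sum.elim Letter.crossings fun _ => 0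

/-- The span of the products of `T i`, `W` and elements of `G` with less than `m` crossings. -/
def crossingSpan (T : ℕ → R) (W : R) (G : Set R) (m : ℕ) : Submodule k R :=
  Submodule.span k {x | ∃ l : List (Letter ⊕ G), (l.map (genCrossings G)).sum < m ∧
    x = (l.map (genVal T W G)).prod}

variable {k} {T : ℕ → R} {W : R} {G : Set R}

theorem prod_mem_crossingSpan {m : ℕ} (l : List (Letter ⊕ G))
    (h : (l.map (genCrossings G)).sum < m) :
    (l.map (genVal T W G)).prod ∈ crossingSpan k T W G m :=
  Submodule.subset_span ⟨l, h, rfl⟩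

theorem crossingSpan_mono : Monotone (crossingSpan k T W G) := by
  intro m m' h
  refine Submodule.span_mono ?_
  rintro x ⟨l, hl, rfl⟩
  exact ⟨l, hl.trans_le h, rfl⟩

theorem mul_mem_crossingSpan {i j : ℕ} {a b : R} (ha : a ∈ crossingSpan k T W G (i + 1))
    (hb : b ∈ crossingSpan k T W G (j + 1)) : a * b ∈ crossingSpan k T W G (i + j + 1) := by
  have h := Submodule.mul_mem_mul ha hb
  rw [crossingSpan, crossingSpan, Submodule.span_mul_span] at h
  refine Submodule.span_mono ?_ h
  rintro _ ⟨_, ⟨l, hl, rfl⟩, _, ⟨l', hl', rfl⟩, rfl⟩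
  exact ⟨l ++ l', by simp; omega, by simp⟩

theorem one_mem_crossingSpan : (1 : R) ∈ crossingSpan k T W G 1 := by
  simpa using prod_mem_crossingSpan (k := k) (T := T) (W := W) (G := G) (m := 1) [] (by simp)

theorem adjoin_le_crossingSpan {a : R} (ha : a ∈ Algebra.adjoin k G) :
    a ∈ crossingSpan k T W G 1 := by
  induction ha using Algebra.adjoin_induction with
  | mem x hx =>
    simpa [genVal] using prod_mem_crossingSpan (k := k) (T := T) (W := W) (m := 1) [.inr ⟨x, hx⟩]
      (by simp [genCrossings])
  | algebraMap r =>
    rw [Algebra.algebraMap_eq_smul_one]; exact Submodule.smul_mem _ _ one_mem_crossingSpan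
  | add x y _ _ hx hy => exact Submodule.add_mem _ hx hy
  | mul x y _ _ hx hy => exact mul_mem_crossingSpan (i := 0) (j := 0) hx hy

theorem CrossingRelations.filtration (H : CrossingRelations k T W G) :
    CrossingFiltration T W G (crossingSpan k T W G) where
  zero := by simp [crossingSpan]
  mono := crossingSpan_mono
  mul_mem := mul_mem_crossingSpan
  one_mem := one_mem_crossingSpan
  T_mem i := by
    simpa [genVal, Letter.val] using prod_mem_crossingSpan (k := k) (T := T) (W := W) (G := G)
      (m := 2) [.inl (.T i)] (by simp [genCrossings, Letter.crossings])
  W_mem := by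
    simpa [genVal, Letter.val] using prod_mem_crossingSpan (k := k) (T := T) (W := W) (G := G)
      (m := 1) [.inl .W] (by simp [genCrossings, Letter.crossings])
  G_mem g hg := adjoin_le_crossingSpan (Algebra.subset_adjoin hg)
  sq i := crossingSpan_mono (by decide) (adjoin_le_crossingSpan (H.sq i))
  braid i := crossingSpan_mono (by decide) (adjoin_le_crossingSpan (H.braid i))
  far := H.far
  W_T := H.W_T
  W_sq := H.W_sq
  W_anticomm := H.W_anticomm
  G_T g hg i := by
    obtain ⟨g', hg', h⟩ := H.G_T g hg i
    exact ⟨g', hg', adjoin_le_crossingSpan h⟩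
  G_W := H.G_W

/-- The code of the empty word. -/
def Code.one : (n : ℕ) → Code n
  | 0 => ()
  | n + 1 => ((Fin.last n, false), Code.one n)

theorem Code.word_one (n : ℕ) : (Code.one n).word = [] := by
  induction n with
  | zero => rfl
  | succ n ih => simp [Code.one, Code.word, ih, path, leftPath]

open CrossingFiltration in
/-- The products with less than `m` crossings are combinations of basis words with less than `m`
crossings: by induction on `m`, the error terms in `gen_mul_mem` are such combinations. -/
theorem CrossingRelations.crossingSpan_le (H : CrossingRelations k T W G) {n : ℕ}
    (hT : ∀ j, n ≤ j + 1 → T j = 0) (hW : n = 0 → W = 0) (m : ℕ) :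
    crossingSpan k T W G m ≤ wordSpan k T W G n m := by
  induction m using Nat.strong_induction_on with
  | _ m ih =>
  have F := H.filtration
  -- a generator with `d` crossings maps the span of the basis words to itself
  have key : ∀ (x : R) (d m' : ℕ), m' + d ≤ m →
      (∀ (c : Code n) (g : R), g ∈ Algebra.adjoin k G → x * (eval T W c.word * g) ∈
        wordSpan k T W G n (crossings c.word + d + 1) ⊔
          crossingSpan k T W G (crossings c.word + d)) →
      ∀ a ∈ wordSpan k T W G n m', x * a ∈ wordSpan k T W G n (m' + d) := by
    intro x d m' hm hx a ha
    induction ha using Submodule.span_induction with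
    | mem a h =>
      obtain ⟨c, g, hg, hc, rfl⟩ := h
      exact (sup_le (wordSpan_mono n (by omega))
        ((ih _ (by omega)).trans (wordSpan_mono n (by omega)))) (hx c g hg)
    | zero => rw [mul_zero]; exact zero_mem _
    | add x y _ _ hx hy => rw [mul_add]; exact add_mem hx hy
    | smul r x _ hx => rw [mul_smul_comm]; exact Submodule.smul_mem _ _ hx
  rw [crossingSpan, Submodule.span_le]
  rintro _ ⟨l, hl, rfl⟩
  have main : ∀ m' ≤ m, (l.map (genCrossings G)).sum < m' →
      (l.map (genVal T W G)).prod ∈ wordSpan k T W G n m' := by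
    clear hl
    induction l with
    | nil =>
      intro m' _ h
      refine Submodule.subset_span ⟨Code.one n, 1, one_mem _, ?_, ?_⟩
      · simpa [Code.word_one] using h
      · simp [Code.word_one]
    | cons a l ihl =>
      intro m' hm' h
      rw [List.map_cons, List.sum_cons] at h
      rw [List.map_cons, List.prod_cons]
      rcases a with (j | _) | g
      · obtain ⟨m', rfl⟩ : ∃ m'', m' = m'' + 1 := ⟨m' - 1, by omega⟩
        simp only [genCrossings, Sum.elim_inl, Letter.crossings] at h
        refine key _ 1 m' hm' (fun c g hg => ?_) _ (ihl m' (by omega) (by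
          simp only [genCrossings]; omega))
        change T j * _ ∈ _
        by_cases hj : j + 1 < n
        · exact (gen_mul_mem F n c g hg).2.1 j hj
        · rw [hT j (by omega), zero_mul]; exact zero_mem _
      · refine key _ 0 m' hm' (fun c g hg => ?_) _ (ihl m' hm' (by
          simpa [genCrossings, Letter.crossings] using h))
        change W * _ ∈ _
        obtain hn | hn := Nat.eq_zero_or_pos n
        · rw [hW hn, zero_mul]; exact zero_mem _
        · exact (gen_mul_mem F n c g hg).2.2 hn
      · refine key _ 0 m' hm' (fun c g' hg => ?_) _ (ihl m' hm' (by
          simpa [genCrossings] using h))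
        exact (gen_mul_mem F n c g' hg).1 g.1 g.2
  exact main m le_rfl hl

/-- The basis words span the algebra over its crossingless elements. -/
theorem CrossingRelations.mem_span (H : CrossingRelations k T W G) {n : ℕ}
    (hT : ∀ j, n ≤ j + 1 → T j = 0) (hW : n = 0 → W = 0)
    (htop : Algebra.adjoin k (Set.range T ∪ {W} ∪ G) = ⊤) (a : R) :
    a ∈ Submodule.span k {x | ∃ (c : Code n) (g : R), g ∈ Algebra.adjoin k G ∧
      x = eval T W c.word * g} := by
  have F := H.filtration
  have h1 : ∃ m, a ∈ crossingSpan k T W G (m + 1) := by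
    have ha : a ∈ Algebra.adjoin k (Set.range T ∪ {W} ∪ G) := htop ▸ trivial
    induction ha using Algebra.adjoin_induction with
    | mem x hx =>
      obtain (⟨i, rfl⟩ | rfl) | hx := hx
      · exact ⟨1, F.T_mem i⟩
      · exact ⟨0, F.W_mem⟩
      · exact ⟨0, F.G_mem x hx⟩
    | algebraMap r =>
      rw [Algebra.algebraMap_eq_smul_one]; exact ⟨0, Submodule.smul_mem _ _ F.one_mem⟩
    | add x y _ _ hx hy =>
      obtain ⟨i, hx⟩ := hx
      obtain ⟨j, hy⟩ := hy
      exact ⟨i + j, add_mem (F.mono (by omega) hx) (F.mono (by omega) hy)⟩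
    | mul x y _ _ hx hy =>
      obtain ⟨i, hx⟩ := hx
      obtain ⟨j, hy⟩ := hy
      exact ⟨i + j, F.mul_mem hx hy⟩
  obtain ⟨m, hm⟩ := h1
  refine Submodule.span_mono ?_ (H.crossingSpan_le hT hW _ hm)
  rintro x ⟨c, g, hg, -, rfl⟩
  exact ⟨c, g, hg, rfl⟩

end KLRW

/-! ### Independence of the words -/

namespace KLRW

instance Code.fintype : (n : ℕ) → Fintype (Code n)
  | 0 => inferInstanceAs (Fintype Unit)
  | n + 1 =>
    haveI := Code.fintype n
    inferInstanceAs (Fintype ((Fin (n + 1) × Bool) × Code n))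

section Independence

variable (K : Type*) [CommRing K]

/-- The space of functions on the permutations of the strands, with values in an exterior algebra
with one generator for each strand.  A permutation `θ` stands for the arrangement of the strands
in which the strand at position `i` is `θ i`. -/
abbrev FunSpace : Type _ := Equiv.Perm ℕ → ExteriorAlgebra K (ℕ →₀ K)

variable {K}

/-- The generator of the exterior algebra that belongs to the strand `i`. -/
def xi (i : ℕ) : ExteriorAlgebra K (ℕ →₀ K) := ExteriorAlgebra.ι K (Finsupp.single i 1)

/-- Exchange of the strands at the positions `i` and `i + 1`, with coefficients. -/
def crossOp (α γ : ℕ → Equiv.Perm ℕ → K) (i : ℕ) : Module.End K (FunSpace K) where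
  toFun φ θ := α i θ • φ θ + γ i θ • φ (θ * Equiv.swap i (i + 1))
  map_add' φ ψ := by ext θ; simp only [Pi.add_apply, smul_add]; abel
  map_smul' c φ := by
    ext θ; simp only [Pi.smul_apply, smul_add, RingHom.id_apply, smul_comm c]

theorem crossOp_apply (α γ : ℕ → Equiv.Perm ℕ → K) (i : ℕ) (φ : FunSpace K) (θ : Equiv.Perm ℕ) :
    crossOp α γ i φ θ = α i θ • φ θ + γ i θ • φ (θ * Equiv.swap i (i + 1)) := rfl

variable (K) in
/-- Multiplication by the exterior generator of the leftmost strand. -/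
def nailOp : Module.End K (FunSpace K) where
  toFun φ θ := xi (θ 0) * φ θ
  map_add' φ ψ := by ext θ; simp [mul_add]
  map_smul' c φ := by ext θ; simp

theorem nailOp_apply (φ : FunSpace K) (θ : Equiv.Perm ℕ) : nailOp K φ θ = xi (θ 0) * φ θ := rfl

variable (K) in
/-- Contraction with the dual of the exterior generator of the strand `m`. -/
def contraction (m : ℕ) : Module.End K (ExteriorAlgebra K (ℕ →₀ K)) :=
  CliffordAlgebra.contractLeft (Finsupp.lapply m)

theorem contraction_xi_mul (m i : ℕ) (a : ExteriorAlgebra K (ℕ →₀ K)) :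
    contraction K m (xi i * a) = (if i = m then a else 0) - xi i * contraction K m a := by
  have h := CliffordAlgebra.contractLeft_ι_mul (Q := (0 : QuadraticForm K (ℕ →₀ K)))
    (d := Finsupp.lapply m) (Finsupp.single i 1) a
  refine h.trans ?_
  rw [Finsupp.lapply_apply, Finsupp.single_apply]
  split_ifs <;> simp <;> rfl

variable (K) in
/-- The functions that involve only the strands `0, …, n - 1`: they are supported on the
permutations of these strands, and their values do not contain the other exterior generators. -/
def funsOn (n : ℕ) : Submodule K (FunSpace K) where
  carrier := {φ | ∀ m, n ≤ m → ∀ θ, (θ m ≠ m → φ θ = 0) ∧ contraction K m (φ θ) = 0}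
  add_mem' {φ ψ} hφ hψ m hm θ :=
    ⟨fun h => by simp [(hφ m hm θ).1 h, (hψ m hm θ).1 h],
      by simp [(hφ m hm θ).2, (hψ m hm θ).2]⟩
  zero_mem' m hm θ := by simp
  smul_mem' c φ hφ m hm θ := ⟨fun h => by simp [(hφ m hm θ).1 h], by simp [(hφ m hm θ).2]⟩

theorem funsOn_mono {n n' : ℕ} (h : n ≤ n') : funsOn K n ≤ funsOn K n' :=
  fun _ hφ m hm => hφ m (h.trans hm)

theorem crossOp_mem_funsOn (α γ : ℕ → Equiv.Perm ℕ → K) {i n : ℕ} (h : i + 1 < n)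
    {φ : FunSpace K} (hφ : φ ∈ funsOn K n) : crossOp α γ i φ ∈ funsOn K n := by
  intro m hm θ
  have e : (θ * Equiv.swap i (i + 1)) m = θ m := by
    rw [Equiv.Perm.mul_apply, Equiv.swap_apply_of_ne_of_ne (by omega) (by omega)]
  refine ⟨fun hθ => ?_, ?_⟩
  · rw [crossOp_apply, (hφ m hm θ).1 hθ, (hφ m hm _).1 (by rwa [e])]
    simp
  · rw [crossOp_apply, map_add, map_smul, map_smul, (hφ m hm θ).2, (hφ m hm _).2]
    simp

theorem nailOp_mem_funsOn {n : ℕ} (h : 0 < n) {φ : FunSpace K} (hφ : φ ∈ funsOn K n) :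
    nailOp K φ ∈ funsOn K n := by
  intro m hm θ
  refine ⟨fun hθ => ?_, ?_⟩
  · rw [nailOp_apply, (hφ m hm θ).1 hθ, mul_zero]
  · rw [nailOp_apply, contraction_xi_mul, (hφ m hm θ).2, mul_zero, sub_zero]
    split_ifs with h0
    · refine (hφ m hm θ).1 fun h1 => ?_
      have := θ.injective (h0.trans h1.symm)
      omega
    · rfl

open Classical in
variable (K) in
/-- The indicator function of the identity permutation. -/
def deltaOne : FunSpace K := Pi.single 1 1

theorem deltaOne_one : deltaOne K 1 = 1 := by
  classical exact Pi.single_eq_same _ _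

theorem deltaOne_of_ne {θ : Equiv.Perm ℕ} (h : θ ≠ 1) : deltaOne K θ = 0 := by
  classical exact Pi.single_eq_of_ne h _

theorem deltaOne_mem_funsOn : deltaOne K ∈ funsOn K 0 := by
  intro m _ θ
  by_cases h : θ = 1
  · subst h
    refine ⟨fun h => by simp at h, ?_⟩
    rw [deltaOne_one]
    exact CliffordAlgebra.contractLeft_one (Q := (0 : QuadraticForm K (ℕ →₀ K)))
      (Finsupp.lapply m)
  · rw [deltaOne_of_ne h]
    simp

variable (α γ : ℕ → Equiv.Perm ℕ → K)

theorem eval_leftPath_mem_funsOn {n p c : ℕ} (h : p + c < n) {φ : FunSpace K}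
    (hφ : φ ∈ funsOn K n) : eval (crossOp α γ) (nailOp K) (leftPath p c) φ ∈ funsOn K n := by
  induction c generalizing p with
  | zero => simpa [leftPath] using hφ
  | succ c ih =>
    rw [leftPath, eval_T_cons, Module.End.mul_apply]
    exact crossOp_mem_funsOn α γ (by omega) (ih (by omega))

theorem eval_rightPath_mem_funsOn {n p : ℕ} (h : p < n) {φ : FunSpace K}
    (hφ : φ ∈ funsOn K n) : eval (crossOp α γ) (nailOp K) (rightPath p) φ ∈ funsOn K n := by
  induction p with
  | zero => simpa [rightPath] using hφ
  | succ c ih =>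
    rw [rightPath, eval_T_cons, Module.End.mul_apply]
    exact crossOp_mem_funsOn α γ (by omega) (ih (by omega))

theorem eval_path_mem_funsOn {n p : ℕ} (h : p ≤ n) (t : Bool) {φ : FunSpace K}
    (hφ : φ ∈ funsOn K (n + 1)) :
    eval (crossOp α γ) (nailOp K) (path n p t) φ ∈ funsOn K (n + 1) := by
  cases t with
  | false => exact eval_leftPath_mem_funsOn α γ (by omega) hφ
  | true =>
    simp only [path, eval_append, eval_W_cons, Module.End.mul_apply]
    exact eval_rightPath_mem_funsOn α γ (by omega) (nailOp_mem_funsOn (by omega)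
      (eval_leftPath_mem_funsOn α γ (by omega) hφ))

theorem eval_word_mem_funsOn {n : ℕ} (c : Code n) :
    eval (crossOp α γ) (nailOp K) c.word (deltaOne K) ∈ funsOn K n := by
  induction n with
  | zero => exact deltaOne_mem_funsOn
  | succ n ih =>
    simp only [Code.word, eval_append, Module.End.mul_apply]
    exact eval_path_mem_funsOn α γ (by have := c.1.1.2; omega) _
      (funsOn_mono (Nat.le_succ n) (ih c.2))

/-- Contraction, applied pointwise, commutes with left paths. -/
theorem contraction_leftPath (m p c : ℕ) (φ : FunSpace K) (θ : Equiv.Perm ℕ) :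
    contraction K m (eval (crossOp α γ) (nailOp K) (leftPath p c) φ θ) =
      eval (crossOp α γ) (nailOp K) (leftPath p c) (fun θ => contraction K m (φ θ)) θ := by
  induction c generalizing p θ with
  | zero => rfl
  | succ c ih =>
    simp only [leftPath, eval_T_cons, Module.End.mul_apply, crossOp_apply, map_add, map_smul, ih]

theorem contraction_rightPath (m p : ℕ) (φ : FunSpace K) (θ : Equiv.Perm ℕ) :
    contraction K m (eval (crossOp α γ) (nailOp K) (rightPath p) φ θ) =
      eval (crossOp α γ) (nailOp K) (rightPath p) (fun θ => contraction K m (φ θ)) θ := by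
  induction p generalizing θ with
  | zero => rfl
  | succ c ih =>
    simp only [rightPath, eval_T_cons, Module.End.mul_apply, crossOp_apply, map_add, map_smul, ih]

variable {α γ} (hγ : ∀ i θ, IsUnit (γ i θ))
include hγ

/-- A left path to the position `p` applied to a function on the first `n` strands vanishes where
the strand `n` is to the left of `p`, and where it is at `p` it is the function, up to units. -/
theorem leftPath_leading {n p c : ℕ} (h : p + c = n) :
    ∃ σ : Equiv.Perm ℕ, σ n = p ∧ ∀ φ : FunSpace K, (∀ θ, θ n ≠ n → φ θ = 0) → ∀ θ,
      (θ⁻¹ n < p → eval (crossOp α γ) (nailOp K) (leftPath p c) φ θ = 0) ∧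
      (θ⁻¹ n = p → ∃ u : Kˣ,
        eval (crossOp α γ) (nailOp K) (leftPath p c) φ θ = u • φ (θ * σ)) := by
  induction c generalizing p with
  | zero =>
    obtain rfl : p = n := by omega
    refine ⟨1, rfl, fun φ hφ θ => ⟨fun h => hφ θ fun h' => ?_, fun _ => ⟨1, by simp [leftPath]⟩⟩⟩
    rw [Equiv.Perm.inv_eq_iff_eq.2 h'.symm] at h
    exact lt_irrefl _ h
  | succ c ih =>
    obtain ⟨σ, hσ, hf⟩ := ih (p := p + 1) (by omega)
    refine ⟨Equiv.swap p (p + 1) * σ, by simp [hσ], fun φ hφ θ => ?_⟩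
    have e : (θ * Equiv.swap p (p + 1))⁻¹ n = Equiv.swap p (p + 1) (θ⁻¹ n) := by
      rw [mul_inv_rev, Equiv.swap_inv, Equiv.Perm.mul_apply]
    simp only [leftPath, eval_T_cons, Module.End.mul_apply, crossOp_apply]
    refine ⟨fun hθ => ?_, fun hθ => ?_⟩
    · rw [(hf φ hφ θ).1 (by omega), (hf φ hφ _).1 (by
        rw [e, Equiv.swap_apply_of_ne_of_ne (by omega) (by omega)]; omega)]
      simp
    · obtain ⟨u, hu⟩ := (hf φ hφ (θ * Equiv.swap p (p + 1))).2 (by rw [e, hθ]; simp)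
      refine ⟨(hγ p θ).unit * u, ?_⟩
      rw [(hf φ hφ θ).1 (by omega), hu, smul_zero, zero_add, mul_smul, mul_assoc]
      rfl

/-- The analogue of `leftPath_leading` for a right path applied to a function on the arrangements
with the strand `n` on the left: the result vanishes where this strand is to the right of `p`, and
where it is at `p` it is the function, up to units. -/
theorem rightPath_leading (n p : ℕ) :
    ∃ σ : Equiv.Perm ℕ, σ 0 = p ∧ ∀ φ : FunSpace K, (∀ θ, θ 0 ≠ n → φ θ = 0) → ∀ θ,
      (p < θ⁻¹ n → eval (crossOp α γ) (nailOp K) (rightPath p) φ θ = 0) ∧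
      (θ⁻¹ n = p → ∃ u : Kˣ,
        eval (crossOp α γ) (nailOp K) (rightPath p) φ θ = u • φ (θ * σ)) := by
  induction p with
  | zero =>
    refine ⟨1, rfl, fun φ hφ θ =>
      ⟨fun h => hφ θ fun h' => ?_, fun _ => ⟨1, by simp [rightPath]⟩⟩⟩
    rw [Equiv.Perm.inv_eq_iff_eq.2 h'.symm] at h
    exact lt_irrefl _ h
  | succ p ih =>
    obtain ⟨σ, hσ, hf⟩ := ih
    refine ⟨Equiv.swap p (p + 1) * σ, by simp [hσ], fun φ hφ θ => ?_⟩
    have e : (θ * Equiv.swap p (p + 1))⁻¹ n = Equiv.swap p (p + 1) (θ⁻¹ n) := by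
      rw [mul_inv_rev, Equiv.swap_inv, Equiv.Perm.mul_apply]
    simp only [rightPath, eval_T_cons, Module.End.mul_apply, crossOp_apply]
    refine ⟨fun hθ => ?_, fun hθ => ?_⟩
    · rw [(hf φ hφ θ).1 (by omega), (hf φ hφ _).1 (by
        rw [e, Equiv.swap_apply_of_ne_of_ne (by omega) (by omega)]; omega)]
      simp
    · obtain ⟨u, hu⟩ := (hf φ hφ (θ * Equiv.swap p (p + 1))).2 (by rw [e, hθ]; simp)
      refine ⟨(hγ p θ).unit * u, ?_⟩
      rw [(hf φ hφ θ).1 (by omega), hu, smul_zero, zero_add, mul_smul, mul_assoc]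
      rfl

/-- If a left path vanishes where the strand `n` is at the end of the path, then the function
it is applied to is zero. -/
theorem eq_zero_of_leftPath {n p c : ℕ} (h : p + c = n) {φ : FunSpace K}
    (hφ : ∀ θ, θ n ≠ n → φ θ = 0)
    (h0 : ∀ θ, θ⁻¹ n = p → eval (crossOp α γ) (nailOp K) (leftPath p c) φ θ = 0) : φ = 0 := by
  obtain ⟨σ, hσ, hf⟩ := leftPath_leading hγ h
  ext1 θ
  by_cases hθ : θ n = n
  · have hp : (θ * σ⁻¹)⁻¹ n = p := by
      rw [mul_inv_rev, inv_inv, Equiv.Perm.mul_apply, Equiv.Perm.inv_eq_iff_eq.2 hθ.symm, hσ]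
    obtain ⟨u, hu⟩ := (hf φ hφ (θ * σ⁻¹)).2 hp
    rw [h0 _ hp, inv_mul_cancel_right] at hu
    exact (smul_eq_zero_iff_eq u).1 hu.symm
  · exact hφ θ hθ

theorem eq_zero_of_rightPath {n p : ℕ} {φ : FunSpace K} (hφ : ∀ θ, θ 0 ≠ n → φ θ = 0)
    (h0 : ∀ θ, θ⁻¹ n = p → eval (crossOp α γ) (nailOp K) (rightPath p) φ θ = 0) : φ = 0 := by
  obtain ⟨σ, hσ, hf⟩ := rightPath_leading hγ n p
  ext1 θ
  by_cases hθ : θ 0 = n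
  · have hp : (θ * σ⁻¹)⁻¹ n = p := by
      rw [mul_inv_rev, inv_inv, Equiv.Perm.mul_apply, Equiv.Perm.inv_eq_iff_eq.2 hθ.symm, hσ]
    obtain ⟨u, hu⟩ := (hf φ hφ (θ * σ⁻¹)).2 hp
    rw [h0 _ hp, inv_mul_cancel_right] at hu
    exact (smul_eq_zero_iff_eq u).1 hu.symm
  · exact hφ θ hθ

/-- The paths of the strand `n` are independent over the functions on the strands to its left:
the contraction with its exterior generator singles out the nailed paths, and then the paths are
told apart by the position of the strand. -/
theorem eq_zero_of_sum_path {n : ℕ} (φ : Fin (n + 1) × Bool → FunSpace K)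
    (hφ : ∀ q, φ q ∈ funsOn K n)
    (h0 : ∑ q, eval (crossOp α γ) (nailOp K) (path n q.1 q.2) (φ q) = 0) : ∀ q, φ q = 0 := by
  have hs : ∀ q θ, θ n ≠ n → φ q θ = 0 := fun q θ => (hφ q n le_rfl θ).1
  have hc : ∀ q θ, contraction K n (φ q θ) = 0 := fun q θ => (hφ q n le_rfl θ).2
  have hL : ∀ q p c θ,
      contraction K n (eval (crossOp α γ) (nailOp K) (leftPath p c) (φ q) θ) = 0 := by
    intro q p c θ
    rw [contraction_leftPath, funext (hc q)]
    exact congrFun (map_zero _) θ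
  -- what remains of a nailed path between the nail and the end of the right path
  let z : Fin (n + 1) → FunSpace K := fun p θ =>
    if θ 0 = n then eval (crossOp α γ) (nailOp K) (leftPath 0 n) (φ (p, true)) θ else 0
  have hzs : ∀ p θ, θ 0 ≠ n → z p θ = 0 := fun p θ h => if_neg h
  have hpath : ∀ (p : Fin (n + 1)) θ, contraction K n
      (eval (crossOp α γ) (nailOp K) (path n p true) (φ (p, true)) θ) =
      eval (crossOp α γ) (nailOp K) (rightPath p) (z p) θ := by
    intro p θ
    simp only [path, eval_append, eval_W_cons, Module.End.mul_apply]
    rw [contraction_rightPath]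
    refine congrFun (congrArg _ (funext fun θ => ?_)) θ
    rw [nailOp_apply, contraction_xi_mul, hL, mul_zero, sub_zero]
  have hz0 : ∀ θ, ∑ p : Fin (n + 1), eval (crossOp α γ) (nailOp K) (rightPath p) (z p) θ = 0 := by
    intro θ
    have h := congrArg (contraction K n) (congrFun h0 θ)
    rw [Finset.sum_apply, map_sum, Fintype.sum_prod_type] at h
    simp only [Fintype.sum_bool, hpath] at h
    simpa [path, hL] using h
  -- where the strand `n` is at `p`, the paths to smaller positions vanish, and those to larger
  -- positions are zero by induction
  have hz : ∀ m, ∀ p : Fin (n + 1), n - p = m → z p = 0 := by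
    intro m
    induction m using Nat.strong_induction_on with
    | _ m ih =>
    intro p hp
    refine eq_zero_of_rightPath (α := α) hγ (n := n) (p := p) (hzs p) fun θ hθ => ?_
    rw [← hz0 θ]
    symm
    refine Fintype.sum_eq_single p fun q hq => ?_
    rcases lt_or_gt_of_ne hq with h | h
    · obtain ⟨_, -, hf⟩ := rightPath_leading (α := α) hγ n q
      exact (hf (z q) (hzs q) θ).1 (by rw [hθ]; exact h)
    · rw [ih (n - q) (by have : (p : ℕ) < q := h; have := q.2; omega) q rfl, map_zero]
      rfl
  have htrue : ∀ p, φ (p, true) = 0 := by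
    intro p
    refine eq_zero_of_leftPath (α := α) hγ (p := 0) (c := n) (by omega) (hs _) fun θ hθ => ?_
    have h := congrFun (hz _ p rfl) θ
    have h' : θ 0 = n := (Equiv.Perm.inv_eq_iff_eq.1 hθ).symm
    simpa [z, h'] using h
  -- the paths without nail
  have hf0 : ∀ θ, ∑ p : Fin (n + 1),
      eval (crossOp α γ) (nailOp K) (leftPath p (n - p)) (φ (p, false)) θ = 0 := by
    intro θ
    have h := congrFun h0 θ
    rw [Finset.sum_apply, Fintype.sum_prod_type] at h
    simp only [Fintype.sum_bool, htrue, map_zero, Pi.zero_apply, zero_add] at h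
    exact h
  -- here the paths to larger positions vanish, and those to smaller positions are zero by induction
  have hfalse : ∀ m, ∀ p : Fin (n + 1), (p : ℕ) = m → φ (p, false) = 0 := by
    intro m
    induction m using Nat.strong_induction_on with
    | _ m ih =>
    intro p hp
    have := p.2
    refine eq_zero_of_leftPath (α := α) hγ (p := p) (c := n - p) (by omega) (hs _) fun θ hθ => ?_
    rw [← hf0 θ]
    symm
    refine Fintype.sum_eq_single p fun q hq => ?_
    rcases lt_or_gt_of_ne hq with h | h
    · rw [ih q (by rw [← hp]; exact h) q rfl, map_zero]
      rfl
    · obtain ⟨_, -, hf⟩ := leftPath_leading (α := α) hγ (n := n) (p := q) (c := n - q)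
        (by have := q.2; omega)
      exact (hf _ (hs _) θ).1 (by rw [hθ]; exact h)
  rintro ⟨p, _ | _⟩
  · exact hfalse _ p rfl
  · exact htrue p

/-- The basis words applied to the indicator function of the identity are independent, if the
coefficients of the transpositions in the crossings are units. -/
theorem linearIndependent_word (n : ℕ) : LinearIndependent K fun c : Code n =>
    eval (crossOp α γ) (nailOp K) c.word (deltaOne K) := by
  induction n with
  | zero =>
    rw [Fintype.linearIndependent_iff]
    intro a h c
    obtain rfl : c = () := rfl
    have h : ∑ c : Unit, a c • deltaOne K = 0 := h
    have h1 := congrFun h 1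
    simp only [Finset.univ_unique, Finset.sum_singleton, Pi.smul_apply, deltaOne_one,
      Pi.zero_apply] at h1
    rw [← Algebra.algebraMap_eq_smul_one] at h1
    exact (ExteriorAlgebra.algebraMap_leftInverse (ℕ →₀ K)).injective (h1.trans (map_zero _).symm)
  | succ n ih =>
    rw [Fintype.linearIndependent_iff] at ih ⊢
    intro a h
    have h1 := eq_zero_of_sum_path (α := α) hγ
      (fun q => ∑ c : Code n, a (q, c) • eval (crossOp α γ) (nailOp K) c.word (deltaOne K))
      (fun q => sum_mem fun c _ => Submodule.smul_mem _ _ (eval_word_mem_funsOn α γ c)) (by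
        rw [← h]
        refine Eq.trans ?_ (Fintype.sum_prod_type (α₁ := Fin (n + 1) × Bool) (α₂ := Code n)
          (fun c => a c • eval (crossOp α γ) (nailOp K) (Code.word (n := n + 1) c)
            (deltaOne K))).symm
        refine Finset.sum_congr rfl fun q _ => ?_
        rw [map_sum]
        refine Finset.sum_congr rfl fun c _ => ?_
        simp only [map_smul, Code.word, eval_append, Module.End.mul_apply])
    rintro ⟨q, c⟩
    exact ih (fun c => a (q, c)) (h1 q) c

end Independence

end KLRW

/-! ### Crossings, dots and nails by position -/

namespace KLRW

open Strand Gen DGGen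

section Transport

variable {F A : Type*} [Ring F] [Ring A]

theorem LocalRel.map {b : ℕ} {Ns : List ℕ} (f : F →+* A) {x : Gen → F} {y z : F}
    (h : LocalRel b Ns x y z) : LocalRel b Ns (fun g => f (x g)) (f y) (f z) := by
  cases h <;> simp only [dots, map_mul, map_add, map_sum, map_one, map_zero, map_pow]
  · exact .idem_mul_self _
  · exact .idem_mul_ne _ _ ‹_›
  · exact .tgt_mul _
  · exact .mul_src _
  · exact .one
  · exact .not_seq _ ‹_›
  · exact .interchange _ _
  · exact .bb_sq _ _
  · exact .braid _ _
  · exact .bb_dot _ _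
  · exact .dot_bb _ _
  · exact .dot_rb _ _ _
  · exact .br_dot _ _ _
  · exact .br_rb _ _ _
  · exact .rb_br _ _ _
  · exact .bb_rb_rb _ _ _
  · exact .br_br_bb _ _ _
  · exact .rb_bb_br _ _ _

/-- Local relations between images under a ring homomorphism are the images of local relations. -/
theorem LocalRel.exists_of_map {b : ℕ} {Ns : List ℕ} (f : F →+* A) {x : Gen → F} {y z : A}
    (h : LocalRel b Ns (fun g => f (x g)) y z) :
    ∃ y' z', LocalRel b Ns x y' z' ∧ f y' = y ∧ f z' = z := by
  cases h with
  | idem_mul_self l => exact ⟨_, _, .idem_mul_self l, by simp, by simp⟩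
  | idem_mul_ne l m hl => exact ⟨_, _, .idem_mul_ne l m hl, by simp, by simp⟩
  | tgt_mul g => exact ⟨_, _, .tgt_mul g, by simp, by simp⟩
  | mul_src g => exact ⟨_, _, .mul_src g, by simp, by simp⟩
  | one => exact ⟨_, _, .one, by simp, by simp⟩
  | not_seq l hl => exact ⟨_, _, .not_seq l hl, by simp, by simp⟩
  | interchange g g' => exact ⟨_, _, .interchange g g', by simp, by simp⟩
  | bb_sq u v => exact ⟨_, _, .bb_sq u v, by simp, by simp⟩
  | braid u v => exact ⟨_, _, .braid u v, by simp, by simp⟩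
  | bb_dot u v => exact ⟨_, _, .bb_dot u v, by simp, by simp⟩
  | dot_bb u v => exact ⟨_, _, .dot_bb u v, by simp, by simp⟩
  | dot_rb u n v => exact ⟨_, _, .dot_rb u n v, by simp, by simp⟩
  | br_dot u n v => exact ⟨_, _, .br_dot u n v, by simp, by simp⟩
  | br_rb u n v => exact ⟨_, _, .br_rb u n v, by simp, by simp [dots]⟩
  | rb_br u n v => exact ⟨_, _, .rb_br u n v, by simp, by simp [dots]⟩
  | bb_rb_rb u n v => exact ⟨_, _, .bb_rb_rb u n v, by simp, by simp⟩
  | br_br_bb u n v => exact ⟨_, _, .br_br_bb u n v, by simp, by simp⟩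
  | rb_bb_br u n v => exact ⟨_, _, .rb_bb_br u n v, by simp, by simp [dots]⟩

/-- The local relations of the affine KLRW algebra hold for the elements `x g`. -/
def LocalHolds (b : ℕ) (Ns : List ℕ) (x : Gen → A) : Prop :=
  ∀ ⦃y z⦄, LocalRel b Ns x y z → y = z

end Transport

section Elements

variable {k : Type*} [CommRing k] {b : ℕ} {Ns : List ℕ}

theorem localHolds_dgPlain : LocalHolds b Ns (dgPlain k b Ns) := by
  intro y z h
  obtain ⟨y', z', h', rfl, rfl⟩ := LocalRel.exists_of_map
    (Pres.mk (DGRel k b Ns) : FreeAlgebra k DGGen →+* DGAlg k b Ns)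
    (x := fun g => FreeAlgebra.ι k (plain g)) h
  exact dgPlain_rel h'

variable (k b Ns) in
/-- The idempotent of a sequence of strands. -/
def dgE (l : List Strand) : DGAlg k b Ns := dgPlain k b Ns (idem l)

theorem dgE_mul_self (l : List Strand) : dgE k b Ns l * dgE k b Ns l = dgE k b Ns l :=
  localHolds_dgPlain (.idem_mul_self l)

theorem dgE_mul_ne {l m : List Strand} (h : l ≠ m) : dgE k b Ns l * dgE k b Ns m = 0 :=
  localHolds_dgPlain (.idem_mul_ne l m h)

theorem sum_dgE : ∑ l ∈ seqs b Ns, dgE k b Ns l = 1 := localHolds_dgPlain .one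

theorem dgE_not_mem {l : List Strand} (h : l ∉ seqs b Ns) : dgE k b Ns l = 0 :=
  localHolds_dgPlain (.not_seq l (by rwa [← mem_seqs]))

theorem mul_dgE_eq_sum (a : DGAlg k b Ns) : a = ∑ l ∈ seqs b Ns, a * dgE k b Ns l := by
  rw [← Finset.mul_sum, sum_dgE, mul_one]

theorem eq_of_mul_dgE {a a' : DGAlg k b Ns} (h : ∀ l, a * dgE k b Ns l = a' * dgE k b Ns l) :
    a = a' := by
  rw [mul_dgE_eq_sum a, mul_dgE_eq_sum a']
  exact Finset.sum_congr rfl fun l _ => h l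

theorem mem_of_mul_dgE {S : Submodule k (DGAlg k b Ns)} {a : DGAlg k b Ns}
    (h : ∀ l, a * dgE k b Ns l ∈ S) : a ∈ S := by
  rw [mul_dgE_eq_sum a]
  exact sum_mem fun l _ => h l

theorem sum_mul_dgE {f : List Strand → DGAlg k b Ns} (hf : ∀ l, f l * dgE k b Ns l = f l)
    (l : List Strand) : (∑ m ∈ seqs b Ns, f m) * dgE k b Ns l = f l := by
  rw [Finset.sum_mul]
  by_cases hl : l ∈ seqs b Ns
  · rw [Finset.sum_eq_single_of_mem l hl, hf]
    intro m _ hm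
    rw [← hf m, mul_assoc, dgE_mul_ne hm, mul_zero]
  · rw [← hf l, dgE_not_mem hl]
    simp

/-- The crossing of the neighbouring strands `c` and `d`; two red strands do not cross. -/
def crossGen (u : List Strand) (c d : Strand) (v : List Strand) : Option Gen :=
  match c, d with
  | black, black => some (bb u v)
  | black, red n => some (br u n v)
  | red n, black => some (rb u n v)
  | red _, red _ => none

theorem crossGen_addRight (u : List Strand) (c d : Strand) (v w : List Strand) :
    crossGen u c d (v ++ w) = (crossGen u c d v).map (Gen.addRight w) := by
  cases c <;> cases d <;> rfl

theorem crossGen_addLeft (u : List Strand) (c d : Strand) (v w : List Strand) :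
    crossGen (w ++ u) c d v = (crossGen u c d v).map (Gen.addLeft w) := by
  cases c <;> cases d <;> rfl

theorem src_of_crossGen {u : List Strand} {c d : Strand} {v : List Strand} {g : Gen}
    (h : crossGen u c d v = some g) : g.src = u ++ c :: d :: v := by
  cases c <;> cases d <;> simp_all [crossGen] <;> subst h <;> rfl

theorem tgt_of_crossGen {u : List Strand} {c d : Strand} {v : List Strand} {g : Gen}
    (h : crossGen u c d v = some g) : g.tgt = u ++ d :: c :: v := by
  cases c <;> cases d <;> simp_all [crossGen] <;> subst h <;> rfl

variable (k b Ns) in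
/-- The class of the crossing of the neighbouring strands `c` and `d`. -/
def dgCross (u : List Strand) (c d : Strand) (v : List Strand) : DGAlg k b Ns :=
  (crossGen u c d v).elim 0 (dgPlain k b Ns)

theorem dgE_mul_cross (u : List Strand) (c d : Strand) (v : List Strand) :
    dgE k b Ns (u ++ d :: c :: v) * dgCross k b Ns u c d v = dgCross k b Ns u c d v := by
  rw [dgCross]
  rcases h : crossGen u c d v with _ | g
  · simp
  · rw [← tgt_of_crossGen h]
    exact dgPlain_tgt_mul g

theorem cross_mul_dgE (u : List Strand) (c d : Strand) (v : List Strand) :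
    dgCross k b Ns u c d v * dgE k b Ns (u ++ c :: d :: v) = dgCross k b Ns u c d v := by
  rw [dgCross]
  rcases h : crossGen u c d v with _ | g
  · simp
  · rw [← src_of_crossGen h]
    exact dgPlain_mul_src g

theorem cross_mul_cross_far (u : List Strand) (c d : Strand) (w : List Strand) (c' d' : Strand)
    (v : List Strand) :
    dgCross k b Ns u c d (w ++ d' :: c' :: v) * dgCross k b Ns (u ++ c :: d :: w) c' d' v =
      dgCross k b Ns (u ++ d :: c :: w) c' d' v * dgCross k b Ns u c d (w ++ c' :: d' :: v) := by
  have e₁ := crossGen_addLeft [] c' d' v (u ++ c :: d :: w)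
  have e₂ := crossGen_addLeft [] c' d' v (u ++ d :: c :: w)
  rw [List.append_nil] at e₁ e₂
  simp only [dgCross, crossGen_addRight, e₁, e₂]
  rcases h : crossGen u c d w with _ | g
  · simp
  rcases h' : crossGen [] c' d' v with _ | g'
  · simp
  have := dgPlain_interchange (k := k) (b := b) (Ns := Ns) g g'
  rw [src_of_crossGen h, tgt_of_crossGen h, src_of_crossGen h', tgt_of_crossGen h'] at this
  exact this

theorem cross_mul_dot_left (u w : List Strand) (c d : Strand) (v : List Strand) :
    dgPlain k b Ns (dot u (w ++ d :: c :: v)) * dgCross k b Ns (u ++ black :: w) c d v =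
      dgCross k b Ns (u ++ black :: w) c d v *
        dgPlain k b Ns (dot u (w ++ c :: d :: v)) := by
  have e := crossGen_addLeft [] c d v (u ++ black :: w)
  rw [List.append_nil] at e
  simp only [dgCross, e]
  rcases h : crossGen [] c d v with _ | g
  · simp
  have := dgPlain_interchange (k := k) (b := b) (Ns := Ns) (dot u w) g
  rw [src_of_crossGen h, tgt_of_crossGen h] at this
  exact this

theorem cross_mul_dot_right (u w : List Strand) (c d : Strand) (v : List Strand) :
    dgPlain k b Ns (dot (u ++ d :: c :: w) v) * dgCross k b Ns u c d (w ++ black :: v) =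
      dgCross k b Ns u c d (w ++ black :: v) *
        dgPlain k b Ns (dot (u ++ c :: d :: w) v) := by
  simp only [dgCross, crossGen_addRight]
  rcases h : crossGen u c d w with _ | g
  · simp
  have := dgPlain_interchange (k := k) (b := b) (Ns := Ns) g (dot [] v)
  rw [src_of_crossGen h, tgt_of_crossGen h] at this
  simp only [Gen.addLeft, Gen.src, Gen.tgt, List.append_nil, List.nil_append] at this
  exact this.symm

theorem nail_mul_cross (u : List Strand) (c d : Strand) (v : List Strand) :
    dgNail k b Ns (u ++ d :: c :: v) * dgCross k b Ns (black :: u) c d v =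
      dgCross k b Ns (black :: u) c d v * dgNail k b Ns (u ++ c :: d :: v) := by
  have e := crossGen_addLeft u c d v [black]
  rw [List.singleton_append] at e
  simp only [dgCross, e]
  rcases h : crossGen u c d v with _ | g
  · simp
  have := dgNail_interchange (k := k) (b := b) (Ns := Ns) g
  rw [src_of_crossGen h, tgt_of_crossGen h] at this
  exact this

variable (k b Ns) in
/-- The crossing at the positions `i` and `i + 1` of a sequence. -/
def crossAt (i : ℕ) (l : List Strand) : DGAlg k b Ns :=
  match l.drop i with
  | c :: d :: v => dgCross k b Ns (l.take i) c d v
  | _ => 0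

variable (k b Ns) in
/-- The dot at the position `i` of a sequence. -/
def dotAt (i : ℕ) (l : List Strand) : DGAlg k b Ns :=
  match l.drop i with
  | black :: v => dgPlain k b Ns (dot (l.take i) v)
  | _ => 0

variable (k b Ns) in
/-- The nail on the first strand of a sequence. -/
def nailAt : List Strand → DGAlg k b Ns
  | black :: v => dgNail k b Ns v
  | _ => 0

theorem exists_split {i : ℕ} {l : List Strand} (h : i < l.length) :
    ∃ u c v, l = u ++ c :: v ∧ u.length = i :=
  ⟨l.take i, l[i], l.drop (i + 1), by simp, by simp; omega⟩

theorem exists_split₂ {i : ℕ} {l : List Strand} (h : i + 1 < l.length) :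
    ∃ u c d v, l = u ++ c :: d :: v ∧ u.length = i := by
  obtain ⟨u, c, v, rfl, hu⟩ := exists_split (Nat.lt_of_succ_lt h)
  rcases v with _ | ⟨d, v⟩
  · simp at h; omega
  · exact ⟨u, c, d, v, rfl, hu⟩

theorem crossAt_eq {i : ℕ} {l u : List Strand} {c d : Strand} {v : List Strand}
    (hl : l = u ++ c :: d :: v) (hi : i = u.length) :
    crossAt k b Ns i l = dgCross k b Ns u c d v := by
  subst hl hi; simp [crossAt]

theorem crossAt_of_length_le {i : ℕ} {l : List Strand} (h : l.length ≤ i + 1) :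
    crossAt k b Ns i l = 0 := by
  have : (l.drop i).length ≤ 1 := by simp; omega
  rw [crossAt]
  generalize l.drop i = m at this
  rcases m with _ | ⟨c, _ | ⟨d, v⟩⟩
  · rfl
  · rfl
  · simp at this

theorem dotAt_black {i : ℕ} {l u v : List Strand} (hl : l = u ++ black :: v)
    (hi : i = u.length) : dotAt k b Ns i l = dgPlain k b Ns (dot u v) := by
  subst hl hi; simp [dotAt]

theorem dotAt_red {i : ℕ} {l u : List Strand} {n : ℕ} {v : List Strand}
    (hl : l = u ++ red n :: v) (hi : i = u.length) : dotAt k b Ns i l = 0 := by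
  subst hl hi; simp [dotAt]

theorem dotAt_of_length_le {i : ℕ} {l : List Strand} (h : l.length ≤ i) :
    dotAt k b Ns i l = 0 := by
  rw [dotAt, List.drop_of_length_le h]

theorem crossAt_mul_dgE (i : ℕ) (l : List Strand) :
    crossAt k b Ns i l * dgE k b Ns l = crossAt k b Ns i l := by
  by_cases h : i + 1 < l.length
  · obtain ⟨u, c, d, v, rfl, rfl⟩ := exists_split₂ h
    rw [crossAt_eq rfl rfl, cross_mul_dgE]
  · rw [crossAt_of_length_le (by omega), zero_mul]

theorem dotAt_mul_dgE (i : ℕ) (l : List Strand) :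
    dotAt k b Ns i l * dgE k b Ns l = dotAt k b Ns i l := by
  by_cases h : i < l.length
  · obtain ⟨u, _ | n, v, rfl, rfl⟩ := exists_split h
    · rw [dotAt_black rfl rfl]
      exact dgPlain_mul_src (dot u v)
    · rw [dotAt_red rfl rfl, zero_mul]
  · rw [dotAt_of_length_le (by omega), zero_mul]

theorem dgE_mul_dotAt (i : ℕ) (l : List Strand) :
    dgE k b Ns l * dotAt k b Ns i l = dotAt k b Ns i l := by
  by_cases h : i < l.length
  · obtain ⟨u, _ | n, v, rfl, rfl⟩ := exists_split h
    · rw [dotAt_black rfl rfl]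
      exact dgPlain_tgt_mul (dot u v)
    · rw [dotAt_red rfl rfl, mul_zero]
  · rw [dotAt_of_length_le (by omega), mul_zero]

theorem nailAt_mul_dgE (l : List Strand) :
    nailAt k b Ns l * dgE k b Ns l = nailAt k b Ns l := by
  rcases l with _ | ⟨_ | n, v⟩
  · simp [nailAt]
  · exact dgNail_src v
  · simp [nailAt]

theorem dgE_mul_nailAt (l : List Strand) :
    dgE k b Ns l * nailAt k b Ns l = nailAt k b Ns l := by
  rcases l with _ | ⟨_ | n, v⟩
  · simp [nailAt]
  · exact dgNail_tgt v
  · simp [nailAt]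

variable (k b Ns) in
/-- The sum of the crossings at the positions `i` and `i + 1`. -/
def dgT (i : ℕ) : DGAlg k b Ns := ∑ l ∈ seqs b Ns, crossAt k b Ns i l

variable (k b Ns) in
/-- The sum of the dots at the position `i`. -/
def dgX (i : ℕ) : DGAlg k b Ns := ∑ l ∈ seqs b Ns, dotAt k b Ns i l

variable (k b Ns) in
/-- The sum of the nails. -/
def dgW : DGAlg k b Ns := ∑ l ∈ seqs b Ns, nailAt k b Ns l

theorem dgT_mul_dgE (i : ℕ) (l : List Strand) :
    dgT k b Ns i * dgE k b Ns l = crossAt k b Ns i l := sum_mul_dgE (crossAt_mul_dgE i) l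

theorem dgX_mul_dgE (i : ℕ) (l : List Strand) :
    dgX k b Ns i * dgE k b Ns l = dotAt k b Ns i l := sum_mul_dgE (dotAt_mul_dgE i) l

theorem dgW_mul_dgE (l : List Strand) :
    dgW k b Ns * dgE k b Ns l = nailAt k b Ns l := sum_mul_dgE nailAt_mul_dgE l

section

variable {l : List Strand} {a : DGAlg k b Ns} (ha : dgE k b Ns l * a = a)
include ha

theorem dgT_mul (i : ℕ) : dgT k b Ns i * a = crossAt k b Ns i l * a := by
  rw [← dgT_mul_dgE, mul_assoc, ha]

theorem dgX_mul (i : ℕ) : dgX k b Ns i * a = dotAt k b Ns i l * a := by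
  rw [← dgX_mul_dgE, mul_assoc, ha]

theorem dgW_mul : dgW k b Ns * a = nailAt k b Ns l * a := by
  rw [← dgW_mul_dgE, mul_assoc, ha]

end

theorem dgE_mul_cross' {u : List Strand} {c d : Strand} {v : List Strand} (a : DGAlg k b Ns) :
    dgE k b Ns (u ++ d :: c :: v) * (dgCross k b Ns u c d v * a) =
      dgCross k b Ns u c d v * a := by
  rw [← mul_assoc, dgE_mul_cross]

end Elements

end KLRW

/-! ### Relations between crossings, dots and nails -/

namespace KLRW

open Strand Gen DGGen

section

variable {k : Type*} [CommRing k] {b : ℕ} {Ns : List ℕ}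

theorem dgT_far (i j : ℕ) (h : i + 2 ≤ j) :
    dgT k b Ns i * dgT k b Ns j = dgT k b Ns j * dgT k b Ns i := by
  refine eq_of_mul_dgE fun l => ?_
  rw [mul_assoc, mul_assoc, dgT_mul_dgE, dgT_mul_dgE]
  by_cases hl : j + 1 < l.length
  · obtain ⟨p, c', d', v, rfl, rfl⟩ := exists_split₂ hl
    obtain ⟨u, c, d, w, rfl, rfl⟩ := exists_split₂ (i := i) (l := p) (by omega)
    rw [crossAt_eq rfl rfl, crossAt_eq (u := u) (c := c) (d := d) (v := w ++ c' :: d' :: v)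
      (by simp) rfl, dgT_mul (dgE_mul_cross _ _ _ _), dgT_mul (dgE_mul_cross _ _ _ _),
      crossAt_eq (u := u) (c := c) (d := d) (v := w ++ d' :: c' :: v) (by simp) rfl,
      crossAt_eq (u := u ++ d :: c :: w) (c := c') (d := d') (v := v) (by simp) (by simp),
      cross_mul_cross_far]
  · rw [crossAt_of_length_le (i := j) (by omega), mul_zero]
    by_cases hi : i + 1 < l.length
    · obtain ⟨u, c, d, w, rfl, rfl⟩ := exists_split₂ hi
      rw [crossAt_eq rfl rfl, dgT_mul (dgE_mul_cross _ _ _ _),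
        crossAt_of_length_le (i := j) (by simp at *; omega), zero_mul]
    · rw [crossAt_of_length_le (by omega), mul_zero]

theorem dgX_far_left (i j : ℕ) (h : j < i) :
    dgX k b Ns j * dgT k b Ns i = dgT k b Ns i * dgX k b Ns j := by
  refine eq_of_mul_dgE fun l => ?_
  rw [mul_assoc, mul_assoc, dgT_mul_dgE, dgX_mul_dgE, dgT_mul (dgE_mul_dotAt j l)]
  by_cases hl : i + 1 < l.length
  · obtain ⟨p, c, d, v, rfl, rfl⟩ := exists_split₂ hl
    obtain ⟨u, s, w, rfl, rfl⟩ := exists_split (i := j) (l := p) (by omega)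
    rw [crossAt_eq rfl rfl, dgX_mul (dgE_mul_cross _ _ _ _)]
    rcases s with _ | n
    · rw [dotAt_black (u := u) (v := w ++ d :: c :: v) (by simp) rfl,
        dotAt_black (u := u) (v := w ++ c :: d :: v) (by simp) rfl, cross_mul_dot_left]
    · rw [dotAt_red (u := u) (v := w ++ d :: c :: v) (n := n) (by simp) rfl,
        dotAt_red (u := u) (v := w ++ c :: d :: v) (n := n) (by simp) rfl, mul_zero, zero_mul]
  · rw [crossAt_of_length_le (by omega), mul_zero, zero_mul]

theorem dgX_far_right (i j : ℕ) (h : i + 2 ≤ j) :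
    dgX k b Ns j * dgT k b Ns i = dgT k b Ns i * dgX k b Ns j := by
  refine eq_of_mul_dgE fun l => ?_
  rw [mul_assoc, mul_assoc, dgT_mul_dgE, dgX_mul_dgE, dgT_mul (dgE_mul_dotAt j l)]
  by_cases hi : i + 1 < l.length
  · obtain ⟨u, c, d, w, rfl, rfl⟩ := exists_split₂ hi
    rw [crossAt_eq rfl rfl, dgX_mul (dgE_mul_cross _ _ _ _)]
    by_cases hl : j < (u ++ c :: d :: w).length
    · obtain ⟨w, s, v, rfl, hw⟩ := exists_split (i := j - u.length - 2) (l := w)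
        (by simp at *; omega)
      rcases s with _ | n
      · rw [dotAt_black (u := u ++ d :: c :: w) (v := v) (by simp) (by simp; omega),
          dotAt_black (u := u ++ c :: d :: w) (v := v) (by simp) (by simp; omega),
          cross_mul_dot_right]
      · rw [dotAt_red (u := u ++ d :: c :: w) (v := v) (n := n) (by simp) (by simp; omega),
          dotAt_red (u := u ++ c :: d :: w) (v := v) (n := n) (by simp) (by simp; omega),
          mul_zero, zero_mul]
    · rw [dotAt_of_length_le (by simp at *; omega), dotAt_of_length_le (by omega), mul_zero,
        zero_mul]
  · rw [crossAt_of_length_le (by omega), mul_zero, zero_mul]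

theorem dgX_comm (i j : ℕ) : dgX k b Ns i * dgX k b Ns j = dgX k b Ns j * dgX k b Ns i := by
  wlog h : i < j generalizing i j
  · rcases (not_lt.1 h).eq_or_lt with rfl | h
    · rfl
    · exact (this j i h).symm
  refine eq_of_mul_dgE fun l => ?_
  rw [mul_assoc, mul_assoc, dgX_mul_dgE, dgX_mul_dgE, dgX_mul (dgE_mul_dotAt j l),
    dgX_mul (dgE_mul_dotAt i l)]
  by_cases hl : j < l.length
  · obtain ⟨p, t, v, rfl, rfl⟩ := exists_split hl
    obtain ⟨u, s, w, rfl, rfl⟩ := exists_split (i := i) (l := p) (by omega)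
    rcases t with _ | n
    · rcases s with _ | m
      · rw [dotAt_black rfl rfl, dotAt_black (u := u) (v := w ++ black :: v) (by simp) rfl]
        simpa [Gen.addLeft, Gen.addRight, Gen.src, Gen.tgt] using
          dgPlain_interchange (k := k) (b := b) (Ns := Ns) (dot u w) (dot [] v)
      · rw [dotAt_red (i := u.length) (u := u) (n := m) (v := w ++ black :: v) (by simp) rfl,
          mul_zero, zero_mul]
    · rw [dotAt_red (i := (u ++ s :: w).length) rfl rfl, mul_zero, zero_mul]
  · rw [dotAt_of_length_le (i := j) (by omega), mul_zero, zero_mul]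

theorem dgX_comm_dgE (i : ℕ) (l : List Strand) :
    dgX k b Ns i * dgE k b Ns l = dgE k b Ns l * dgX k b Ns i := by
  refine eq_of_mul_dgE fun m => ?_
  rw [mul_assoc, mul_assoc, dgX_mul_dgE]
  by_cases h : l = m
  · subst h
    rw [dgE_mul_self, dgX_mul_dgE, dgE_mul_dotAt]
  · rw [dgE_mul_ne h, ← dgE_mul_dotAt, ← mul_assoc, dgE_mul_ne h, mul_zero, zero_mul]

theorem dgE_comm (l m : List Strand) :
    dgE k b Ns l * dgE k b Ns m = dgE k b Ns m * dgE k b Ns l := by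
  by_cases h : l = m
  · rw [h]
  · rw [dgE_mul_ne h, dgE_mul_ne (Ne.symm h)]

theorem dgW_comm_dgE (l : List Strand) :
    dgE k b Ns l * dgW k b Ns = dgW k b Ns * dgE k b Ns l := by
  refine eq_of_mul_dgE fun m => ?_
  rw [mul_assoc, mul_assoc, dgW_mul_dgE]
  by_cases h : l = m
  · subst h
    rw [dgE_mul_self, dgW_mul_dgE, dgE_mul_nailAt]
  · rw [dgE_mul_ne h, ← dgE_mul_nailAt, ← mul_assoc, dgE_mul_ne h, mul_zero, zero_mul]

theorem dgW_comm_dgX (i : ℕ) : dgX k b Ns i * dgW k b Ns = dgW k b Ns * dgX k b Ns i := by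
  refine eq_of_mul_dgE fun l => ?_
  rw [mul_assoc, mul_assoc, dgW_mul_dgE, dgX_mul_dgE, dgW_mul (dgE_mul_dotAt i l),
    dgX_mul (dgE_mul_nailAt l)]
  rcases l with _ | ⟨_ | n, l⟩
  · simp [nailAt]
  · rcases i with _ | i
    · rw [dotAt_black (l := black :: l) (u := []) (i := 0) rfl rfl]
      exact dgNail_dot l
    · by_cases h : i < l.length
      · obtain ⟨u, _ | n, v, rfl, rfl⟩ := exists_split h
        · rw [dotAt_black (i := u.length + 1) (l := black :: (u ++ black :: v)) (u := black :: u)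
            (v := v)
            rfl rfl]
          exact (dgNail_interchange (dot u v)).symm
        · rw [dotAt_red (i := u.length + 1) (l := black :: (u ++ red n :: v)) (u := black :: u)
            (v := v) rfl rfl, zero_mul, mul_zero]
      · rw [dotAt_of_length_le (by simp; omega), zero_mul, mul_zero]
  · simp [nailAt]

theorem dgT_dgW (i : ℕ) :
    dgT k b Ns (i + 1) * dgW k b Ns = dgW k b Ns * dgT k b Ns (i + 1) := by
  refine eq_of_mul_dgE fun l => ?_
  rw [mul_assoc, mul_assoc, dgW_mul_dgE, dgT_mul_dgE, dgT_mul (dgE_mul_nailAt l)]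
  rcases l with _ | ⟨c₀, l⟩
  · simp [nailAt, crossAt]
  by_cases h : i + 1 < l.length
  · obtain ⟨u, c, d, v, rfl, rfl⟩ := exists_split₂ h
    rw [crossAt_eq (i := u.length + 1) (l := c₀ :: (u ++ c :: d :: v)) (u := c₀ :: u) (c := c)
      (d := d) (v := v) rfl rfl,
      dgW_mul (dgE_mul_cross _ _ _ _)]
    rcases c₀ with _ | n
    · exact (nail_mul_cross u c d v).symm
    · simp [nailAt]
  · rw [crossAt_of_length_le (by simp; omega), zero_mul, mul_zero]

theorem dgW_sq : dgW k b Ns * dgW k b Ns = 0 := by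
  refine eq_of_mul_dgE fun l => ?_
  rw [mul_assoc, dgW_mul_dgE, zero_mul, dgW_mul (dgE_mul_nailAt l)]
  rcases l with _ | ⟨_ | n, l⟩
  · simp [nailAt]
  · exact dgNail_sq l
  · simp [nailAt]

theorem dgW_anticomm : dgT k b Ns 0 * dgW k b Ns * dgT k b Ns 0 * dgW k b Ns =
    -(dgW k b Ns * dgT k b Ns 0 * dgW k b Ns * dgT k b Ns 0) := by
  refine eq_of_mul_dgE fun l => ?_
  rw [neg_mul]
  simp only [mul_assoc]
  rw [dgW_mul_dgE, dgT_mul_dgE]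
  have hE : ∀ (l : List Strand) (a : DGAlg k b Ns), dgE k b Ns l * (nailAt k b Ns l * a) =
      nailAt k b Ns l * a := fun l a => by rw [← mul_assoc, dgE_mul_nailAt]
  rcases l with _ | ⟨c, _ | ⟨d, v⟩⟩
  · simp [nailAt, crossAt]
  · rw [dgT_mul (dgE_mul_nailAt _), crossAt_of_length_le (by simp)]
    simp
  · have e₀ : ∀ c d, crossAt k b Ns 0 (c :: d :: v) = dgCross k b Ns [] c d v := fun c d =>
      crossAt_eq rfl rfl
    have hC : ∀ c d (a : DGAlg k b Ns), dgE k b Ns (d :: c :: v) * (dgCross k b Ns [] c d v * a) =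
      dgCross k b Ns [] c d v * a := fun c d a => dgE_mul_cross' (u := []) a
    have hC1 : dgE k b Ns (d :: c :: v) * dgCross k b Ns [] c d v = dgCross k b Ns [] c d v :=
      dgE_mul_cross [] c d v
    rw [dgT_mul (dgE_mul_nailAt _), e₀, dgW_mul (hC _ _ _), dgT_mul (hE _ _), e₀,
      dgW_mul hC1, dgT_mul (hE _ _), e₀, dgW_mul (hC _ _ _)]
    rcases c with _ | m
    · rcases d with _ | n
      · have h := dgNail_anticomm (k := k) (b := b) (Ns := Ns) v
        simp only [mul_assoc] at h
        exact h
      · simp [nailAt]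
    · simp [nailAt]

variable (k b Ns) in
/-- The dots and the idempotents. -/
def dgG : Set (DGAlg k b Ns) := Set.range (dgX k b Ns) ∪ Set.range (dgE k b Ns)

variable (k b Ns) in
/-- The subalgebra generated by the dots and the idempotents. -/
abbrev dgC : Subalgebra k (DGAlg k b Ns) := Algebra.adjoin k (dgG k b Ns)

theorem dgE_mem (l : List Strand) : dgE k b Ns l ∈ dgC k b Ns :=
  Algebra.subset_adjoin (Or.inr ⟨l, rfl⟩)

theorem dgX_mem (i : ℕ) : dgX k b Ns i ∈ dgC k b Ns :=
  Algebra.subset_adjoin (Or.inl ⟨i, rfl⟩)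

theorem dot_mem (u v : List Strand) : dgPlain k b Ns (dot u v) ∈ dgC k b Ns := by
  have h := mul_mem (dgX_mem u.length) (dgE_mem (k := k) (b := b) (Ns := Ns) (u ++ black :: v))
  rwa [dgX_mul_dgE, dotAt_black rfl rfl] at h

theorem dgPlain_dots_mem (u : List Strand) (m : ℕ) (v : List Strand) :
    dots (dgPlain k b Ns) u m v ∈ dgC k b Ns :=
  mul_mem (dgE_mem _) (pow_mem (dot_mem u v) m)

theorem dgT_sq_mem (i : ℕ) : dgT k b Ns i * dgT k b Ns i ∈ dgC k b Ns := by
  refine mem_of_mul_dgE (S := Subalgebra.toSubmodule (dgC k b Ns)) fun l => ?_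
  rw [mul_assoc, dgT_mul_dgE]
  by_cases h : i + 1 < l.length
  · obtain ⟨u, c, d, v, rfl, rfl⟩ := exists_split₂ h
    rw [crossAt_eq rfl rfl, dgT_mul (dgE_mul_cross _ _ _ _), crossAt_eq rfl rfl]
    rcases c with _ | m <;> rcases d with _ | n
    · rw [show dgCross k b Ns u black black v * dgCross k b Ns u black black v = 0 from
        dgPlain_bb_sq u v]
      exact zero_mem _
    · rw [show dgCross k b Ns u (red n) black v * dgCross k b Ns u black (red n) v = _ from
        localHolds_dgPlain (.rb_br u n v)]
      exact dgPlain_dots_mem _ _ _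
    · rw [show dgCross k b Ns u black (red m) v * dgCross k b Ns u (red m) black v = _ from
        localHolds_dgPlain (.br_rb u m v)]
      exact dgPlain_dots_mem _ _ _
    · simp [dgCross, crossGen]
  · rw [crossAt_of_length_le (by omega), mul_zero]
    exact zero_mem _

theorem dgT_braid_mem (i : ℕ) : dgT k b Ns i * dgT k b Ns (i + 1) * dgT k b Ns i -
    dgT k b Ns (i + 1) * dgT k b Ns i * dgT k b Ns (i + 1) ∈ dgC k b Ns := by
  refine mem_of_mul_dgE (S := Subalgebra.toSubmodule (dgC k b Ns)) fun l => ?_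
  rw [sub_mul]
  simp only [mul_assoc]
  rw [dgT_mul_dgE, dgT_mul_dgE]
  by_cases h : i + 2 < l.length
  · obtain ⟨u, a, c, v, rfl, rfl⟩ := exists_split₂ (Nat.lt_of_succ_lt h)
    rcases v with _ | ⟨d, v⟩
    · simp at h
    have e₁ : ∀ a c d : Strand, crossAt k b Ns u.length (u ++ a :: c :: d :: v) =
      dgCross k b Ns u a c (d :: v) := fun a c d => crossAt_eq rfl rfl
    have e₂ : ∀ a c d : Strand, crossAt k b Ns (u.length + 1) (u ++ a :: c :: d :: v) =
      dgCross k b Ns (u ++ [a]) c d v := fun a c d => crossAt_eq (by simp) (by simp)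
    have h₁ : ∀ a c d, dgE k b Ns (u ++ c :: a :: d :: v) * dgCross k b Ns u a c (d :: v) =
      dgCross k b Ns u a c (d :: v) := fun a c d => dgE_mul_cross _ _ _ _
    have h₁' : ∀ a c d (x : DGAlg k b Ns),
      dgE k b Ns (u ++ c :: a :: d :: v) * (dgCross k b Ns u a c (d :: v) * x) =
      dgCross k b Ns u a c (d :: v) * x := fun a c d x => dgE_mul_cross' _
    have h₂ : ∀ a c d, dgE k b Ns (u ++ a :: d :: c :: v) * dgCross k b Ns (u ++ [a]) c d v =
      dgCross k b Ns (u ++ [a]) c d v := fun a c d => by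
        simpa using dgE_mul_cross (k := k) (b := b) (Ns := Ns) (u ++ [a]) c d v
    have h₂' : ∀ a c d (x : DGAlg k b Ns),
      dgE k b Ns (u ++ a :: d :: c :: v) * (dgCross k b Ns (u ++ [a]) c d v * x) =
      dgCross k b Ns (u ++ [a]) c d v * x := fun a c d x => by rw [← mul_assoc, h₂]
    rw [e₁, e₂, dgT_mul (h₁ _ _ _), e₂, dgT_mul (h₂' _ _ _ _), e₁, dgT_mul (h₂ _ _ _), e₁,
      dgT_mul (h₁' _ _ _ _), e₂]
    simp only [← mul_assoc]
    rcases a with _ | n₁ <;> rcases c with _ | n₂ <;> rcases d with _ | n₃ <;>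
      simp only [dgCross, crossGen, Option.elim_some, Option.elim_none, mul_zero, zero_mul,
        sub_zero]
    · rw [localHolds_dgPlain (.braid u v), sub_self]
      exact zero_mem _
    · rw [localHolds_dgPlain (.br_br_bb u n₃ v), sub_self]
      exact zero_mem _
    · rw [localHolds_dgPlain (.rb_bb_br u n₂ v), add_sub_cancel_left]
      exact Subalgebra.sum_mem (dgC k b Ns) fun i _ =>
        mul_mem (dgPlain_dots_mem _ _ _) (dgPlain_dots_mem _ _ _)
    · exact zero_mem _
    · rw [localHolds_dgPlain (.bb_rb_rb u n₁ v), sub_self]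
      exact zero_mem _
    · exact zero_mem _
    · exact zero_mem _
    · exact zero_mem _
  · rw [crossAt_of_length_le (i := i + 1) (by omega), mul_zero, mul_zero, sub_zero]
    by_cases hi : i + 1 < l.length
    · obtain ⟨u, c, d, v, rfl, rfl⟩ := exists_split₂ hi
      rw [crossAt_eq rfl rfl, dgT_mul (dgE_mul_cross _ _ _ _),
        crossAt_of_length_le (i := u.length + 1) (by
          simp only [List.length_append, List.length_cons] at h ⊢; omega), zero_mul, mul_zero]
      exact zero_mem _
    · rw [crossAt_of_length_le (by omega), mul_zero, mul_zero]
      exact zero_mem _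

theorem dgX_dgT_mem (i : ℕ) : dgX k b Ns i * dgT k b Ns i -
    dgT k b Ns i * dgX k b Ns (i + 1) ∈ dgC k b Ns := by
  refine mem_of_mul_dgE (S := Subalgebra.toSubmodule (dgC k b Ns)) fun l => ?_
  rw [sub_mul, mul_assoc, mul_assoc, dgT_mul_dgE, dgX_mul_dgE, dgT_mul (dgE_mul_dotAt _ _)]
  by_cases h : i + 1 < l.length
  · obtain ⟨u, c, d, v, rfl, rfl⟩ := exists_split₂ h
    rw [crossAt_eq rfl rfl, dgX_mul (dgE_mul_cross _ _ _ _)]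
    rcases d with _ | n
    · rw [dotAt_black rfl rfl, dotAt_black (u := u ++ [c]) (v := v) (by simp) (by simp)]
      rcases c with _ | n
      · rw [show dgPlain k b Ns (dot u (black :: v)) * dgCross k b Ns u black black v = _ from
          dgPlain_dot_bb u v]
        simpa [dgCross, crossGen, dgE] using dgE_mem (k := k) (b := b) (Ns := Ns)
          (u ++ black :: black :: v)
      · rw [show dgPlain k b Ns (dot u (red n :: v)) * dgCross k b Ns u (red n) black v = _ from
          localHolds_dgPlain (.dot_rb u n v)]
        simp [dgCross, crossGen]
    · rw [dotAt_red rfl rfl, dotAt_red (u := u ++ [c]) (v := v) (n := n) (by simp) (by simp)]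
      simp
  · rw [crossAt_of_length_le (by omega), mul_zero, zero_mul, sub_zero]
    exact zero_mem _

theorem dgX_succ_dgT_mem (i : ℕ) : dgX k b Ns (i + 1) * dgT k b Ns i -
    dgT k b Ns i * dgX k b Ns i ∈ dgC k b Ns := by
  refine mem_of_mul_dgE (S := Subalgebra.toSubmodule (dgC k b Ns)) fun l => ?_
  rw [sub_mul, mul_assoc, mul_assoc, dgT_mul_dgE, dgX_mul_dgE, dgT_mul (dgE_mul_dotAt _ _)]
  by_cases h : i + 1 < l.length
  · obtain ⟨u, c, d, v, rfl, rfl⟩ := exists_split₂ h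
    rw [crossAt_eq rfl rfl, dgX_mul (dgE_mul_cross _ _ _ _)]
    rcases c with _ | n
    · rw [dotAt_black rfl rfl, dotAt_black (u := u ++ [d]) (v := v) (by simp) (by simp)]
      rcases d with _ | n
      · rw [show dgCross k b Ns u black black v * dgPlain k b Ns (dot u (black :: v)) = _ from
          dgPlain_bb_dot u v, sub_add_eq_sub_sub]
        simpa [dgCross, crossGen, dgE] using dgE_mem (k := k) (b := b) (Ns := Ns)
          (u ++ black :: black :: v)
      · rw [show dgCross k b Ns u black (red n) v * dgPlain k b Ns (dot u (red n :: v)) = _ from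
          localHolds_dgPlain (.br_dot u n v)]
        simp [dgCross, crossGen]
    · rw [dotAt_red rfl rfl, dotAt_red (u := u ++ [d]) (v := v) (n := n) (by simp) (by simp)]
      simp
  · rw [crossAt_of_length_le (by omega), mul_zero, zero_mul, sub_zero]
    exact zero_mem _

theorem exists_dgE_dgT (i : ℕ) (l : List Strand) :
    ∃ m, dgE k b Ns l * dgT k b Ns i = dgT k b Ns i * dgE k b Ns m := by
  by_cases h : i + 1 < l.length
  · obtain ⟨u, c, d, v, rfl, rfl⟩ := exists_split₂ h
    refine ⟨u ++ d :: c :: v, eq_of_mul_dgE fun m => ?_⟩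
    rw [mul_assoc, mul_assoc, dgT_mul_dgE]
    by_cases hm : u ++ d :: c :: v = m
    · subst hm
      rw [dgE_mul_self, dgT_mul_dgE, crossAt_eq rfl rfl, dgE_mul_cross]
    · rw [dgE_mul_ne hm, mul_zero]
      by_cases h' : u.length + 1 < m.length
      · obtain ⟨u', c', d', v', rfl, hu⟩ := exists_split₂ h'
        rw [crossAt_eq rfl hu.symm, ← dgE_mul_cross, ← mul_assoc, dgE_mul_ne, zero_mul]
        intro e
        obtain ⟨h₁, h₂⟩ := List.append_inj e hu.symm
        injection h₂ with h₂ h₃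
        injection h₃ with h₃ h₄
        exact hm (by rw [h₁, h₂, h₃, h₄])
      · rw [crossAt_of_length_le (by omega), mul_zero]
  · refine ⟨l, eq_of_mul_dgE fun m => ?_⟩
    rw [dgT_mul_dgE, crossAt_of_length_le (by omega), zero_mul, mul_assoc, dgT_mul_dgE]
    by_cases h' : i + 1 < m.length
    · obtain ⟨u', c', d', v', rfl, rfl⟩ := exists_split₂ h'
      rw [crossAt_eq rfl rfl, ← dgE_mul_cross, ← mul_assoc, dgE_mul_ne, zero_mul]
      rintro rfl
      simp only [List.length_append, List.length_cons] at h
      omega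
    · rw [crossAt_of_length_le (by omega), mul_zero]

variable (k b Ns) in
/-- The relations of the algebra, summed over all sequences of strands. -/
theorem dgCrossingRelations : CrossingRelations k (dgT k b Ns) (dgW k b Ns) (dgG k b Ns) where
  sq := dgT_sq_mem
  braid := dgT_braid_mem
  far := dgT_far
  W_T := dgT_dgW
  W_sq := dgW_sq
  W_anticomm := dgW_anticomm
  G_T := by
    rintro _ (⟨j, rfl⟩ | ⟨l, rfl⟩) i
    · rcases lt_trichotomy j i with h | rfl | h
      · exact ⟨_, Or.inl ⟨j, rfl⟩, by rw [dgX_far_left i j h, sub_self]; exact zero_mem _⟩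
      · exact ⟨_, Or.inl ⟨j + 1, rfl⟩, dgX_dgT_mem j⟩
      · obtain rfl | h := (Nat.succ_le_of_lt h).eq_or_lt
        · exact ⟨_, Or.inl ⟨i, rfl⟩, dgX_succ_dgT_mem i⟩
        · exact ⟨_, Or.inl ⟨j, rfl⟩, by rw [dgX_far_right i j h, sub_self]; exact zero_mem _⟩
    · obtain ⟨m, hm⟩ := exists_dgE_dgT (k := k) (b := b) (Ns := Ns) i l
      exact ⟨_, Or.inr ⟨m, rfl⟩, by rw [hm, sub_self]; exact zero_mem _⟩
  G_W := by
    rintro _ (⟨j, rfl⟩ | ⟨l, rfl⟩)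
    · exact ⟨_, Or.inl ⟨j, rfl⟩, dgW_comm_dgX j⟩
    · exact ⟨_, Or.inr ⟨l, rfl⟩, dgW_comm_dgE l⟩

end

end KLRW

/-! ### Words as diagrams, and columns over polynomial rings -/

namespace KLRW

open Strand Gen DGGen

theorem _root_.Pres.adjoin_range_gen {k : Type*} [CommRing k] {X : Type*}
    (R : FreeAlgebra k X → FreeAlgebra k X → Prop) :
    Algebra.adjoin k (Set.range (Pres.gen R)) = ⊤ := by
  have h : Set.range (Pres.gen R) = Pres.mk R '' Set.range (FreeAlgebra.ι k) := by
    rw [← Set.range_comp]; rfl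
  rw [h, ← AlgHom.map_adjoin, FreeAlgebra.adjoin_range_ι, Algebra.map_top,
    AlgHom.range_eq_top]
  exact Pres.mk_surjective

theorem length_eq_count_add (l : List Strand) :
    l.length = l.count black + (l.filterMap Strand.label?).length := by
  induction l with
  | nil => rfl
  | cons c l ih =>
    rcases c with _ | n
    · simp [ih, List.filterMap_cons, Strand.label?]; omega
    · simp [ih, Strand.label?]; omega

theorem length_of_mem_seqs {b : ℕ} {Ns : List ℕ} {l : List Strand} (h : l ∈ seqs b Ns) :
    l.length = b + Ns.length := by
  obtain ⟨h₁, h₂⟩ := (mem_seqs l b Ns).1 h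
  rw [length_eq_count_add, h₁, h₂]

section Top

/-- The strands on top of the crossing of the positions `i` and `i + 1`, if there is one. -/
def stepT (i : ℕ) (l : List Strand) : Option (List Strand) :=
  match l.drop i with
  | c :: d :: v => (crossGen (l.take i) c d v).map Gen.tgt
  | _ => none

/-- The strands on top of a letter with strands `l` at the bottom, if the letter is a diagram. -/
def Letter.step : Letter → List Strand → Option (List Strand)
  | .T i, l => stepT i l
  | .W, black :: v => some (black :: v)
  | .W, _ => none

/-- The strands on top of a word with strands `l` at the bottom, if the word is a diagram. -/
def top (w : List Letter) (l : List Strand) : Option (List Strand) :=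
  w.foldr (fun a m => m.bind a.step) (some l)

@[simp] theorem top_nil (l : List Strand) : top [] l = some l := rfl

@[simp] theorem top_cons (a : Letter) (w : List Letter) (l : List Strand) :
    top (a :: w) l = (top w l).bind a.step := rfl

theorem top_append (w w' : List Letter) (l : List Strand) :
    top (w ++ w') l = (top w' l).bind (top w) := by
  induction w with
  | nil => exact (Option.bind_fun_some _).symm
  | cons a w ih =>
    rw [List.cons_append, top_cons, ih, Option.bind_assoc]
    rfl

theorem stepT_eq {i : ℕ} {l u : List Strand} {c d : Strand} {v : List Strand}
    (hl : l = u ++ c :: d :: v) (hi : i = u.length) :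
    stepT i l = (crossGen u c d v).map Gen.tgt := by
  subst hl hi; simp [stepT]

theorem exists_of_stepT {i : ℕ} {l m : List Strand} (h : stepT i l = some m) :
    ∃ u c d v g, l = u ++ c :: d :: v ∧ m = u ++ d :: c :: v ∧ u.length = i ∧
      crossGen u c d v = some g := by
  by_cases hi : i + 1 < l.length
  · obtain ⟨u, c, d, v, rfl, rfl⟩ := exists_split₂ hi
    rw [stepT_eq rfl rfl] at h
    obtain ⟨g, hg, rfl⟩ := Option.map_eq_some_iff.1 h
    exact ⟨u, c, d, v, g, rfl, tgt_of_crossGen hg, rfl, hg⟩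
  · rw [stepT] at h
    have hl : (l.drop i).length ≤ 1 := by simp; omega
    generalize l.drop i = m at h hl
    rcases m with _ | ⟨c, _ | ⟨d, v⟩⟩
    · simp at h
    · simp at h
    · simp at hl

theorem stepT_getElem? {i : ℕ} {l m : List Strand} (h : stepT i l = some m) :
    m[i]? = l[i + 1]? ∧ ∀ j, i + 1 < j → m[j]? = l[j]? := by
  obtain ⟨u, c, d, v, g, rfl, rfl, rfl, -⟩ := exists_of_stepT h
  refine ⟨by simp, fun j hj => ?_⟩
  obtain ⟨j, rfl⟩ : ∃ j', j = u.length + (j' + 2) := ⟨j - u.length - 2, by omega⟩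
  simp [List.getElem?_append_right]

theorem top_leftPath_getElem? {p c : ℕ} {l m : List Strand} (h : top (leftPath p c) l = some m) :
    m[p]? = l[p + c]? ∧ ∀ j, p + c < j → m[j]? = l[j]? := by
  induction c generalizing p m with
  | zero =>
    obtain rfl : l = m := by simpa [leftPath] using h
    exact ⟨rfl, fun j _ => rfl⟩
  | succ c ih =>
    rw [leftPath, top_cons] at h
    obtain ⟨m', hm', h⟩ := Option.bind_eq_some_iff.1 h
    obtain ⟨h₁, h₂⟩ := ih hm'
    obtain ⟨h₃, h₄⟩ := stepT_getElem? h
    refine ⟨by rw [h₃, h₁]; congr 1; omega, fun j hj => ?_⟩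
    rw [h₄ j (by omega), h₂ j (by omega)]

theorem top_rightPath_getElem? {p : ℕ} {l m : List Strand} (h : top (rightPath p) l = some m)
    {j : ℕ} (hj : p < j) : m[j]? = l[j]? := by
  induction p generalizing m with
  | zero =>
    obtain rfl : l = m := by simpa [rightPath] using h
    rfl
  | succ c ih =>
    rw [rightPath, top_cons] at h
    obtain ⟨m', hm', h⟩ := Option.bind_eq_some_iff.1 h
    rw [(stepT_getElem? h).2 j hj, ih hm' (by omega)]

theorem step_W {l m : List Strand} (h : Letter.W.step l = some m) :
    m = l ∧ l[0]? = some black := by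
  rcases l with _ | ⟨_ | n, v⟩
  · simp [Letter.step] at h
  · simp only [Letter.step, Option.some.injEq] at h
    exact ⟨h.symm, rfl⟩
  · simp [Letter.step] at h

theorem top_path_getElem? {n p : ℕ} (hp : p ≤ n) {t : Bool} {l m : List Strand}
    (h : top (path n p t) l = some m) :
    (t = true → l[n]? = some black) ∧ ∀ j, n < j → m[j]? = l[j]? := by
  rcases t with _ | _
  · refine ⟨by simp, fun j hj => (top_leftPath_getElem? h).2 j (by omega)⟩
  · rw [path, top_append, top_cons] at h
    obtain ⟨m₁, h₁, h⟩ := Option.bind_eq_some_iff.1 h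
    obtain ⟨m₂, h₂, h₁⟩ := Option.bind_eq_some_iff.1 h₁
    obtain ⟨rfl, h₃⟩ := step_W h₁
    obtain ⟨h₄, h₅⟩ := top_leftPath_getElem? h₂
    rw [h₄] at h₃
    refine ⟨fun _ => by simpa using h₃, fun j hj => ?_⟩
    rw [top_rightPath_getElem? h (by omega), h₅ j (by omega)]

theorem top_word_getElem? {n : ℕ} (c : Code n) {l m : List Strand} (h : top c.word l = some m)
    {j : ℕ} (hj : n ≤ j) : m[j]? = l[j]? := by
  induction n generalizing m with
  | zero =>
    obtain rfl : l = m := by simpa [Code.word] using h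
    rfl
  | succ n ih =>
    rw [Code.word, top_append] at h
    obtain ⟨m₁, h₁, h⟩ := Option.bind_eq_some_iff.1 h
    rw [(top_path_getElem? (by have := c.1.1.2; omega) h).2 j (by omega), ih _ h₁ (by omega)]

theorem nails_append (w w' : List Letter) : nails (w ++ w') = nails w + nails w' := by
  simp [nails]

theorem nails_leftPath (p c : ℕ) : nails (leftPath p c) = 0 := by
  induction c generalizing p with
  | zero => rfl
  | succ c ih => simpa [nails, leftPath, Letter.nails] using ih (p + 1)

theorem nails_rightPath (p : ℕ) : nails (rightPath p) = 0 := by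
  induction p with
  | zero => rfl
  | succ c ih => simpa [nails, rightPath, Letter.nails] using ih

theorem nails_path (n p : ℕ) (t : Bool) : nails (path n p t) = if t then 1 else 0 := by
  cases t with
  | false => simp [path, nails_leftPath]
  | true =>
    have h := nails_leftPath 0 n
    have h' := nails_rightPath p
    simp only [nails] at h h'
    simp [path, nails, Letter.nails, h, h']

/-- Only black strands are nailed in a basis word that is a diagram, and each at most once. -/
theorem nails_le {n : ℕ} (c : Code n) {l m : List Strand} (h : top c.word l = some m) :
    nails c.word ≤ ((Finset.range n).filter fun i => l[i]? = some black).card := by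
  induction n generalizing m with
  | zero => simp [Code.word, nails]
  | succ n ih =>
    rw [Code.word, top_append] at h
    obtain ⟨m₁, h₁, h⟩ := Option.bind_eq_some_iff.1 h
    have h₂ := (top_path_getElem? (by have := c.1.1.2; omega) h).1
    rw [top_word_getElem? _ h₁ le_rfl] at h₂
    have h₃ := ih _ h₁
    rw [Code.word, nails_append, nails_path, Finset.range_add_one, Finset.filter_insert]
    split_ifs with h₄ h₅ h₆
    · rw [Finset.card_insert_of_notMem (by simp)]; omega
    · exact absurd (h₂ h₄) h₅
    · rw [Finset.card_insert_of_notMem (by simp)]; omega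
    · omega

end Top

section

variable {k : Type*} [CommRing k] {b : ℕ} {Ns : List ℕ}

theorem dgT_eq_zero {j : ℕ} (h : b + Ns.length ≤ j + 1) : dgT k b Ns j = 0 :=
  Finset.sum_eq_zero fun l hl => crossAt_of_length_le (by rw [length_of_mem_seqs hl]; exact h)

theorem dgW_eq_zero (h : b + Ns.length = 0) : dgW k b Ns = 0 :=
  Finset.sum_eq_zero fun l hl => by
    have := length_of_mem_seqs hl
    rw [h, List.length_eq_zero_iff] at this
    rw [this, nailAt]
    simp

/-- The sums of crossings, nails and dots generate the algebra together with the idempotents, which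
select the summands. -/
theorem adjoin_dg_eq_top : Algebra.adjoin k
    (Set.range (dgT k b Ns) ∪ {dgW k b Ns} ∪ dgG k b Ns) = ⊤ := by
  set S := Algebra.adjoin k (Set.range (dgT k b Ns) ∪ {dgW k b Ns} ∪ dgG k b Ns)
  have hT : ∀ i, dgT k b Ns i ∈ S := fun i => Algebra.subset_adjoin (Or.inl (Or.inl ⟨i, rfl⟩))
  have hW : dgW k b Ns ∈ S := Algebra.subset_adjoin (Or.inl (Or.inr rfl))
  have hX : ∀ i, dgX k b Ns i ∈ S := fun i => Algebra.subset_adjoin (Or.inr (Or.inl ⟨i, rfl⟩))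
  have hE : ∀ l, dgE k b Ns l ∈ S := fun i => Algebra.subset_adjoin (Or.inr (Or.inr ⟨i, rfl⟩))
  have hC : ∀ u c d v, dgCross k b Ns u c d v ∈ S := fun u c d v => by
    have h := mul_mem (hT u.length) (hE (u ++ c :: d :: v))
    rwa [dgT_mul_dgE, crossAt_eq rfl rfl] at h
  rw [eq_top_iff, ← Pres.adjoin_range_gen, Algebra.adjoin_le_iff]
  rintro _ ⟨g | v, rfl⟩
  · rcases g with l | ⟨u, v⟩ | ⟨u, v⟩ | ⟨u, n, v⟩ | ⟨u, n, v⟩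
    · exact hE l
    · have h := mul_mem (hX u.length) (hE (u ++ black :: v))
      rwa [dgX_mul_dgE, dotAt_black rfl rfl] at h
    · exact hC u black black v
    · exact hC u black (red n) v
    · exact hC u (red n) black v
  · have h := mul_mem hW (hE (black :: v))
    rwa [dgW_mul_dgE] at h

theorem stepT_dg {i : ℕ} {l : List Strand} :
    (stepT i l = none → crossAt k b Ns i l = 0) ∧
      ∀ m, stepT i l = some m → dgE k b Ns m * crossAt k b Ns i l = crossAt k b Ns i l := by
  by_cases hi : i + 1 < l.length
  · obtain ⟨u, c, d, v, rfl, rfl⟩ := exists_split₂ hi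
    rw [stepT_eq rfl rfl, crossAt_eq rfl rfl]
    refine ⟨fun h => ?_, fun m h => ?_⟩
    · rw [dgCross, Option.map_eq_none_iff.1 h]; rfl
    · obtain ⟨g, hg, rfl⟩ := Option.map_eq_some_iff.1 h
      rw [tgt_of_crossGen hg, dgE_mul_cross]
  · rw [crossAt_of_length_le (by omega)]
    simp

/-- A word over the idempotent of `l` is zero if it is not a diagram, and otherwise has the strands
`top w l` on top. -/
theorem top_dg (w : List Letter) (l : List Strand) :
    (top w l = none → eval (dgT k b Ns) (dgW k b Ns) w * dgE k b Ns l = 0) ∧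
      ∀ m, top w l = some m → dgE k b Ns m * (eval (dgT k b Ns) (dgW k b Ns) w * dgE k b Ns l) =
        eval (dgT k b Ns) (dgW k b Ns) w * dgE k b Ns l := by
  induction w with
  | nil => simp [dgE_mul_self]
  | cons a w ih =>
    obtain ⟨ih₁, ih₂⟩ := ih
    rw [top_cons]
    rcases h : top w l with _ | m'
    · rcases a with i | _ <;> simp [mul_assoc, ih₁ h]
    have ih₂ := ih₂ m' h
    rw [Option.bind_some]
    rcases a with i | _
    · rw [eval_T_cons, mul_assoc, dgT_mul ih₂]
      refine ⟨fun hs => ?_, fun m hm => ?_⟩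
      · rw [stepT_dg.1 hs, zero_mul]
      · rw [← mul_assoc, stepT_dg.2 m hm]
    · rw [eval_W_cons, mul_assoc, dgW_mul ih₂]
      rcases m' with _ | ⟨_ | n, v⟩
      · simp [Letter.step, nailAt]
      · refine ⟨by simp [Letter.step], fun m hm => ?_⟩
        obtain rfl : black :: v = m := by simpa [Letter.step] using hm
        rw [← mul_assoc, dgE_mul_nailAt]
      · simp [Letter.step, nailAt]

theorem dgC_comm {x y : DGAlg k b Ns} (hx : x ∈ dgC k b Ns) (hy : y ∈ dgC k b Ns) :
    x * y = y * x := by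
  have h : ∀ x ∈ dgG k b Ns, ∀ y ∈ dgG k b Ns, x * y = y * x := by
    rintro _ (⟨i, rfl⟩ | ⟨l, rfl⟩) _ (⟨j, rfl⟩ | ⟨m, rfl⟩)
    · exact dgX_comm i j
    · exact dgX_comm_dgE i m
    · exact (dgX_comm_dgE j l).symm
    · exact dgE_comm l m
  exact congrArg Subtype.val
    ((Algebra.isMulCommutative_adjoin k h).is_comm.comm (⟨x, hx⟩ : dgC k b Ns) ⟨y, hy⟩)

/-- The positions of the black strands. -/
abbrev BlackPos (l : List Strand) : Type := {i : ℕ // l[i]? = some black}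

instance (l : List Strand) : Finite (BlackPos l) :=
  Set.Finite.to_subtype ((Set.finite_lt_nat l.length).subset fun i hi => by
    obtain ⟨h, -⟩ := List.getElem?_eq_some_iff.1 hi
    exact h)

instance : CommRing (dgC k b Ns) :=
  { (inferInstance : Ring (dgC k b Ns)) with
    mul_comm := fun x y => Subtype.ext (dgC_comm x.2 y.2) }

variable (k b Ns) in
/-- The polynomials in the dots on the black strands of `l`. -/
def dgPoly (l : List Strand) : MvPolynomial (BlackPos l) k →ₐ[k] DGAlg k b Ns :=
  (dgC k b Ns).val.comp (MvPolynomial.aeval fun i => (⟨dgX k b Ns i, dgX_mem i⟩ : dgC k b Ns))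

theorem dgPoly_X (l : List Strand) (i : BlackPos l) :
    dgPoly k b Ns l (MvPolynomial.X i) = dgX k b Ns i := by
  simp [dgPoly]

theorem dgPoly_mem (l : List Strand) (p : MvPolynomial (BlackPos l) k) :
    dgPoly k b Ns l p ∈ dgC k b Ns :=
  ((MvPolynomial.aeval fun i : BlackPos l => (⟨dgX k b Ns i, dgX_mem i⟩ : dgC k b Ns)) p).2

/-- On the idempotent of `l`, the dots and idempotents are polynomials in the dots on the black
strands of `l`. -/
theorem exists_dgPoly (l : List Strand) {g : DGAlg k b Ns} (hg : g ∈ dgC k b Ns) :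
    ∃ p, g * dgE k b Ns l = dgE k b Ns l * dgPoly k b Ns l p := by
  induction hg using Algebra.adjoin_induction with
  | mem x hx =>
    rcases hx with ⟨i, rfl⟩ | ⟨m, rfl⟩
    · by_cases hi : l[i]? = some black
      · exact ⟨MvPolynomial.X ⟨i, hi⟩, by rw [dgPoly_X, dgX_comm_dgE]⟩
      · refine ⟨0, ?_⟩
        rw [dgX_mul_dgE, map_zero, mul_zero]
        by_cases h : i < l.length
        · obtain ⟨u, _ | n, v, rfl, rfl⟩ := exists_split h
          · simp at hi
          · rw [dotAt_red rfl rfl]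
        · rw [dotAt_of_length_le (by omega)]
    · by_cases h : m = l
      · exact ⟨1, by rw [h, dgE_mul_self, map_one, mul_one]⟩
      · exact ⟨0, by rw [dgE_mul_ne h, map_zero, mul_zero]⟩
  | algebraMap r =>
    exact ⟨algebraMap _ _ r, by rw [AlgHom.commutes, Algebra.commutes]⟩
  | add x y _ _ hx hy =>
    obtain ⟨p, hp⟩ := hx
    obtain ⟨q, hq⟩ := hy
    exact ⟨p + q, by rw [add_mul, hp, hq, map_add, mul_add]⟩
  | mul x y _ _ hx hy =>
    obtain ⟨p, hp⟩ := hx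
    obtain ⟨q, hq⟩ := hy
    exact ⟨p * q, by rw [mul_assoc, hq, ← mul_assoc, hp, mul_assoc, ← map_mul]⟩

/-- The algebra as a module over the polynomials in the dots on the black strands of `l`, which
act from the right.  The column of `l` consists of the multiples of the idempotent of `l`.  This is
a type synonym, as the algebra does not carry this module structure for a single `l`. -/
def Column (k : Type*) [CommRing k] (b : ℕ) (Ns : List ℕ) (_ : List Strand) : Type _ :=
  DGAlg k b Ns

instance (l : List Strand) : AddCommGroup (Column k b Ns l) :=
  inferInstanceAs (AddCommGroup (DGAlg k b Ns))

/-- An element of the algebra, considered in the right module. -/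
def toColumn (l : List Strand) : DGAlg k b Ns ≃+ Column k b Ns l := AddEquiv.refl _

instance (l : List Strand) : Module (MvPolynomial (BlackPos l) k) (Column k b Ns l) where
  smul p x := toColumn l ((toColumn l).symm x * dgPoly k b Ns l p)
  one_smul x := show toColumn l ((toColumn l).symm x * dgPoly k b Ns l 1) = x by
    rw [map_one, mul_one, AddEquiv.apply_symm_apply]
  mul_smul p q x := show toColumn l ((toColumn l).symm x * dgPoly k b Ns l (p * q)) =
      toColumn l ((toColumn l).symm (toColumn l ((toColumn l).symm x * dgPoly k b Ns l q)) *
        dgPoly k b Ns l p) by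
    rw [AddEquiv.symm_apply_apply, mul_comm p q, map_mul (dgPoly k b Ns l), mul_assoc]
  smul_zero p := show toColumn l ((toColumn l).symm 0 * dgPoly k b Ns l p) = 0 by
    rw [map_zero, zero_mul, map_zero]
  zero_smul x := show toColumn l ((toColumn l).symm x * dgPoly k b Ns l 0) = 0 by
    rw [map_zero, mul_zero, map_zero]
  smul_add p x y := show toColumn l ((toColumn l).symm (x + y) * dgPoly k b Ns l p) =
      toColumn l ((toColumn l).symm x * dgPoly k b Ns l p) +
        toColumn l ((toColumn l).symm y * dgPoly k b Ns l p) by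
    rw [map_add, add_mul, map_add]
  add_smul p q x := show toColumn l ((toColumn l).symm x * dgPoly k b Ns l (p + q)) =
      toColumn l ((toColumn l).symm x * dgPoly k b Ns l p) +
        toColumn l ((toColumn l).symm x * dgPoly k b Ns l q) by
    rw [map_add, mul_add, map_add]

theorem smul_toColumn (l : List Strand) (p : MvPolynomial (BlackPos l) k) (a : DGAlg k b Ns) :
    p • toColumn l a = toColumn l (a * dgPoly k b Ns l p) := rfl

/-- The codes of the words that are diagrams with strands `l` at the bottom. -/
abbrev LegalCode (b : ℕ) (Ns : List ℕ) (l : List Strand) : Type :=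
  {c : Code (b + Ns.length) // top c.word l ≠ none}

/-- The basis element of a word. -/
def wordVec (k : Type*) [CommRing k] {b : ℕ} {Ns : List ℕ} (l : List Strand)
    (c : LegalCode b Ns l) : Column k b Ns l :=
  toColumn l (eval (dgT k b Ns) (dgW k b Ns) c.1.word * dgE k b Ns l)

/-- The words that are diagrams span the column of `l` over the polynomials in the dots. -/
theorem mul_dgE_mem_span (l : List Strand) (a : DGAlg k b Ns) :
    toColumn l (a * dgE k b Ns l) ∈ Submodule.span (MvPolynomial (BlackPos l) k)
      (Set.range (wordVec k (b := b) (Ns := Ns) l)) := by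
  have h := (dgCrossingRelations k b Ns).mem_span (n := b + Ns.length) (fun j => dgT_eq_zero)
    dgW_eq_zero adjoin_dg_eq_top a
  induction h using Submodule.span_induction with
  | mem x hx =>
    obtain ⟨c, g, hg, rfl⟩ := hx
    obtain ⟨p, hp⟩ := exists_dgPoly l hg
    rw [mul_assoc, hp, ← mul_assoc]
    by_cases hc : top c.word l = none
    · rw [(top_dg c.word l).1 hc, zero_mul, map_zero]
      exact zero_mem _
    · rw [← smul_toColumn]
      exact Submodule.smul_mem _ p (Submodule.subset_span ⟨⟨c, hc⟩, rfl⟩)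
  | zero => rw [zero_mul, map_zero]; exact zero_mem _
  | add x y _ _ hx hy => rw [add_mul, map_add]; exact add_mem hx hy
  | smul r x _ hx =>
    have e : r • x * dgE k b Ns l = x * dgE k b Ns l * dgPoly k b Ns l (algebraMap k _ r) := by
      rw [AlgHom.commutes, ← Algebra.commutes, ← Algebra.smul_def, smul_mul_assoc]
    rw [e, ← smul_toColumn]
    exact Submodule.smul_mem _ _ hx

end

end KLRW

/-! ### The polynomial representation: operators -/

namespace KLRW

open Strand Gen DGGen

section Representation

variable {K : Type*} [CommRing K] (x : ℕ → K) (col : ℕ → Strand) (n : ℕ)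

/-- The strands at the positions below `n`, if the strand `i` is `col i` and the strands are
arranged by `θ`. -/
def seqOf (θ : Equiv.Perm ℕ) : List Strand := (List.range n).map fun i => col (θ i)

variable {col n}

theorem seqOf_getElem? (θ : Equiv.Perm ℕ) (i : ℕ) :
    (seqOf col n θ)[i]? = if i < n then some (col (θ i)) else none := by
  rw [seqOf, List.getElem?_map]
  split_ifs with h
  · rw [List.getElem?_range h]; rfl
  · rw [List.getElem?_eq_none (by simpa using h)]; rfl

theorem col_of_seqOf {θ : Equiv.Perm ℕ} {u : List Strand} {c : Strand} {v : List Strand}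
    (h : seqOf col n θ = u ++ c :: v) : col (θ u.length) = c := by
  have h₁ := seqOf_getElem? (col := col) (n := n) θ u.length
  rw [h] at h₁
  split_ifs at h₁
  · simpa using h₁.symm
  · simp at h₁

theorem seqOf_swap {θ : Equiv.Perm ℕ} {u : List Strand} {c d : Strand} {v : List Strand}
    (h : seqOf col n θ = u ++ c :: d :: v) :
    seqOf col n (θ * Equiv.swap u.length (u.length + 1)) = u ++ d :: c :: v := by
  have hn : n = u.length + (v.length + 2) := by
    have := congrArg List.length h
    simpa [seqOf] using this
  have hc := col_of_seqOf h
  have hd : col (θ (u.length + 1)) = d := by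
    simpa using col_of_seqOf (u := u ++ [c]) (by simpa using h)
  refine List.ext_getElem? fun j => ?_
  have hj := congrArg (·[j]?) h
  simp only [seqOf_getElem?] at hj ⊢
  rw [Equiv.Perm.mul_apply]
  rcases lt_trichotomy j u.length with hj' | rfl | hj'
  · rw [Equiv.swap_apply_of_ne_of_ne (by omega) (by omega), hj, List.getElem?_append_left hj',
      List.getElem?_append_left hj']
  · rw [Equiv.swap_apply_left, if_pos (by omega), hd]
    simp
  · obtain rfl | ⟨j, rfl⟩ : j = u.length + 1 ∨ ∃ j', j = u.length + (j' + 2) := by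
      by_cases e : j = u.length + 1
      · exact Or.inl e
      · exact Or.inr ⟨j - u.length - 2, by omega⟩
    · rw [Equiv.swap_apply_right, if_pos (by omega), hc]
      simp
    · rw [Equiv.swap_apply_of_ne_of_ne (by omega) (by omega), hj]
      simp [List.getElem?_append_right]

theorem seqOf_swap_succ {θ : Equiv.Perm ℕ} {u : List Strand} {a c d : Strand} {v : List Strand}
    (h : seqOf col n θ = u ++ a :: c :: d :: v) :
    seqOf col n (θ * Equiv.swap (u.length + 1) (u.length + 2)) = u ++ a :: d :: c :: v := by
  have := seqOf_swap (u := u ++ [a]) (c := c) (d := d) (v := v) (by simpa using h)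
  simpa using this

/-- The inverse of `x i - x j`; the elements `x i` stand for the dots on the strands, and their
differences will be units for distinct strands. -/
def invDiff (i j : ℕ) : K := Ring.inverse (x i - x j)

/-- The coefficient of the identity permutation in the operator of a diagram.  A crossing of two
black strands acts as a divided difference operator, and a crossing of a black strand and a red
strand labeled `m` as an exchange of the strands, times the power `m` of the variable in one of the
two directions. -/
def coefId : Gen → Equiv.Perm ℕ → K
  | idem _, _ => 1
  | dot u _, θ => x (θ u.length)
  | bb u _, θ => invDiff x (θ u.length) (θ (u.length + 1))
  | br _ _ _, _ => 0
  | rb _ _ _, _ => 0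

/-- The coefficient of the transposition in the operator of a diagram. -/
def coefSwap : Gen → Equiv.Perm ℕ → K
  | idem _, _ => 0
  | dot _ _, _ => 0
  | bb u _, θ => -invDiff x (θ u.length) (θ (u.length + 1))
  | br _ _ _, _ => 1
  | rb u m _, θ => x (θ u.length) ^ m

/-- The transposition in the operator of a diagram. -/
def genSwap : Gen → Equiv.Perm ℕ
  | idem _ => 1
  | dot _ _ => 1
  | bb u _ => Equiv.swap u.length (u.length + 1)
  | br u _ _ => Equiv.swap u.length (u.length + 1)
  | rb u _ _ => Equiv.swap u.length (u.length + 1)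

theorem seqOf_genSwap {θ : Equiv.Perm ℕ} {g : Gen} (h : seqOf col n θ = g.tgt) :
    seqOf col n (θ * genSwap g) = g.src := by
  rcases g with l | ⟨u, v⟩ | ⟨u, v⟩ | ⟨u, n, v⟩ | ⟨u, n, v⟩
  · exact h
  · exact h
  · exact seqOf_swap h
  · exact seqOf_swap h
  · exact seqOf_swap h

variable (col n)

open Classical in
/-- The operator of a diagram without nails on the functions on the permutations. -/
def rawOp (g : Gen) : Module.End K (FunSpace K) where
  toFun φ θ := if seqOf col n θ = g.tgt then
    coefId x g θ • φ θ + coefSwap x g θ • φ (θ * genSwap g) else 0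
  map_add' φ ψ := by
    ext θ
    simp only [Pi.add_apply, smul_add]
    split_ifs
    · abel
    · rw [add_zero]
  map_smul' c φ := by
    ext θ
    simp only [Pi.smul_apply, RingHom.id_apply]
    split_ifs
    · rw [smul_add, smul_comm c, smul_comm c]
    · rw [smul_zero]

variable (K) in
open Classical in
/-- The operator of a nail on the functions on the permutations. -/
def rawNail (v : List Strand) : Module.End K (FunSpace K) where
  toFun φ θ := if seqOf col n θ = black :: v then xi (θ 0) * φ θ else 0
  map_add' φ ψ := by
    ext θ
    simp only [Pi.add_apply, mul_add]
    split_ifs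
    · rfl
    · rw [add_zero]
  map_smul' c φ := by
    ext θ
    simp only [Pi.smul_apply, RingHom.id_apply]
    split_ifs
    · rw [mul_smul_comm]
    · rw [smul_zero]

variable (K) in
/-- The functions supported on the arrangements with `b` black strands and red strands labeled
`Ns`.  They form an invariant subspace, on which the idempotents sum to the identity. -/
def good (b : ℕ) (Ns : List ℕ) : Submodule K (FunSpace K) where
  carrier := {φ | ∀ θ, seqOf col n θ ∉ seqs b Ns → φ θ = 0}
  add_mem' hφ hψ θ h := by simp [hφ θ h, hψ θ h]
  zero_mem' θ _ := rfl
  smul_mem' c φ hφ θ h := by simp [hφ θ h]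

variable {col n}

theorem isSeq_tgt_iff {b : ℕ} {Ns : List ℕ} (g : Gen) : IsSeq b Ns g.tgt ↔ IsSeq b Ns g.src := by
  rcases g with l | ⟨u, v⟩ | ⟨u, v⟩ | ⟨u, n, v⟩ | ⟨u, n, v⟩ <;>
    simp [IsSeq, tgt, src, Strand.label?, List.filterMap_cons]

theorem rawOp_mem {b : ℕ} {Ns : List ℕ} (g : Gen) {φ : FunSpace K} (hφ : φ ∈ good K col n b Ns) :
    rawOp x col n g φ ∈ good K col n b Ns := by
  intro θ hθ
  change (if _ then _ else _) = _
  split_ifs with h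
  · rw [hφ θ hθ, hφ (θ * genSwap g), smul_zero, smul_zero, add_zero]
    rw [seqOf_genSwap h, mem_seqs, ← isSeq_tgt_iff, ← h, ← mem_seqs]
    exact hθ
  · rfl

theorem rawNail_mem {b : ℕ} {Ns : List ℕ} (v : List Strand) {φ : FunSpace K}
    (hφ : φ ∈ good K col n b Ns) : rawNail K col n v φ ∈ good K col n b Ns := by
  intro θ hθ
  change (if _ then _ else _) = _
  split_ifs with h
  · rw [hφ θ hθ, mul_zero]
  · rfl

variable (col n) in
/-- The operators of the elementary diagrams. -/
def repGen (b : ℕ) (Ns : List ℕ) : DGGen → Module.End K (good K col n b Ns)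
  | plain g => (rawOp x col n g).restrict fun _ => rawOp_mem x g
  | nail v => (rawNail K col n v).restrict fun _ => rawNail_mem v

variable {x} {b : ℕ} {Ns : List ℕ} (φ : good K col n b Ns) (θ : Equiv.Perm ℕ)

open Classical in
theorem repGen_plain (g : Gen) : (repGen x col n b Ns (plain g) φ).1 θ =
    if seqOf col n θ = g.tgt then
      coefId x g θ • φ.1 θ + coefSwap x g θ • φ.1 (θ * genSwap g) else 0 := rfl

theorem repGen_of_eq {g : Gen} (h : seqOf col n θ = g.tgt) :
    (repGen x col n b Ns (plain g) φ).1 θ =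
      coefId x g θ • φ.1 θ + coefSwap x g θ • φ.1 (θ * genSwap g) := if_pos h

theorem repGen_of_ne {g : Gen} (h : seqOf col n θ ≠ g.tgt) :
    (repGen x col n b Ns (plain g) φ).1 θ = 0 := if_neg h

open Classical in
theorem repGen_dots (u : List Strand) (m : ℕ) (v : List Strand) :
    ((dots (fun g => repGen x col n b Ns (plain g)) u m v) φ).1 θ =
      if seqOf col n θ = u ++ black :: v then x (θ u.length) ^ m • φ.1 θ else 0 := by
  rw [dots, Module.End.mul_apply, repGen_plain]
  simp only [coefId, coefSwap, one_smul, zero_smul, add_zero, tgt]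
  split_ifs with h
  · induction m with
    | zero => simp
    | succ m ih =>
      rw [pow_succ', Module.End.mul_apply, repGen_of_eq _ _ (g := dot u v) h]
      simp only [coefId, coefSwap, zero_smul, add_zero, ih, smul_smul, pow_succ']
  · rfl

section

variable (φ : good K col n b Ns) {θ : Equiv.Perm ℕ} {l : List Strand} (h : seqOf col n θ = l)
include h

theorem repGen_idem : (repGen x col n b Ns (plain (idem l)) φ).1 θ = φ.1 θ := by
  rw [repGen_of_eq _ _ (g := idem l) h]; simp [coefId, coefSwap]

theorem repGen_dot {u v : List Strand} {i : ℕ} (e : l = u ++ black :: v) (hi : u.length = i) :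
    (repGen x col n b Ns (plain (dot u v)) φ).1 θ = x (θ i) • φ.1 θ := by
  subst hi
  rw [repGen_of_eq _ _ (g := dot u v) (h.trans e)]
  simp [coefId, coefSwap]

theorem repGen_bb {u v : List Strand} {i j : ℕ} (e : l = u ++ black :: black :: v)
    (hi : u.length = i) (hj : u.length + 1 = j) :
    (repGen x col n b Ns (plain (bb u v)) φ).1 θ =
      invDiff x (θ i) (θ j) • (φ.1 θ - φ.1 (θ * Equiv.swap i j)) := by
  subst hi hj
  rw [repGen_of_eq _ _ (g := bb u v) (h.trans e)]
  simp [coefId, coefSwap, genSwap, sub_eq_add_neg]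

theorem repGen_br {u v : List Strand} {m i j : ℕ} (e : l = u ++ red m :: black :: v)
    (hi : u.length = i) (hj : u.length + 1 = j) :
    (repGen x col n b Ns (plain (br u m v)) φ).1 θ = φ.1 (θ * Equiv.swap i j) := by
  subst hi hj
  rw [repGen_of_eq _ _ (g := br u m v) (h.trans e)]
  simp [coefId, coefSwap, genSwap]

theorem repGen_rb {u v : List Strand} {m i j : ℕ} (e : l = u ++ black :: red m :: v)
    (hi : u.length = i) (hj : u.length + 1 = j) :
    (repGen x col n b Ns (plain (rb u m v)) φ).1 θ = x (θ i) ^ m • φ.1 (θ * Equiv.swap i j) := by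
  subst hi hj
  rw [repGen_of_eq _ _ (g := rb u m v) (h.trans e)]
  simp [coefId, coefSwap, genSwap]

end

section Coefficients

variable {x : ℕ → K} (hx : ∀ i j, i ≠ j → IsUnit (x i - x j))
include hx

theorem invDiff_mul {i j : ℕ} (h : i ≠ j) : invDiff x i j * (x i - x j) = 1 :=
  Ring.inverse_mul_cancel _ (hx i j h)

theorem invDiff_swap {i j : ℕ} (h : i ≠ j) : invDiff x j i = -invDiff x i j := by
  have h₁ := invDiff_mul hx h
  have h₂ := invDiff_mul hx h.symm
  linear_combination -(invDiff x i j) * h₂ - (invDiff x j i) * h₁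

theorem invDiff_mul_invDiff {i j l : ℕ} (hij : i ≠ j) (hil : i ≠ l) (hjl : j ≠ l) :
    invDiff x i j * invDiff x j l = invDiff x i l * (invDiff x i j + invDiff x j l) := by
  have h₁ := invDiff_mul hx hij
  have h₂ := invDiff_mul hx hil
  have h₃ := invDiff_mul hx hjl
  linear_combination -(invDiff x i j * invDiff x j l) * h₂ +
    (invDiff x i l * invDiff x j l) * h₁ + (invDiff x i l * invDiff x i j) * h₃

end Coefficients

theorem swap_braid (i : ℕ) : Equiv.swap i (i + 1) * Equiv.swap (i + 1) (i + 2) *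
    Equiv.swap i (i + 1) = Equiv.swap (i + 1) (i + 2) * Equiv.swap i (i + 1) *
      Equiv.swap (i + 1) (i + 2) := by
  ext j
  simp only [Equiv.Perm.mul_apply, Equiv.swap_apply_def]
  split_ifs <;> omega

theorem swap_sq (i j : ℕ) : θ * Equiv.swap i j * Equiv.swap i j = θ := by
  rw [mul_assoc, Equiv.swap_mul_self, mul_one]

end Representation

end KLRW

/-! ### The polynomial representation: local relations -/

namespace KLRW

open Strand Gen DGGen

section Relations

variable {K : Type*} [CommRing K] {x : ℕ → K} {col : ℕ → Strand} {n b : ℕ} {Ns : List ℕ}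

theorem genSwap_addRight (g : Gen) (w : List Strand) : genSwap (g.addRight w) = genSwap g := by
  cases g <;> rfl

theorem tgt_addRight (g : Gen) (w : List Strand) : (g.addRight w).tgt = g.tgt ++ w := by
  cases g <;> simp [addRight, tgt]

theorem tgt_addLeft (g : Gen) (w : List Strand) : (g.addLeft w).tgt = w ++ g.tgt := by
  cases g <;> simp [addLeft, tgt]

theorem src_addRight (g : Gen) (w : List Strand) : (g.addRight w).src = g.src ++ w := by
  cases g <;> simp [addRight, src]

theorem src_addLeft (g : Gen) (w : List Strand) : (g.addLeft w).src = w ++ g.src := by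
  cases g <;> simp [addLeft, src]

theorem length_tgt (g : Gen) : g.tgt.length = g.src.length := by
  cases g <;> simp [src, tgt]

theorem coefId_eq_zero_or (g : Gen) (θ : Equiv.Perm ℕ) : coefId x g θ = 0 ∨ g.src = g.tgt := by
  cases g <;> simp [coefId, src, tgt]

theorem coefId_addRight (g : Gen) (w : List Strand) (θ : Equiv.Perm ℕ) :
    coefId x (g.addRight w) θ = coefId x g θ := by
  cases g <;> rfl

theorem coefSwap_addRight (g : Gen) (w : List Strand) (θ : Equiv.Perm ℕ) :
    coefSwap x (g.addRight w) θ = coefSwap x g θ := by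
  cases g <;> rfl

/-- The coefficients of a diagram depend only on the strands that take part in it. -/
theorem coef_congr {g : Gen} {θ θ' : Equiv.Perm ℕ} (h : ∀ i < g.src.length, θ i = θ' i) :
    coefId x g θ = coefId x g θ' ∧ coefSwap x g θ = coefSwap x g θ' := by
  rcases g with l | ⟨u, v⟩ | ⟨u, v⟩ | ⟨u, n, v⟩ | ⟨u, n, v⟩
  · simp [coefId, coefSwap]
  · simp [coefId, coefSwap, h u.length (by simp [src])]
  · simp [coefId, coefSwap, h u.length (by simp [src]), h (u.length + 1) (by simp [src])]
  · simp [coefId, coefSwap]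
  · simp [coefId, coefSwap, h u.length (by simp [src])]

theorem coef_addLeft_congr {g : Gen} {w : List Strand} {θ θ' : Equiv.Perm ℕ}
    (h : ∀ i, w.length ≤ i → θ i = θ' i) : coefId x (g.addLeft w) θ = coefId x (g.addLeft w) θ' ∧
      coefSwap x (g.addLeft w) θ = coefSwap x (g.addLeft w) θ' := by
  have h' : ∀ i, θ (w.length + i) = θ' (w.length + i) := fun i => h _ (by omega)
  cases g <;> simp [coefId, coefSwap, addLeft, h', add_assoc]

theorem coef_addLeft_length {g : Gen} {w w' : List Strand} {θ : Equiv.Perm ℕ}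
    (h : w.length = w'.length) : coefId x (g.addLeft w) θ = coefId x (g.addLeft w') θ ∧
      coefSwap x (g.addLeft w) θ = coefSwap x (g.addLeft w') θ ∧
      genSwap (g.addLeft w) = genSwap (g.addLeft w') := by
  cases g <;> simp [coefId, coefSwap, genSwap, addLeft, h]

theorem genSwap_apply {g : Gen} {i : ℕ} (h : g.src.length ≤ i) : genSwap g i = i := by
  cases g <;> simp only [genSwap, src, List.length_append, List.length_cons] at h ⊢
  · rfl
  · rfl
  all_goals exact Equiv.swap_apply_of_ne_of_ne (by omega) (by omega)

theorem genSwap_addLeft_apply {g : Gen} {w : List Strand} {i : ℕ} (h : i < w.length) :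
    genSwap (g.addLeft w) i = i := by
  cases g <;> simp only [genSwap, addLeft, List.length_append]
  · rfl
  · rfl
  all_goals exact Equiv.swap_apply_of_ne_of_ne (by omega) (by omega)

theorem genSwap_apply_lt {g : Gen} {i : ℕ} (h : i < g.src.length) :
    genSwap g i < g.src.length := by
  by_contra h'
  rw [not_lt] at h'
  have := genSwap_apply h'
  exact absurd ((genSwap g).injective this) (by omega)

theorem genSwap_comm (g h : Gen) :
    genSwap g * genSwap (h.addLeft g.src) = genSwap (h.addLeft g.src) * genSwap g := by
  ext i
  rw [Equiv.Perm.mul_apply, Equiv.Perm.mul_apply]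
  by_cases hi : i < g.src.length
  · rw [genSwap_addLeft_apply hi, genSwap_addLeft_apply (genSwap_apply_lt hi)]
  · rw [not_lt] at hi
    rw [genSwap_apply hi, genSwap_apply]
    by_contra h'
    rw [not_le] at h'
    have := genSwap_addLeft_apply (g := h) h'
    have := (genSwap (h.addLeft g.src)).injective this
    omega

/-- The operators of diagrams next to each other commute, as they involve different strands. -/
theorem repGen_interchange (g h : Gen) :
    repGen x col n b Ns (plain (g.addRight h.tgt)) * repGen x col n b Ns (plain (h.addLeft g.src)) =
      repGen x col n b Ns (plain (h.addLeft g.tgt)) *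
        repGen x col n b Ns (plain (g.addRight h.src)) := by
  refine LinearMap.ext fun φ => Subtype.ext (funext fun θ => ?_)
  rw [Module.End.mul_apply, Module.End.mul_apply]
  by_cases hθ : seqOf col n θ = g.tgt ++ h.tgt
  · have hg := hθ.trans (tgt_addRight g h.tgt).symm
    have hh := hθ.trans (tgt_addLeft h g.tgt).symm
    obtain ⟨e₁, e₂, e₃⟩ := coef_addLeft_length (x := x) (g := h) (θ := θ) (length_tgt g)
    have hg' := seqOf_genSwap hg
    have hh' := seqOf_genSwap hh
    rw [src_addRight, ← tgt_addLeft] at hg'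
    rw [src_addLeft, ← tgt_addRight] at hh'
    rw [repGen_of_eq _ _ hg, repGen_of_eq _ _ hg', repGen_of_eq _ _ hh, repGen_of_eq _ _ hh']
    have h₁ : coefId x (g.addRight h.tgt) θ •
        (repGen x col n b Ns (plain (h.addLeft g.src)) φ).1 θ =
        coefId x g θ • (coefId x (h.addLeft g.src) θ • φ.1 θ +
          coefSwap x (h.addLeft g.src) θ • φ.1 (θ * genSwap (h.addLeft g.src))) := by
      rw [coefId_addRight]
      rcases coefId_eq_zero_or (x := x) g θ with e | e
      · rw [e, zero_smul, zero_smul]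
      · rw [repGen_of_eq _ _ (by rw [tgt_addLeft, e, hθ])]
    have h₂ : coefId x (h.addLeft g.tgt) θ •
        (repGen x col n b Ns (plain (g.addRight h.src)) φ).1 θ =
        coefId x (h.addLeft g.src) θ • (coefId x g θ • φ.1 θ +
          coefSwap x g θ • φ.1 (θ * genSwap g)) := by
      rw [e₁]
      rcases coefId_eq_zero_or (x := x) h θ with e | e
      · have e' : coefId x (h.addLeft g.src) θ = 0 ∨ h.src = h.tgt := by
          rcases coefId_eq_zero_or (x := x) (h.addLeft g.src) θ with e | e
          · exact Or.inl e
          · rw [src_addLeft, tgt_addLeft] at e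
            exact Or.inr (List.append_cancel_left e)
        rcases e' with e' | e'
        · rw [e', zero_smul, zero_smul]
        · rw [repGen_of_eq _ _ (by rw [tgt_addRight, e', hθ]), coefId_addRight, coefSwap_addRight,
            genSwap_addRight]
      · rw [repGen_of_eq _ _ (by rw [tgt_addRight, e, hθ]), coefId_addRight, coefSwap_addRight,
          genSwap_addRight]
    rw [h₁, h₂]
    obtain ⟨f₁, f₂⟩ := coef_addLeft_congr (x := x) (g := h) (w := g.src)
      (θ := θ * genSwap (g.addRight h.tgt)) (θ' := θ) (fun i hi => by
        rw [genSwap_addRight, Equiv.Perm.mul_apply, genSwap_apply hi])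
    obtain ⟨f₃, f₄⟩ := coef_congr (x := x) (g := g) (θ := θ * genSwap (h.addLeft g.tgt)) (θ' := θ)
      (fun i hi => by
        rw [e₃, Equiv.Perm.mul_apply, genSwap_addLeft_apply hi])
    rw [f₁, f₂, e₂, e₃] at *
    simp only [coefId_addRight, coefSwap_addRight, genSwap_addRight, f₃, f₄]
    rw [mul_assoc, mul_assoc, genSwap_comm]
    module
  · rw [repGen_of_ne _ _ (by rwa [tgt_addRight]), repGen_of_ne _ _ (by rwa [tgt_addLeft])]

section Three

variable (φ : good K col n b Ns) {θ : Equiv.Perm ℕ} {u v : List Strand}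

theorem swap_apply_add_two (i : ℕ) : Equiv.swap i (i + 1) (i + 2) = i + 2 :=
  Equiv.swap_apply_of_ne_of_ne (by omega) (by omega)

theorem swap_succ_apply (i : ℕ) : Equiv.swap (i + 1) (i + 2) i = i :=
  Equiv.swap_apply_of_ne_of_ne (by omega) (by omega)

theorem repGen_braid (hx : ∀ i j, i ≠ j → IsUnit (x i - x j))
    (h : seqOf col n θ = u ++ black :: black :: black :: v) :
    (repGen x col n b Ns (plain (bb u (black :: v))) (repGen x col n b Ns
      (plain (bb (u ++ [black]) v)) (repGen x col n b Ns (plain (bb u (black :: v))) φ))).1 θ =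
    (repGen x col n b Ns (plain (bb (u ++ [black]) v)) (repGen x col n b Ns
      (plain (bb u (black :: v))) (repGen x col n b Ns (plain (bb (u ++ [black]) v)) φ))).1 θ := by
  have h₁ := seqOf_swap h
  have h₂ := seqOf_swap_succ h
  have h₁₂ := seqOf_swap_succ h₁
  have h₂₁ := seqOf_swap h₂
  have A : ∀ (φ : good K col n b Ns) {θ : Equiv.Perm ℕ}
      (_ : seqOf col n θ = u ++ black :: black :: black :: v), _ := fun φ θ h =>
    repGen_bb (x := x) φ h (u := u) (v := black :: v) rfl rfl rfl
  have B : ∀ (φ : good K col n b Ns) {θ : Equiv.Perm ℕ}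
      (_ : seqOf col n θ = u ++ black :: black :: black :: v), _ := fun φ θ h =>
    repGen_bb (x := x) φ h (u := u ++ [black]) (v := v) (i := u.length + 1) (j := u.length + 2)
      (by simp) (by simp) (by simp)
  have h10 := invDiff_swap hx (i := θ u.length) (j := θ (u.length + 1)) (by simp)
  have h21 := invDiff_swap hx (i := θ (u.length + 1)) (j := θ (u.length + 2)) (by simp)
  have hm := invDiff_mul_invDiff hx (i := θ u.length) (j := θ (u.length + 1))
    (l := θ (u.length + 2)) (by simp) (by simp) (by simp)
  rw [A _ h, B _ h, B _ h₁, A _ h, A _ h₁, A _ h₂, A _ h₁₂, B _ h, A _ h, A _ h₂, B _ h, B _ h₁,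
    B _ h₂, B _ h₂₁]
  simp only [swap_sq, Equiv.Perm.mul_apply, Equiv.swap_apply_left, Equiv.swap_apply_right,
    swap_apply_add_two, swap_succ_apply, h10, h21]
  have hb := congrArg (θ * ·) (swap_braid u.length)
  simp only [← mul_assoc] at hb
  rw [hb]
  generalize invDiff x (θ u.length) (θ (u.length + 1)) = p at *
  generalize invDiff x (θ u.length) (θ (u.length + 2)) = q at *
  generalize invDiff x (θ (u.length + 1)) (θ (u.length + 2)) = r at *
  generalize φ.1 θ = a₁
  generalize φ.1 (θ * Equiv.swap u.length (u.length + 1)) = a₂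
  generalize φ.1 (θ * Equiv.swap (u.length + 1) (u.length + 2)) = a₃
  have h₁ : p * r - q * (p + r) = 0 := sub_eq_zero.2 hm
  rw [← sub_eq_zero]
  trans (p * r - q * (p + r)) • ((p - r) • a₁ - p • a₂ + r • a₃)
  · module
  · rw [h₁, zero_smul]

theorem sub_pow_mul_sum {K : Type*} [CommRing K] (y z : K) (m : ℕ) :
    (y - z) * ∑ i ∈ Finset.range m, y ^ i * z ^ (m - 1 - i) = y ^ m - z ^ m := by
  rw [mul_comm]
  exact Commute.geom_sum₂_mul (Commute.all y z) m

theorem repGen_rb_bb_br (hx : ∀ i j, i ≠ j → IsUnit (x i - x j)) {m : ℕ}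
    (h : seqOf col n θ = u ++ black :: red m :: black :: v) :
    (repGen x col n b Ns (plain (rb u m (black :: v))) (repGen x col n b Ns
      (plain (bb (u ++ [red m]) v)) (repGen x col n b Ns (plain (br u m (black :: v))) φ))).1 θ =
    (repGen x col n b Ns (plain (br (u ++ [black]) m v)) (repGen x col n b Ns
      (plain (bb u (red m :: v))) (repGen x col n b Ns (plain (rb (u ++ [black]) m v)) φ))).1 θ +
      ∑ i ∈ Finset.range m,
        ((dots (fun g => repGen x col n b Ns (plain g)) u i (red m :: black :: v)) ((dots (fun g =>
          repGen x col n b Ns (plain g)) (u ++ [black, red m]) (m - 1 - i) v) φ)).1 θ := by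
  have h₁ := seqOf_swap h
  have h₂ := seqOf_swap_succ h
  have h₁₂ := seqOf_swap_succ h₁
  have h₂₁ := seqOf_swap h₂
  have hd : ∀ i ∈ Finset.range m,
      ((dots (fun g => repGen x col n b Ns (plain g)) u i (red m :: black :: v)) ((dots (fun g =>
        repGen x col n b Ns (plain g)) (u ++ [black, red m]) (m - 1 - i) v) φ)).1 θ =
      (x (θ u.length) ^ i * x (θ (u.length + 2)) ^ (m - 1 - i)) • φ.1 θ := by
    intro i _
    rw [repGen_dots, if_pos h, repGen_dots, if_pos (by simpa using h), smul_smul]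
    simp
  have h02 := invDiff_mul hx (i := θ u.length) (j := θ (u.length + 2)) (by simp)
  have hs := sub_pow_mul_sum (x (θ u.length)) (x (θ (u.length + 2))) m
  rw [Finset.sum_congr rfl hd, ← Finset.sum_smul,
    repGen_rb (i := u.length) (j := u.length + 1) _ h rfl rfl rfl,
    repGen_bb (i := u.length + 1) (j := u.length + 2) _ h₁ (by simp) (by simp) (by simp),
    repGen_br (i := u.length) (j := u.length + 1) _ h₁ rfl rfl rfl,
    repGen_br (i := u.length) (j := u.length + 1) _ h₁₂ rfl rfl rfl,
    repGen_br (i := u.length + 1) (j := u.length + 2) _ h (by simp) (by simp) (by simp),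
    repGen_bb (i := u.length) (j := u.length + 1) _ h₂ rfl rfl rfl,
    repGen_rb (i := u.length + 1) (j := u.length + 2) _ h₂ (by simp) (by simp) (by simp),
    repGen_rb (i := u.length + 1) (j := u.length + 2) _ h₂₁ (by simp) (by simp) (by simp)]
  simp only [swap_sq, Equiv.Perm.mul_apply, Equiv.swap_apply_left, Equiv.swap_apply_right,
    swap_apply_add_two, swap_succ_apply]
  have hb := congrArg (θ * ·) (swap_braid u.length)
  simp only [← mul_assoc] at hb
  rw [hb]
  generalize x (θ u.length) = y at *
  generalize x (θ (u.length + 2)) = z at *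
  generalize (∑ i ∈ Finset.range m, y ^ i * z ^ (m - 1 - i)) = S at *
  have h₃ : invDiff x (θ u.length) (θ (u.length + 2)) * (y ^ m - z ^ m) = S := by
    linear_combination S * h02 - invDiff x (θ u.length) (θ (u.length + 2)) * hs
  rw [← h₃]
  module

theorem repGen_bb_rb_rb {m : ℕ}
    (h : seqOf col n θ = u ++ black :: black :: red m :: v) :
    (repGen x col n b Ns (plain (bb u (red m :: v))) (repGen x col n b Ns
      (plain (rb (u ++ [black]) m v)) (repGen x col n b Ns (plain (rb u m (black :: v))) φ))).1 θ =
    (repGen x col n b Ns (plain (rb (u ++ [black]) m v)) (repGen x col n b Ns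
      (plain (rb u m (black :: v))) (repGen x col n b Ns
        (plain (bb (u ++ [red m]) v)) φ))).1 θ := by
  have h₁ := seqOf_swap h
  have h₂ := seqOf_swap_succ h
  have h₁₂ := seqOf_swap_succ h₁
  have h₂₁ := seqOf_swap h₂
  rw [repGen_bb (i := u.length) (j := u.length + 1) _ h rfl rfl rfl,
    repGen_rb (i := u.length + 1) (j := u.length + 2) _ h (by simp) (by simp) (by simp),
    repGen_rb (i := u.length + 1) (j := u.length + 2) _ h₁ (by simp) (by simp) (by simp),
    repGen_rb (i := u.length) (j := u.length + 1) _ h₂ rfl rfl rfl,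
    repGen_rb (i := u.length) (j := u.length + 1) _ h₁₂ rfl rfl rfl,
    repGen_rb (i := u.length + 1) (j := u.length + 2) _ h (by simp) (by simp) (by simp),
    repGen_rb (i := u.length) (j := u.length + 1) _ h₂ rfl rfl rfl,
    repGen_bb (i := u.length + 1) (j := u.length + 2) _ h₂₁ (by simp) (by simp) (by simp)]
  simp only [Equiv.Perm.mul_apply, Equiv.swap_apply_left, Equiv.swap_apply_right,
    swap_apply_add_two, swap_succ_apply]
  have hb := congrArg (θ * ·) (swap_braid u.length)
  simp only [← mul_assoc] at hb
  rw [hb]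
  module

theorem repGen_br_br_bb {m : ℕ} (h : seqOf col n θ = u ++ red m :: black :: black :: v) :
    (repGen x col n b Ns (plain (br u m (black :: v))) (repGen x col n b Ns
      (plain (br (u ++ [black]) m v)) (repGen x col n b Ns (plain (bb u (red m :: v))) φ))).1 θ =
    (repGen x col n b Ns (plain (bb (u ++ [red m]) v)) (repGen x col n b Ns
      (plain (br u m (black :: v))) (repGen x col n b Ns
        (plain (br (u ++ [black]) m v)) φ))).1 θ := by
  have h₁ := seqOf_swap h
  have h₂ := seqOf_swap_succ h
  have h₁₂ := seqOf_swap_succ h₁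
  have h₂₁ := seqOf_swap h₂
  rw [repGen_bb (i := u.length + 1) (j := u.length + 2) _ h (by simp) (by simp) (by simp),
    repGen_br (i := u.length) (j := u.length + 1) _ h rfl rfl rfl,
    repGen_br (i := u.length + 1) (j := u.length + 2) _ h₁ (by simp) (by simp) (by simp),
    repGen_bb (i := u.length) (j := u.length + 1) _ h₁₂ rfl rfl rfl,
    repGen_br (i := u.length) (j := u.length + 1) _ h rfl rfl rfl,
    repGen_br (i := u.length + 1) (j := u.length + 2) _ h₁ (by simp) (by simp) (by simp),
    repGen_br (i := u.length) (j := u.length + 1) _ h₂ rfl rfl rfl,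
    repGen_br (i := u.length + 1) (j := u.length + 2) _ h₂₁ (by simp) (by simp) (by simp)]
  simp only [Equiv.Perm.mul_apply, Equiv.swap_apply_left, swap_apply_add_two, swap_succ_apply]
  have hb := congrArg (θ * ·) (swap_braid u.length)
  simp only [← mul_assoc] at hb
  rw [hb]

end Three

/-- The operators of the elementary diagrams satisfy the local relations. -/
theorem localHolds_repGen (hx : ∀ i j, i ≠ j → IsUnit (x i - x j)) :
    LocalHolds b Ns fun g => repGen x col n b Ns (plain g) := by
  intro y z hyz
  cases hyz with
  | interchange g g' => exact repGen_interchange g g'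
  | idem_mul_self l =>
    refine LinearMap.ext fun φ => Subtype.ext (funext fun θ => ?_)
    rw [Module.End.mul_apply]
    by_cases h : seqOf col n θ = l
    · rw [repGen_idem _ h]
    · rw [repGen_of_ne _ _ (g := idem l) h, repGen_of_ne _ _ (g := idem l) h]
  | idem_mul_ne l m hl =>
    refine LinearMap.ext fun φ => Subtype.ext (funext fun θ => ?_)
    rw [Module.End.mul_apply]
    by_cases h : seqOf col n θ = l
    · rw [repGen_idem _ h, repGen_of_ne _ _ (g := idem m) (by rw [h]; exact hl)]
      rfl
    · rw [repGen_of_ne _ _ (g := idem l) h]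
      rfl
  | tgt_mul g =>
    refine LinearMap.ext fun φ => Subtype.ext (funext fun θ => ?_)
    rw [Module.End.mul_apply]
    by_cases h : seqOf col n θ = g.tgt
    · rw [repGen_idem _ h]
    · rw [repGen_of_ne _ _ (g := idem g.tgt) h, repGen_of_ne _ _ h]
  | mul_src g =>
    refine LinearMap.ext fun φ => Subtype.ext (funext fun θ => ?_)
    rw [Module.End.mul_apply]
    by_cases h : seqOf col n θ = g.tgt
    · rw [repGen_of_eq _ _ h, repGen_of_eq _ _ h, repGen_idem _ (seqOf_genSwap h)]
      congr 1
      rcases coefId_eq_zero_or (x := x) g θ with e | e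
      · rw [e, zero_smul, zero_smul]
      · rw [e, repGen_idem _ h]
    · rw [repGen_of_ne _ _ h, repGen_of_ne _ _ h]
  | one =>
    refine LinearMap.ext fun φ => Subtype.ext (funext fun θ => ?_)
    rw [LinearMap.sum_apply, AddSubmonoidClass.coe_finsetSum, Finset.sum_apply]
    by_cases h : seqOf col n θ ∈ seqs b Ns
    · rw [Finset.sum_eq_single_of_mem _ h fun m _ hm =>
        repGen_of_ne _ _ (g := idem m) (Ne.symm hm), repGen_idem _ rfl]
      rfl
    · refine (Finset.sum_eq_zero fun m hm => repGen_of_ne _ _ (g := idem m) ?_).trans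
        (φ.2 θ h).symm
      rintro rfl
      exact h hm
  | not_seq l hl =>
    refine LinearMap.ext fun φ => Subtype.ext (funext fun θ => ?_)
    by_cases h : seqOf col n θ = l
    · rw [repGen_idem _ h, φ.2 θ (by rwa [h, mem_seqs])]
      rfl
    · rw [repGen_of_ne _ _ (g := idem l) h]
      rfl
  | bb_sq u v =>
    refine LinearMap.ext fun φ => Subtype.ext (funext fun θ => ?_)
    rw [Module.End.mul_apply]
    by_cases h : seqOf col n θ = u ++ black :: black :: v
    · rw [repGen_bb _ h rfl rfl rfl, repGen_bb _ h rfl rfl rfl,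
        repGen_bb _ (seqOf_swap h) rfl rfl rfl]
      simp only [swap_sq, Equiv.Perm.mul_apply, Equiv.swap_apply_left, Equiv.swap_apply_right]
      rw [invDiff_swap hx (i := θ u.length) (j := θ (u.length + 1)) (by simp)]
      change _ = 0
      module
    · rw [repGen_of_ne _ _ (g := bb u v) h]
      rfl
  | braid u v =>
    refine LinearMap.ext fun φ => Subtype.ext (funext fun θ => ?_)
    by_cases h : seqOf col n θ = u ++ black :: black :: black :: v
    · exact repGen_braid φ hx h
    · simp only [Module.End.mul_apply]
      rw [repGen_of_ne _ _ (g := bb u (black :: v)) h,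
        repGen_of_ne _ _ (g := bb (u ++ [black]) v) (by simpa [tgt] using h)]
  | bb_dot u v =>
    refine LinearMap.ext fun φ => Subtype.ext (funext fun θ => ?_)
    rw [LinearMap.add_apply, Module.End.mul_apply, Module.End.mul_apply, Submodule.coe_add,
      Pi.add_apply]
    by_cases h : seqOf col n θ = u ++ black :: black :: v
    · rw [repGen_bb _ h rfl rfl rfl, repGen_dot _ h rfl rfl, repGen_dot _ (seqOf_swap h) rfl rfl,
        repGen_dot (i := u.length + 1) _ h (by simp) (by simp), repGen_bb _ h rfl rfl rfl,
        repGen_idem _ h]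
      simp only [Equiv.Perm.mul_apply, Equiv.swap_apply_left]
      have h₁ := invDiff_mul hx (i := θ u.length) (j := θ (u.length + 1)) (by simp)
      nth_rewrite 3 [← one_smul K (φ.1 θ)]
      rw [← h₁]
      module
    · rw [repGen_of_ne _ _ (g := bb u v) h, repGen_of_ne _ _ (g := dot (u ++ [black]) v)
        (by simpa [tgt] using h), repGen_of_ne _ _ (g := idem (u ++ black :: black :: v)) h,
        add_zero]
  | dot_bb u v =>
    refine LinearMap.ext fun φ => Subtype.ext (funext fun θ => ?_)
    rw [LinearMap.add_apply, Module.End.mul_apply, Module.End.mul_apply, Submodule.coe_add,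
      Pi.add_apply]
    by_cases h : seqOf col n θ = u ++ black :: black :: v
    · rw [repGen_dot _ h rfl rfl, repGen_bb _ h rfl rfl rfl, repGen_bb _ h rfl rfl rfl,
        repGen_dot (i := u.length + 1) _ h (by simp) (by simp),
        repGen_dot (i := u.length + 1) _ (seqOf_swap h) (by simp) (by simp), repGen_idem _ h]
      simp only [Equiv.Perm.mul_apply, Equiv.swap_apply_right]
      have h₁ := invDiff_mul hx (i := θ u.length) (j := θ (u.length + 1)) (by simp)
      nth_rewrite 3 [← one_smul K (φ.1 θ)]
      rw [← h₁]
      module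
    · rw [repGen_of_ne _ _ (g := bb u v) h, repGen_of_ne _ _ (g := dot u (black :: v))
        h, repGen_of_ne _ _ (g := idem (u ++ black :: black :: v)) h, add_zero]
  | dot_rb u m v =>
    refine LinearMap.ext fun φ => Subtype.ext (funext fun θ => ?_)
    rw [Module.End.mul_apply, Module.End.mul_apply]
    by_cases h : seqOf col n θ = u ++ black :: red m :: v
    · rw [repGen_dot _ h rfl rfl, repGen_rb _ h rfl rfl rfl, repGen_rb _ h rfl rfl rfl,
        repGen_dot (i := u.length + 1) _ (seqOf_swap h) (by simp) (by simp)]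
      simp only [Equiv.Perm.mul_apply, Equiv.swap_apply_right]
      rw [smul_comm]
    · rw [repGen_of_ne _ _ (g := dot u (red m :: v)) h, repGen_of_ne _ _ (g := rb u m v) h]
  | br_dot u m v =>
    refine LinearMap.ext fun φ => Subtype.ext (funext fun θ => ?_)
    rw [Module.End.mul_apply, Module.End.mul_apply]
    by_cases h : seqOf col n θ = u ++ red m :: black :: v
    · rw [repGen_br _ h rfl rfl rfl, repGen_dot _ (seqOf_swap h) rfl rfl,
        repGen_dot (i := u.length + 1) _ h (by simp) (by simp), repGen_br _ h rfl rfl rfl]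
      simp only [Equiv.Perm.mul_apply, Equiv.swap_apply_left]
    · rw [repGen_of_ne _ _ (g := br u m v) h, repGen_of_ne _ _ (g := dot (u ++ [red m]) v)
        (by simpa [tgt] using h)]
  | br_rb u m v =>
    refine LinearMap.ext fun φ => Subtype.ext (funext fun θ => ?_)
    rw [Module.End.mul_apply, repGen_dots]
    by_cases h : seqOf col n θ = u ++ red m :: black :: v
    · rw [repGen_br _ h rfl rfl rfl, repGen_rb _ (seqOf_swap h) rfl rfl rfl,
        if_pos (by simpa using h), swap_sq]
      simp
    · rw [repGen_of_ne _ _ (g := br u m v) h, if_neg (by simpa using h)]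
  | rb_br u m v =>
    refine LinearMap.ext fun φ => Subtype.ext (funext fun θ => ?_)
    rw [Module.End.mul_apply, repGen_dots]
    by_cases h : seqOf col n θ = u ++ black :: red m :: v
    · rw [repGen_rb _ h rfl rfl rfl, repGen_br _ (seqOf_swap h) rfl rfl rfl,
        if_pos (by simpa using h), swap_sq]
    · rw [repGen_of_ne _ _ (g := rb u m v) h, if_neg (by simpa using h)]
  | bb_rb_rb u m v =>
    refine LinearMap.ext fun φ => Subtype.ext (funext fun θ => ?_)
    by_cases h : seqOf col n θ = u ++ black :: black :: red m :: v
    · exact repGen_bb_rb_rb φ h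
    · simp only [Module.End.mul_apply]
      rw [repGen_of_ne _ _ (g := bb u (red m :: v)) h,
        repGen_of_ne _ _ (g := rb (u ++ [black]) m v) (by simpa [tgt] using h)]
  | br_br_bb u m v =>
    refine LinearMap.ext fun φ => Subtype.ext (funext fun θ => ?_)
    by_cases h : seqOf col n θ = u ++ red m :: black :: black :: v
    · exact repGen_br_br_bb φ h
    · simp only [Module.End.mul_apply]
      rw [repGen_of_ne _ _ (g := br u m (black :: v)) h,
        repGen_of_ne _ _ (g := bb (u ++ [red m]) v) (by simpa [tgt] using h)]
  | rb_bb_br u m v =>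
    refine LinearMap.ext fun φ => Subtype.ext (funext fun θ => ?_)
    rw [LinearMap.add_apply, Submodule.coe_add, Pi.add_apply, LinearMap.sum_apply,
      AddSubmonoidClass.coe_finsetSum, Finset.sum_apply]
    by_cases h : seqOf col n θ = u ++ black :: red m :: black :: v
    · exact repGen_rb_bb_br φ hx h
    · simp only [Module.End.mul_apply]
      rw [repGen_of_ne _ _ (g := rb u m (black :: v)) h,
        repGen_of_ne _ _ (g := br (u ++ [black]) m v) (by simpa [tgt] using h), zero_add]
      refine (Finset.sum_eq_zero fun i _ => ?_).symm
      rw [repGen_dots, if_neg h]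

end Relations

end KLRW

/-! ### Freeness of the columns -/

namespace KLRW

open Strand Gen DGGen

section Representation

variable {k : Type*} [CommRing k] {K : Type*} [CommRing K] [Algebra k K] {x : ℕ → K}
  {col : ℕ → Strand} {n b : ℕ} {Ns : List ℕ}

theorem xi_mul_self (i : ℕ) : xi (K := K) i * xi i = 0 := ExteriorAlgebra.ι_sq_zero _

theorem xi_mul_comm (i j : ℕ) : xi (K := K) i * xi j = -(xi j * xi i) :=
  eq_neg_of_add_eq_zero_left (ExteriorAlgebra.ι_add_mul_swap _ _)

theorem repGen_nail_eq {φ : good K col n b Ns} {θ : Equiv.Perm ℕ} {v : List Strand}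
    (h : seqOf col n θ = black :: v) :
    (repGen x col n b Ns (nail v) φ).1 θ = xi (θ 0) * φ.1 θ := if_pos h

theorem repGen_nail_ne {φ : good K col n b Ns} {θ : Equiv.Perm ℕ} {v : List Strand}
    (h : seqOf col n θ ≠ black :: v) : (repGen x col n b Ns (nail v) φ).1 θ = 0 := if_neg h

theorem repGen_rel (hx : ∀ i j, i ≠ j → IsUnit (x i - x j)) ⦃y z : FreeAlgebra k DGGen⦄
    (h : DGRel k b Ns y z) : FreeAlgebra.lift k (repGen x col n b Ns) y =
      FreeAlgebra.lift k (repGen x col n b Ns) z := by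
  cases h with
  | loc h =>
    have h' := LocalRel.map (A := Module.End K (good K col n b Ns))
      (FreeAlgebra.lift k (repGen x col n b Ns)).toRingHom h
    simp only [AlgHom.toRingHom_eq_coe, RingHom.coe_coe, FreeAlgebra.lift_ι_apply] at h'
    exact localHolds_repGen hx h'
  | tgt_nail v =>
    simp only [map_mul, FreeAlgebra.lift_ι_apply]
    refine LinearMap.ext fun φ => Subtype.ext (funext fun θ => ?_)
    rw [Module.End.mul_apply]
    by_cases h : seqOf col n θ = black :: v
    · rw [repGen_idem _ h]
    · rw [repGen_of_ne _ _ (g := idem (black :: v)) h, repGen_nail_ne h]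
  | nail_src v =>
    simp only [map_mul, FreeAlgebra.lift_ι_apply]
    refine LinearMap.ext fun φ => Subtype.ext (funext fun θ => ?_)
    rw [Module.End.mul_apply]
    by_cases h : seqOf col n θ = black :: v
    · rw [repGen_nail_eq h, repGen_nail_eq h, repGen_idem _ h]
    · rw [repGen_nail_ne h, repGen_nail_ne h]
  | interchange g =>
    simp only [map_mul, FreeAlgebra.lift_ι_apply]
    refine LinearMap.ext fun φ => Subtype.ext (funext fun θ => ?_)
    rw [Module.End.mul_apply, Module.End.mul_apply]
    have ht : (g.addLeft [black]).tgt = black :: g.tgt := tgt_addLeft g [black]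
    by_cases h : seqOf col n θ = black :: g.tgt
    · have h' := seqOf_genSwap (h.trans ht.symm)
      rw [src_addLeft, List.singleton_append] at h'
      rw [repGen_nail_eq h, repGen_of_eq _ _ (h.trans ht.symm),
        repGen_of_eq _ _ (h.trans ht.symm), repGen_nail_eq h', Equiv.Perm.mul_apply,
        genSwap_addLeft_apply (by simp), mul_add, mul_smul_comm, mul_smul_comm]
      congr 1
      rcases coefId_eq_zero_or (x := x) (g.addLeft [black]) θ with e | e
      · rw [e, zero_smul, zero_smul]
      · rw [src_addLeft, ht, List.singleton_append] at e
        rw [repGen_nail_eq (h.trans e.symm)]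
    · rw [repGen_nail_ne h, repGen_of_ne _ _ (by rwa [ht])]
  | dot_nail v =>
    simp only [map_mul, FreeAlgebra.lift_ι_apply]
    refine LinearMap.ext fun φ => Subtype.ext (funext fun θ => ?_)
    rw [Module.End.mul_apply, Module.End.mul_apply]
    by_cases h : seqOf col n θ = black :: v
    · rw [repGen_nail_eq h, repGen_dot (u := []) _ h rfl rfl, repGen_dot (u := []) _ h rfl rfl,
        repGen_nail_eq h, mul_smul_comm]
    · rw [repGen_nail_ne h, repGen_of_ne _ _ (g := dot [] v) h]
  | nail_anticomm v =>
    simp only [map_mul, map_neg, FreeAlgebra.lift_ι_apply]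
    refine LinearMap.ext fun φ => Subtype.ext (funext fun θ => ?_)
    rw [LinearMap.neg_apply, Submodule.coe_neg, Pi.neg_apply]
    simp only [Module.End.mul_apply]
    by_cases h : seqOf col n θ = black :: black :: v
    · have h' : seqOf col n (θ * Equiv.swap 0 1) = black :: black :: v := seqOf_swap (u := []) h
      have B : ∀ (φ : good K col n b Ns) {θ : Equiv.Perm ℕ}
          (_ : seqOf col n θ = black :: black :: v), _ := fun φ θ h =>
        repGen_bb (x := x) φ h (u := []) (i := 0) (j := 1) rfl rfl rfl
      rw [B _ h, repGen_nail_eq h, repGen_nail_eq h, repGen_nail_eq h', B _ h, B _ h', B _ h,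
        repGen_nail_eq h, repGen_nail_eq h, repGen_nail_eq h', repGen_nail_eq h', B _ h, B _ h']
      simp only [swap_sq, repGen_nail_eq h, Equiv.Perm.mul_apply, Equiv.swap_apply_left,
        Equiv.swap_apply_right]
      rw [invDiff_swap hx (i := θ 0) (j := θ 1) (by simp)]
      simp only [mul_sub, mul_smul_comm, ← mul_assoc, xi_mul_self, zero_mul,
        xi_mul_comm (K := K) (θ 1) (θ 0),
        neg_mul]
      module
    · rw [repGen_nail_ne h, repGen_of_ne _ _ (g := bb [] v) h, neg_zero]
  | nail_sq v =>
    simp only [map_mul, map_zero, FreeAlgebra.lift_ι_apply]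
    refine LinearMap.ext fun φ => Subtype.ext (funext fun θ => ?_)
    rw [Module.End.mul_apply]
    by_cases h : seqOf col n θ = black :: v
    · rw [repGen_nail_eq h, repGen_nail_eq h, ← mul_assoc, xi_mul_self, zero_mul]
      rfl
    · rw [repGen_nail_ne h]
      rfl

variable (k col n b Ns) in
/-- The polynomial representation of the dg-enhanced KLRW algebra, extended to functions on the
permutations of the strands. -/
def dgRep (hx : ∀ i j, i ≠ j → IsUnit (x i - x j)) :
    DGAlg k b Ns →ₐ[k] Module.End K (good K col n b Ns) :=
  Pres.lift (FreeAlgebra.lift k (repGen x col n b Ns)) (repGen_rel hx)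

variable (hx : ∀ i j, i ≠ j → IsUnit (x i - x j))

theorem dgRep_plain (g : Gen) :
    dgRep k col n b Ns hx (dgPlain k b Ns g) = repGen x col n b Ns (plain g) := by
  rw [dgRep, dgPlain, Pres.lift_gen, FreeAlgebra.lift_ι_apply]

theorem dgRep_nail (v : List Strand) :
    dgRep k col n b Ns hx (dgNail k b Ns v) = repGen x col n b Ns (nail v) := by
  rw [dgRep, dgNail, Pres.lift_gen, FreeAlgebra.lift_ι_apply]

/-- The coefficient of the identity in the operator of a crossing. -/
def crossId (x : ℕ → K) (col : ℕ → Strand) (i : ℕ) (θ : Equiv.Perm ℕ) : K :=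
  match col (θ i), col (θ (i + 1)) with
  | black, black => invDiff x (θ i) (θ (i + 1))
  | _, _ => 0

/-- The coefficient of the transposition in the operator of a crossing.  It is invertible; the
value for two red strands, which do not cross, does not matter. -/
def crossSwap (x : ℕ → K) (col : ℕ → Strand) (i : ℕ) (θ : Equiv.Perm ℕ) : K :=
  match col (θ i), col (θ (i + 1)) with
  | black, black => -invDiff x (θ i) (θ (i + 1))
  | black, red m => x (θ i) ^ m
  | red _, _ => 1

include hx in
theorem isUnit_crossSwap (hx₀ : ∀ i, IsUnit (x i)) (i : ℕ) (θ : Equiv.Perm ℕ) :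
    IsUnit (crossSwap x col i θ) := by
  rw [crossSwap]
  split
  · rw [IsUnit.neg_iff]
    exact IsUnit.of_mul_eq_one _ (invDiff_mul hx (by simp))
  · exact (hx₀ _).pow _
  · exact isUnit_one

/-- On functions supported where it is a diagram, a crossing acts as the exchange operator. -/
theorem repGen_cross {u : List Strand} {c d : Strand} {v : List Strand} {g : Gen}
    (hg : crossGen u c d v = some g) (φ : good K col n b Ns)
    (hφ : ∀ θ, seqOf col n θ ≠ u ++ c :: d :: v → φ.1 θ = 0) :
    (repGen x col n b Ns (plain g) φ).1 =
      crossOp (crossId x col) (crossSwap x col) u.length φ.1 := by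
  ext θ
  rw [crossOp_apply]
  by_cases h : seqOf col n θ = u ++ d :: c :: v
  · have hd := col_of_seqOf h
    have hc : col (θ (u.length + 1)) = c := by
      simpa using col_of_seqOf (u := u ++ [d]) (by simpa using h)
    rw [repGen_of_eq _ _ (h.trans (tgt_of_crossGen hg).symm), crossId, crossSwap, hd, hc]
    rcases c with _ | m <;> rcases d with _ | m' <;> simp [crossGen] at hg <;> subst hg <;>
      simp [coefId, coefSwap, genSwap]
  · rw [repGen_of_ne _ _ (by rwa [tgt_of_crossGen hg]), hφ (θ * _) fun h' => h ?_, smul_zero,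
      add_zero]
    · by_cases h' : seqOf col n θ = u ++ c :: d :: v
      · have hc := col_of_seqOf h'
        have hd : col (θ (u.length + 1)) = d := by
          simpa using col_of_seqOf (u := u ++ [c]) (by simpa using h')
        rw [crossId, hc, hd]
        rcases c with _ | m <;> rcases d with _ | m'
        · exact absurd h' h
        all_goals simp
      · rw [hφ θ h', smul_zero]
    · have := seqOf_swap h'
      rwa [swap_sq] at this

/-- The strands of a sequence, numbered by their positions; the value beyond its length does not
matter. -/
def colOf (l : List Strand) (i : ℕ) : Strand := l.getD i black

theorem seqOf_colOf (l : List Strand) : seqOf (colOf l) l.length 1 = l := by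
  refine List.ext_getElem? fun i => ?_
  rw [seqOf_getElem?]
  split_ifs with h
  · simp [colOf, h]
  · simp at h
    simp [h]

variable {l : List Strand} (hl : l ∈ seqs b Ns)

/-- The indicator function of the identity permutation. -/
def goodDelta (K : Type*) [CommRing K] (hl : l ∈ seqs b Ns) :
    good K (colOf l) l.length b Ns :=
  ⟨deltaOne K, fun θ h => deltaOne_of_ne fun e => h (by rwa [e, seqOf_colOf])⟩

theorem deltaOne_seqOf {θ : Equiv.Perm ℕ} (h : seqOf (colOf l) l.length θ ≠ l) :
    deltaOne K θ = 0 := deltaOne_of_ne fun e => h (by rw [e, seqOf_colOf])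

theorem dgRep_dgE {m : List Strand} {φ : good K col n b Ns}
    (hφ : ∀ θ, seqOf col n θ ≠ m → φ.1 θ = 0) :
    dgRep k col n b Ns hx (dgE k b Ns m) φ = φ := by
  refine Subtype.ext (funext fun θ => ?_)
  rw [dgE, dgRep_plain]
  by_cases h : seqOf col n θ = m
  · rw [repGen_idem _ h]
  · rw [repGen_of_ne _ _ (g := idem m) h, hφ θ h]

/-- A word that is a diagram acts by exchange operators. -/
theorem dgRep_word (w : List Letter) {m : List Strand} (hw : top w l = some m) :
    (dgRep k (colOf l) l.length b Ns hx (eval (dgT k b Ns) (dgW k b Ns) w * dgE k b Ns l)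
      (goodDelta K hl)).1 = eval (crossOp (crossId x (colOf l)) (crossSwap x (colOf l)))
        (nailOp K) w (deltaOne K) ∧
    ∀ θ, seqOf (colOf l) l.length θ ≠ m →
      (dgRep k (colOf l) l.length b Ns hx (eval (dgT k b Ns) (dgW k b Ns) w * dgE k b Ns l)
        (goodDelta K hl)).1 θ = 0 := by
  induction w generalizing m with
  | nil =>
    obtain rfl : l = m := by simpa using hw
    rw [eval_nil, eval_nil, one_mul, dgRep_dgE hx fun θ h => deltaOne_seqOf h]
    exact ⟨rfl, fun θ h => deltaOne_seqOf h⟩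
  | cons a w ih =>
    rw [top_cons] at hw
    obtain ⟨m', hm', hw⟩ := Option.bind_eq_some_iff.1 hw
    obtain ⟨ih₁, ih₂⟩ := ih hm'
    have hE := (top_dg (k := k) (b := b) (Ns := Ns) w l).2 m' hm'
    rcases a with i | _
    · obtain ⟨u, c, d, v, g, rfl, rfl, rfl, hg⟩ := exists_of_stepT hw
      rw [eval_T_cons, eval_T_cons, mul_assoc, dgT_mul hE, crossAt_eq rfl rfl, map_mul,
        Module.End.mul_apply, Module.End.mul_apply, ← ih₁, dgCross, hg, Option.elim_some,
        dgRep_plain]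
      refine ⟨repGen_cross hg _ ih₂, fun θ h => repGen_of_ne _ _ ?_⟩
      rwa [tgt_of_crossGen hg]
    · rcases m' with _ | ⟨_ | n, v⟩
      · simp [Letter.step] at hw
      · obtain rfl : black :: v = m := by simpa [Letter.step] using hw
        rw [eval_W_cons, eval_W_cons, mul_assoc, dgW_mul hE, nailAt, map_mul,
          Module.End.mul_apply, Module.End.mul_apply, ← ih₁, dgRep_nail]
        refine ⟨funext fun θ => ?_, fun θ h => repGen_nail_ne h⟩
        rw [nailOp_apply]
        by_cases h : seqOf (colOf l) l.length θ = black :: v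
        · rw [repGen_nail_eq h]
        · rw [repGen_nail_ne h, ih₂ θ h, mul_zero]
      · simp [Letter.step] at hw

theorem dgRep_dgX (i : BlackPos l) :
    dgRep k (colOf l) l.length b Ns hx (dgX k b Ns i) (goodDelta K hl) =
      x i • goodDelta K hl := by
  obtain ⟨i, hi⟩ := i
  obtain ⟨h, hi⟩ := List.getElem?_eq_some_iff.1 hi
  have hd : dotAt k b Ns i l = dgPlain k b Ns (dot (l.take i) (l.drop (i + 1))) :=
    dotAt_black (by rw [← hi]; simp) (by simp; omega)
  have e := dgRep_dgE (k := k) hx (φ := goodDelta K hl) fun θ h => deltaOne_seqOf h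
  rw [← e, ← Module.End.mul_apply, ← map_mul, dgX_mul_dgE, e, hd, dgRep_plain]
  refine Subtype.ext (funext fun θ => ?_)
  by_cases hθ : θ = 1
  · subst hθ
    rw [repGen_dot (i := i) _ (seqOf_colOf l) (by rw [← hi]; simp) (by simp; omega)]
    rfl
  · have h0 : (goodDelta K hl).1 θ = 0 := deltaOne_of_ne hθ
    have h1 : (x i • goodDelta K hl).1 θ = x i • (goodDelta K hl).1 θ := rfl
    rw [h1, h0, smul_zero, repGen_plain]
    simp [coefId, coefSwap, h0]

theorem dgRep_dgPoly (p : MvPolynomial (BlackPos l) k) :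
    dgRep k (colOf l) l.length b Ns hx (dgPoly k b Ns l p) (goodDelta K hl) =
      MvPolynomial.aeval (fun i : BlackPos l => x i) p • goodDelta K hl := by
  induction p using MvPolynomial.induction_on with
  | C a =>
    rw [MvPolynomial.algHom_C, AlgHom.commutes, MvPolynomial.algHom_C, algebraMap_smul]
    rfl
  | add p q hp hq => rw [map_add, map_add, LinearMap.add_apply, hp, hq, map_add, add_smul]
  | mul_X p i hp =>
    rw [map_mul, dgPoly_X, map_mul, Module.End.mul_apply, dgRep_dgX, map_smul, hp, smul_smul,
      map_mul, MvPolynomial.aeval_X, mul_comm]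

end Representation

section Independence

variable (k : Type*) [CommRing k] {b : ℕ} {Ns : List ℕ} {l : List Strand}

theorem isUnit_X (i : ℕ) : IsUnit (algebraMap (MvPolynomial ℕ k)
    (FractionRing (MvPolynomial ℕ k)) (MvPolynomial.X i)) :=
  IsLocalization.map_units (M := nonZeroDivisors (MvPolynomial ℕ k)) _
    ⟨_, MvPolynomial.isRegular_X.mem_nonZeroDivisors⟩

/-- Over any ring, the difference of two variables is a nonzerodivisor. -/
theorem isUnit_X_sub_X {i j : ℕ} (h : i ≠ j) : IsUnit (algebraMap (MvPolynomial ℕ k)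
    (FractionRing (MvPolynomial ℕ k)) (MvPolynomial.X i) - algebraMap (MvPolynomial ℕ k)
      (FractionRing (MvPolynomial ℕ k)) (MvPolynomial.X j)) := by
  -- the substitution `X i ↦ X i + X j` is injective and maps `X i - X j` to `X i`
  let f : MvPolynomial ℕ k →ₐ[k] MvPolynomial ℕ k :=
    MvPolynomial.aeval (Function.update MvPolynomial.X i (MvPolynomial.X i + MvPolynomial.X j))
  let f' : MvPolynomial ℕ k →ₐ[k] MvPolynomial ℕ k :=
    MvPolynomial.aeval (Function.update MvPolynomial.X i (MvPolynomial.X i - MvPolynomial.X j))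
  have hf : ∀ p, f' (f p) = p := by
    intro p
    rw [← AlgHom.comp_apply]
    refine (DFunLike.congr_fun (MvPolynomial.algHom_ext (f := f'.comp f) (g := AlgHom.id k _)
      fun l => ?_) p).trans rfl
    by_cases hl : l = i
    · subst hl
      simp [f, f', h.symm]
    · simp [f, f', hl]
  have hs : f (MvPolynomial.X i - MvPolynomial.X j) = MvPolynomial.X i := by
    simp [f, h.symm]
  rw [← map_sub]
  refine IsLocalization.map_units (M := nonZeroDivisors (MvPolynomial ℕ k)) _ ⟨_, ?_⟩
  rw [mem_nonZeroDivisors_iff_right]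
  intro q hq
  have h0 := congrArg f hq
  rw [map_mul, hs, map_zero] at h0
  rw [← hf q, (mem_nonZeroDivisors_iff_right.1 MvPolynomial.isRegular_X.mem_nonZeroDivisors) _ h0,
    map_zero]

/-- The words that are diagrams are independent over the polynomials in the dots: applied to the
indicator function of the identity in the polynomial representation, the dots become independent
variables and the words stay independent. -/
theorem linearIndependent_wordVec (hl : l ∈ seqs b Ns) :
    LinearIndependent (MvPolynomial (BlackPos l) k) (wordVec k (b := b) (Ns := Ns) l) := by
  classical
  let K := FractionRing (MvPolynomial ℕ k)
  let x : ℕ → K := fun i => algebraMap (MvPolynomial ℕ k) K (MvPolynomial.X i)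
  have hx : ∀ i j, i ≠ j → IsUnit (x i - x j) := fun i j => isUnit_X_sub_X k
  have hind := (linearIndependent_word (α := crossId x (colOf l))
    (γ := crossSwap x (colOf l)) (isUnit_crossSwap hx (isUnit_X k)) (b + Ns.length)).comp
      (Subtype.val : LegalCode b Ns l → _) Subtype.val_injective
  rw [Fintype.linearIndependent_iff] at hind ⊢
  intro p hp c
  -- the variables of different black strands are independent in `K`
  have hinj : ∀ p : MvPolynomial (BlackPos l) k,
      MvPolynomial.aeval (fun i : BlackPos l => x i) p = 0 → p = 0 := by
    intro p hp
    have h : MvPolynomial.aeval (fun i : BlackPos l => x i) p =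
        algebraMap (MvPolynomial ℕ k) K (MvPolynomial.rename Subtype.val p) := by
      rw [← IsScalarTower.toAlgHom_apply k (MvPolynomial ℕ k) K, ← AlgHom.comp_apply]
      congr 1
      ext i
      simp [x]
    rw [h] at hp
    have := (IsFractionRing.injective (MvPolynomial ℕ k) K) (hp.trans (map_zero _).symm)
    exact MvPolynomial.rename_injective _ Subtype.val_injective (this.trans (map_zero _).symm)
  refine hinj _ (hind (fun c => MvPolynomial.aeval (fun i : BlackPos l => x i) (p c)) ?_ c)
  -- the action on the indicator function of the identity
  let act : Column k b Ns l →+ FunSpace K := AddMonoidHom.mk'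
    (fun a => (dgRep k (colOf l) l.length b Ns hx ((toColumn l).symm a) (goodDelta K hl)).1)
    fun a a' =>
      congrArg (fun f : Module.End K (good K (colOf l) l.length b Ns) => (f (goodDelta K hl)).1)
        (map_add (dgRep k (colOf l) l.length b Ns hx) _ _)
  have hact : ∀ c, act (p c • wordVec k l c) =
      MvPolynomial.aeval (fun i : BlackPos l => x i) (p c) •
        eval (crossOp (crossId x (colOf l)) (crossSwap x (colOf l))) (nailOp K) c.1.word
          (deltaOne K) := by
    intro c
    obtain ⟨m, hm⟩ := Option.ne_none_iff_exists'.1 c.2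
    have e : act (p c • wordVec k l c) = (dgRep k (colOf l) l.length b Ns hx
      (eval (dgT k b Ns) (dgW k b Ns) c.1.word * dgE k b Ns l * dgPoly k b Ns l (p c))
        (goodDelta K hl)).1 := rfl
    rw [e, map_mul, Module.End.mul_apply, dgRep_dgPoly, map_smul,
      ← (dgRep_word (k := k) hx hl c.1.word hm).1]
    rfl
  have h0 := congrArg act hp
  rw [map_sum, map_zero] at h0
  rw [← h0]
  exact Finset.sum_congr rfl fun c _ => (hact c).symm

end Independence

end KLRW

/-! ### Dots that are boundaries -/

namespace DGAlgebra

variable {k A : Type*} [CommRing k] [Ring A] [Algebra k A] (D : DGAlgebra k A)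

/-- The elements of homological degree `h`. -/
def degPart (h : ℤ) : Submodule k A := ⨆ q, D.gr (h, q)

theorem gr_le_degPart (h q : ℤ) : D.gr (h, q) ≤ D.degPart h := le_iSup (fun q => D.gr (h, q)) q

variable {D}

@[elab_as_elim]
theorem degPart_induction {h : ℤ} {p : A → Prop} {a : A} (ha : a ∈ D.degPart h)
    (hom : ∀ q a, a ∈ D.gr (h, q) → p a) (h0 : p 0) (hadd : ∀ a b, p a → p b → p (a + b)) : p a :=
  Submodule.iSup_induction (fun q => D.gr (h, q)) (motive := p) ha hom h0 hadd

theorem one_mem_degPart : (1 : A) ∈ D.degPart 0 := by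
  let := D.graded
  exact D.gr_le_degPart 0 0 SetLike.GradedOne.one_mem

theorem mul_mem_degPart {h h' : ℤ} {a a' : A} (ha : a ∈ D.degPart h) (ha' : a' ∈ D.degPart h') :
    a * a' ∈ D.degPart (h + h') := by
  let := D.graded
  refine degPart_induction ha (fun q a ha => ?_) (by simp) fun a b ha hb => ?_
  · refine degPart_induction ha' (fun q' a' ha' => ?_) (by simp) fun a' b ha' hb => ?_
    · exact D.gr_le_degPart _ (q + q') (SetLike.mul_mem_graded ha ha')
    · rw [mul_add]; exact add_mem ha' hb
  · rw [add_mul]; exact add_mem ha hb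

theorem d_mem_degPart {h : ℤ} {a : A} (ha : a ∈ D.degPart (h + 1)) : D.d a ∈ D.degPart h := by
  refine degPart_induction ha (fun q a ha => ?_) (by simp) fun a b ha hb => ?_
  · have := D.d_mem _ _ _ ha
    rw [add_sub_cancel_right] at this
    exact D.gr_le_degPart _ q this
  · rw [map_add]; exact add_mem ha hb

theorem sgn_of_mem_degPart {h : ℤ} {a : A} (ha : a ∈ D.degPart h) :
    D.sgn a = h.negOnePow • a := by
  refine degPart_induction ha (fun q a ha => D.sgn_of_mem ha) (by simp) fun a b ha hb => ?_
  rw [map_add, ha, hb, smul_add]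

variable (D) in
/-- The projection to the elements of homological degree `h`. -/
def homProj (h : ℤ) : A →ₗ[k] A :=
  letI := D.graded
  (DirectSum.toModule k (ℤ × ℤ) A fun i => if i.1 = h then (D.gr i).subtype else 0) ∘ₗ
    (DirectSum.decomposeLinearEquiv D.gr).toLinearMap

theorem homProj_of_mem_gr {h h' q : ℤ} {a : A} (ha : a ∈ D.gr (h', q)) :
    D.homProj h a = if h' = h then a else 0 := by
  let := D.graded
  have e : DirectSum.decompose D.gr a = DirectSum.lof k _ (fun i => D.gr i) (h', q) ⟨a, ha⟩ :=
    DirectSum.decompose_of_mem _ ha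
  rw [homProj, LinearMap.comp_apply, LinearEquiv.coe_coe, DirectSum.decomposeLinearEquiv_apply, e,
    DirectSum.toModule_lof]
  split_ifs <;> simp_all

theorem homProj_of_mem {h h' : ℤ} {a : A} (ha : a ∈ D.degPart h') :
    D.homProj h a = if h' = h then a else 0 := by
  refine degPart_induction ha (fun q a ha => homProj_of_mem_gr ha) (by simp) fun a b ha hb => ?_
  rw [map_add, ha, hb]
  split_ifs <;> simp

theorem homProj_mul (h : ℤ) (a : A) {a' : A} (ha' : a' ∈ D.degPart 0) :
    D.homProj h (a * a') = D.homProj h a * a' := by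
  induction a using D.homogeneous_induction with
  | h0 => simp
  | hom i q a ha =>
    have h₁ := mul_mem_degPart (D.gr_le_degPart _ _ ha) ha'
    rw [add_zero] at h₁
    rw [homProj_of_mem h₁, homProj_of_mem_gr ha]
    split_ifs <;> simp
  | hadd x y hx hy => rw [add_mul, map_add, hx, hy, map_add, add_mul]

variable (D) in
/-- The boundaries of the elements of homological degree one. -/
def degBoundaries : Submodule k A := (D.degPart 1).map D.d

theorem mul_mem_degBoundaries_left {a c : A} (hc : c ∈ D.degPart 0) (hd : D.d c = 0)
    (ha : a ∈ D.degBoundaries) : c * a ∈ D.degBoundaries := by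
  obtain ⟨y, hy, rfl⟩ := ha
  refine ⟨c * y, by simpa using mul_mem_degPart hc hy, ?_⟩
  rw [D.leibniz', hd, zero_mul, zero_add, sgn_of_mem_degPart hc, Int.negOnePow_zero, one_smul]

theorem mul_mem_degBoundaries_right {a c : A} (hc : c ∈ D.degPart 0) (hd : D.d c = 0)
    (ha : a ∈ D.degBoundaries) : a * c ∈ D.degBoundaries := by
  obtain ⟨y, hy, rfl⟩ := ha
  refine ⟨y * c, by simpa using mul_mem_degPart hy hc, ?_⟩
  rw [D.leibniz', hd, mul_zero, add_zero]

/-- A cycle times a boundary is a boundary. -/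
theorem exists_d_eq_mul {h : ℤ} {z a : A} (hz : z ∈ D.degPart h) (hd : D.d z = 0)
    (ha : a ∈ D.degBoundaries) : ∃ y ∈ D.degPart (h + 1), D.d y = z * a := by
  obtain ⟨y, hy, rfl⟩ := ha
  refine ⟨D.sgn z * y, ?_, ?_⟩
  · rw [sgn_of_mem_degPart hz, Units.smul_def, smul_mul_assoc]
    exact zsmul_mem (mul_mem_degPart hz hy) _
  · rw [D.leibniz', D.sgn_sgn, D.d_sgn, hd]
    simp

end DGAlgebra

namespace KLRW

open Strand Gen DGGen

section

variable {k : Type*} [CommRing k] {b : ℕ} {Ns : List ℕ} (N : ℕ)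

local notation "D" => dgKLRW k b Ns N

theorem dgPlain_mem_degPart (g : Gen) : dgPlain k b Ns g ∈ (D).degPart 0 :=
  (D).gr_le_degPart 0 g.degQ (dgPlain_mem N g)

theorem dgNail_mem_degPart (v : List Strand) : dgNail k b Ns v ∈ (D).degPart 1 :=
  (D).gr_le_degPart 1 _ (gen_mem_wordGr (k := k) (Pres.gen (DGRel k b Ns)) (DGGen.deg N) (nail v))

theorem d_dgPlain (g : Gen) : (D).d (dgPlain k b Ns g) = 0 := dgD_plain N g

theorem dgPlain_mul_mem_degBoundaries (g : Gen) {a : DGAlg k b Ns}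
    (ha : a ∈ (D).degBoundaries) : dgPlain k b Ns g * a ∈ (D).degBoundaries :=
  DGAlgebra.mul_mem_degBoundaries_left (dgPlain_mem_degPart N g) (d_dgPlain N g) ha

theorem mul_dgPlain_mem_degBoundaries (g : Gen) {a : DGAlg k b Ns}
    (ha : a ∈ (D).degBoundaries) : a * dgPlain k b Ns g ∈ (D).degBoundaries :=
  DGAlgebra.mul_mem_degBoundaries_right (dgPlain_mem_degPart N g) (d_dgPlain N g) ha

/-- For a crossing `t` of two black strands with the idempotent `e`, the element `H` is the divided
difference of `x₁ ^ m`. -/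
theorem exists_divided_difference {A : Type*} [Ring A] {e t x₁ x₂ : A} (hte : t * e = t)
    (het : e * t = t) (hee : e * e = e) (hex₁ : e * x₁ = x₁) (hex₂ : e * x₂ = x₂)
    (hxe₁ : x₁ * e = x₁) (hxe₂ : x₂ * e = x₂) (h1 : t * x₁ = x₂ * t + e)
    (hx : x₁ * x₂ = x₂ * x₁) (m : ℕ) :
    ∃ H, t * (e * x₁ ^ m) = e * x₂ ^ m * t + H ∧ x₁ * H = H * x₁ ∧ H * e = H ∧
      x₁ * H - x₂ * H = e * x₁ ^ m - e * x₂ ^ m := by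
  have c₁ : Commute e x₁ := hex₁.trans hxe₁.symm
  have c₂ : Commute e x₂ := hex₂.trans hxe₂.symm
  induction m with
  | zero => exact ⟨0, by simp [het, hte], by simp, by simp, by simp⟩
  | succ m ih =>
    obtain ⟨H, a1, a2, a3, a4⟩ := ih
    have c₃ : e * x₂ ^ m * e = e * x₂ ^ m := by
      rw [mul_assoc, ← (c₂.pow_right m).eq, ← mul_assoc, hee]
    refine ⟨e * x₂ ^ m + H * x₁, ?_, ?_, ?_, ?_⟩
    · rw [pow_succ, ← mul_assoc e, ← mul_assoc, a1, add_mul, mul_assoc, h1, mul_add, c₃,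
        ← mul_assoc, mul_assoc e, ← pow_succ]
      abel
    · rw [mul_add, add_mul, ← mul_assoc x₁ H, a2, ((c₁.symm).mul_right
        (Commute.pow_right hx m)).eq]
    · rw [add_mul, c₃, mul_assoc, hxe₁]
    · have e₁ : x₁ * (H * x₁) - x₂ * (H * x₁) = (e * x₁ ^ m - e * x₂ ^ m) * x₁ := by
        rw [← a4]; noncomm_ring
      have e₂ : x₁ * (e * x₂ ^ m) = e * x₂ ^ m * x₁ :=
        ((c₁.symm).mul_right (Commute.pow_right hx m)).eq
      have e₃ : x₂ * (e * x₂ ^ m) = e * x₂ ^ (m + 1) := by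
        rw [pow_succ', ← mul_assoc, ← mul_assoc, c₂.eq]
      rw [mul_add, mul_add, add_sub_add_comm, e₁, e₂, e₃, pow_succ x₁]
      noncomm_ring

/-- If `m` dots on the left one of two black strands are a boundary, so are `m` dots on the right
one. -/
theorem dots_black_mem (u : List Strand) (m : ℕ) (v : List Strand)
    (h : dots (dgPlain k b Ns) u m (black :: v) ∈ (D).degBoundaries) :
    dots (dgPlain k b Ns) (u ++ [black]) m v ∈ (D).degBoundaries := by
  have L : ∀ g {a : DGAlg k b Ns}, _ → _ := fun g a => dgPlain_mul_mem_degBoundaries N g (a := a)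
  have R : ∀ g {a : DGAlg k b Ns}, _ → _ := fun g a => mul_dgPlain_mem_degBoundaries N g (a := a)
  have hE : u ++ [black] ++ black :: v = u ++ black :: black :: v := by simp
  rw [dots] at h ⊢
  rw [hE]
  have hex₂ := dgPlain_tgt_mul (k := k) (b := b) (Ns := Ns) (dot (u ++ [black]) v)
  have hxe₂ := dgPlain_mul_src (k := k) (b := b) (Ns := Ns) (dot (u ++ [black]) v)
  have hx := dgPlain_interchange (k := k) (b := b) (Ns := Ns) (dot u []) (dot [] v)
  simp only [src, tgt, addLeft, addRight, hE, List.append_nil, List.nil_append] at hex₂ hxe₂ hx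
  have h1 := dgPlain_bb_dot (k := k) (b := b) (Ns := Ns) u v
  have h2 := dgPlain_dot_bb (k := k) (b := b) (Ns := Ns) u v
  have ht := dgPlain_bb_sq (k := k) (b := b) (Ns := Ns) u v
  obtain ⟨H, a1, a2, a3, a4⟩ := exists_divided_difference
    (dgPlain_mul_src (k := k) (b := b) (Ns := Ns) (bb u v)) (dgPlain_tgt_mul (bb u v))
    (dgPlain_idem_mul_self _) (dgPlain_tgt_mul (dot u (black :: v))) hex₂
    (dgPlain_mul_src (dot u (black :: v))) hxe₂ h1 hx m
  -- The crossing of both sides of the boundary `e * x₁ ^ m` is `H * t`.  Commuting it with the dots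
  -- gives `H`, and hence `x₁ * H - x₂ * H = e * x₁ ^ m - e * x₂ ^ m`, as boundaries.
  have b1 : H * dgPlain k b Ns (bb u v) ∈ (D).degBoundaries := by
    have := R (bb u v) (L (bb u v) h)
    change dgPlain k b Ns (bb u v) * (dgPlain k b Ns (idem (src (bb u v))) *
      dgPlain k b Ns (dot u (black :: v)) ^ m) * dgPlain k b Ns (bb u v) ∈ (D).degBoundaries at this
    rwa [a1, add_mul, mul_assoc _ (dgPlain k b Ns (bb u v)), ht, mul_zero, zero_add] at this
  have b2 : H ∈ (D).degBoundaries := by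
    have := sub_mem (L (dot u (black :: v)) b1) (R (dot (u ++ [black]) v) b1)
    rw [← mul_assoc, a2, mul_assoc, mul_assoc, ← mul_sub, h2, add_sub_cancel_left] at this
    rwa [← a3]
  have b3 := sub_mem h (sub_mem (L (dot u (black :: v)) b2) (L (dot (u ++ [black]) v) b2))
  rw [a4] at b3
  exact (congrArg (· ∈ (D).degBoundaries) (sub_sub_cancel _ _)).mp b3

/-- If `m` dots on a black strand to the left of a red strand `n` are a boundary, so are `n + m`
dots on a black strand to the right of it, which are a double crossing around the `m` dots. -/
theorem dots_red_mem (u : List Strand) (m n : ℕ) (v : List Strand)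
    (h : dots (dgPlain k b Ns) u m (red n :: v) ∈ (D).degBoundaries) :
    dots (dgPlain k b Ns) (u ++ [red n]) (n + m) v ∈ (D).degBoundaries := by
  have h' := dgPlain_mul_mem_degBoundaries N (br u n v)
    (mul_dgPlain_mem_degBoundaries N (rb u n v) h)
  have hp : ∀ m : ℕ, dgPlain k b Ns (dot u (red n :: v)) ^ m * dgPlain k b Ns (rb u n v) =
      dgPlain k b Ns (rb u n v) * dgPlain k b Ns (dot (u ++ [red n]) v) ^ m := by
    intro m
    induction m with
    | zero => simp
    | succ m ih =>
      rw [pow_succ', mul_assoc, ih, ← mul_assoc,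
        localHolds_dgPlain (.dot_rb u n v), mul_assoc, ← pow_succ']
  rw [dots, mul_assoc, hp, ← mul_assoc (dgPlain k b Ns (idem _))] at h'
  rw [show dgPlain k b Ns (idem (u ++ black :: red n :: v)) * dgPlain k b Ns (rb u n v) = _ from
    dgPlain_tgt_mul (rb u n v), ← mul_assoc, localHolds_dgPlain (.br_rb u n v), dots, mul_assoc,
    ← pow_add] at h'
  exact h'

/-- Sufficiently many dots on any black strand are a boundary. -/
theorem exists_dots_mem (u v : List Strand) :
    ∃ m, dots (dgPlain k b Ns) u m v ∈ (D).degBoundaries := by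
  induction u using List.reverseRecOn generalizing v with
  | nil => exact ⟨N, dgNail k b Ns v, dgNail_mem_degPart N v, dgD_nail N v⟩
  | append_singleton u c ih =>
    rcases c with _ | n
    · obtain ⟨m, hm⟩ := ih (black :: v)
      exact ⟨m, dots_black_mem N u m v hm⟩
    · obtain ⟨m, hm⟩ := ih (red n :: v)
      exact ⟨n + m, dots_red_mem N u m n v hm⟩

end

end KLRW

/-! ### Vanishing of the homology in nonzero degrees -/

namespace KLRW

open Strand Gen DGGen

section

variable {k : Type*} [CommRing k] {b : ℕ} {Ns : List ℕ} (N : ℕ)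

local notation "D" => dgKLRW k b Ns N

theorem dgE_mem_degPart (l : List Strand) : dgE k b Ns l ∈ (D).degPart 0 :=
  dgPlain_mem_degPart N _

theorem d_dgE (l : List Strand) : (D).d (dgE k b Ns l) = 0 := d_dgPlain N _

theorem dgX_mem_degPart (i : ℕ) : dgX k b Ns i ∈ (D).degPart 0 ∧ (D).d (dgX k b Ns i) = 0 := by
  have h : ∀ l, dotAt k b Ns i l ∈ (D).degPart 0 ∧ (D).d (dotAt k b Ns i l) = 0 := by
    intro l
    rw [dotAt]
    split
    · exact ⟨dgPlain_mem_degPart N _, d_dgPlain N _⟩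
    · exact ⟨zero_mem _, map_zero _⟩
  refine ⟨sum_mem fun l _ => (h l).1, ?_⟩
  rw [dgX, map_sum]
  exact Finset.sum_eq_zero fun l _ => (h l).2

theorem dgT_mem_degPart (i : ℕ) : dgT k b Ns i ∈ (D).degPart 0 := by
  refine sum_mem fun l _ => ?_
  rw [crossAt]
  split
  · rw [dgCross]
    rcases crossGen _ _ _ _ with _ | g
    · exact zero_mem _
    · exact dgPlain_mem_degPart N g
  · exact zero_mem _

theorem dgW_mem_degPart : dgW k b Ns ∈ (D).degPart 1 := by
  refine sum_mem fun l _ => ?_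
  unfold nailAt
  split
  · exact dgNail_mem_degPart N _
  · exact zero_mem _

theorem eval_mem_degPart (w : List Letter) :
    eval (dgT k b Ns) (dgW k b Ns) w ∈ (D).degPart (nails w) := by
  induction w with
  | nil => exact DGAlgebra.one_mem_degPart
  | cons a w ih =>
    rcases a with i | _
    · rw [eval_T_cons, show nails (.T i :: w) = nails w by simp [nails, Letter.nails],
        ← zero_add (nails w : ℤ)]
      exact DGAlgebra.mul_mem_degPart (dgT_mem_degPart N i) ih
    · rw [eval_W_cons, show (nails (.W :: w) : ℤ) = 1 + nails w by simp [nails, Letter.nails]]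
      exact DGAlgebra.mul_mem_degPart (dgW_mem_degPart N) ih

theorem dgC_mem_degPart {a : DGAlg k b Ns} (ha : a ∈ dgC k b Ns) :
    a ∈ (D).degPart 0 ∧ (D).d a = 0 := by
  induction ha using Algebra.adjoin_induction with
  | mem x hx =>
    rcases hx with ⟨i, rfl⟩ | ⟨m, rfl⟩
    · exact dgX_mem_degPart N i
    · exact ⟨dgE_mem_degPart N m, d_dgE N m⟩
  | algebraMap r =>
    rw [Algebra.algebraMap_eq_smul_one]
    exact ⟨Submodule.smul_mem _ _ DGAlgebra.one_mem_degPart, by rw [map_smul, (D).d_one, smul_zero]⟩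
  | add x y _ _ hx hy => exact ⟨add_mem hx.1 hy.1, by rw [map_add, hx.2, hy.2, add_zero]⟩
  | mul x y _ _ hx hy =>
    exact ⟨by simpa using DGAlgebra.mul_mem_degPart hx.1 hy.1,
      (D).cycles.mul_mem hx.2 hy.2⟩

variable {l : List Strand}

variable (k b Ns) in
/-- The span of the basis words with `h` nails. -/
def nailPart (l : List Strand) (h : ℤ) :
    Submodule (MvPolynomial (BlackPos l) k) (Column k b Ns l) :=
  Submodule.span _ (Set.range fun c : {c : LegalCode b Ns l // (nails c.1.word : ℤ) = h} =>
    wordVec k l c.1)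

theorem mul_dgE_mem_degPart {h : ℤ} {a : DGAlg k b Ns} (ha : a ∈ (D).degPart h) :
    a * dgE k b Ns l ∈ (D).degPart h := by
  have := DGAlgebra.mul_mem_degPart ha (dgE_mem_degPart N l)
  rwa [add_zero] at this

theorem d_mul_dgE (a : DGAlg k b Ns) : (D).d (a * dgE k b Ns l) = (D).d a * dgE k b Ns l := by
  rw [(D).leibniz', d_dgE, mul_zero, add_zero]

/-- An element of the column of `l` of homological degree `h` is a combination of words with `h`
nails. -/
theorem mem_nailPart {h : ℤ} {a : DGAlg k b Ns} (ha : a ∈ (D).degPart h) :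
    toColumn l (a * dgE k b Ns l) ∈ nailPart k b Ns l h := by
  have key : ∀ y ∈ Submodule.span (MvPolynomial (BlackPos l) k)
        (Set.range (wordVec k (b := b) (Ns := Ns) l)),
      toColumn l ((D).homProj h ((toColumn l).symm y)) ∈ nailPart k b Ns l h := by
    intro y hy
    induction hy using Submodule.span_induction with
    | mem y hy =>
      obtain ⟨c, rfl⟩ := hy
      rw [wordVec, AddEquiv.symm_apply_apply,
        DGAlgebra.homProj_of_mem (mul_dgE_mem_degPart N (eval_mem_degPart N _))]
      split_ifs with hc
      · exact Submodule.subset_span ⟨⟨c, hc⟩, rfl⟩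
      · rw [map_zero]; exact zero_mem _
    | zero => simp
    | add x y _ _ hx hy => simp only [map_add]; exact add_mem hx hy
    | smul p y _ hy =>
      obtain ⟨a, rfl⟩ := (toColumn l).surjective y
      rw [AddEquiv.symm_apply_apply] at hy
      rw [smul_toColumn, AddEquiv.symm_apply_apply,
        DGAlgebra.homProj_mul _ _ (dgC_mem_degPart N (dgPoly_mem l p)).1, ← smul_toColumn]
      exact Submodule.smul_mem _ p hy
  have h₁ := key _ (mul_dgE_mem_span l a)
  rwa [AddEquiv.symm_apply_apply, DGAlgebra.homProj_of_mem (mul_dgE_mem_degPart N ha),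
    if_pos rfl] at h₁

theorem exists_of_mem_nailPart {h : ℤ} {y : Column k b Ns l} (hy : y ∈ nailPart k b Ns l h) :
    ∃ a ∈ (D).degPart h, a * dgE k b Ns l = a ∧ toColumn l a = y := by
  induction hy using Submodule.span_induction with
  | mem y hy =>
    obtain ⟨⟨c, rfl⟩, rfl⟩ := hy
    exact ⟨_, mul_dgE_mem_degPart N (eval_mem_degPart N c.1.word),
      by rw [mul_assoc, dgE_mul_self], rfl⟩
  | zero => exact ⟨0, zero_mem _, zero_mul _, map_zero _⟩
  | add x y _ _ hx hy =>
    obtain ⟨a, ha, ha', rfl⟩ := hx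
    obtain ⟨a₂, ha₂, ha₂', rfl⟩ := hy
    exact ⟨a + a₂, add_mem ha ha₂, by rw [add_mul, ha', ha₂'], map_add _ _ _⟩
  | smul p y _ hy =>
    obtain ⟨a, ha, ha', rfl⟩ := hy
    refine ⟨a * dgPoly k b Ns l p, ?_, ?_, (smul_toColumn l p a).symm⟩
    · have := DGAlgebra.mul_mem_degPart ha (dgC_mem_degPart N (dgPoly_mem l p)).1
      rwa [add_zero] at this
    · rw [mul_assoc, dgC_comm (dgPoly_mem l p) (dgE_mem l), ← mul_assoc, ha']

/-- The differential, which is linear over the polynomials in the dots as these are cycles. -/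
def columnD (l : List Strand) :
    Column k b Ns l →ₗ[MvPolynomial (BlackPos l) k] Column k b Ns l where
  toFun a := toColumn l ((D).d ((toColumn l).symm a))
  map_add' a a' := by simp
  map_smul' p a := by
    obtain ⟨a, rfl⟩ := (toColumn l).surjective a
    rw [smul_toColumn, AddEquiv.symm_apply_apply, (D).leibniz',
      (dgC_mem_degPart N (dgPoly_mem l p)).2, mul_zero, add_zero, AddEquiv.symm_apply_apply]
    rfl

theorem columnD_toColumn (a : DGAlg k b Ns) :
    columnD N l (toColumn l a) = toColumn l ((D).d a) := rfl

theorem columnD_mem {h : ℤ} {y : Column k b Ns l} (hy : y ∈ nailPart k b Ns l (h + 1)) :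
    columnD N l y ∈ nailPart k b Ns l h := by
  obtain ⟨a, ha, ha', rfl⟩ := exists_of_mem_nailPart N hy
  rw [columnD_toColumn, ← ha', d_mul_dgE]
  exact mem_nailPart N (DGAlgebra.d_mem_degPart ha)

/-- The terms of the column are free, and therefore flat. -/
theorem flat_nailPart (hl : l ∈ seqs b Ns) (h : ℤ) :
    Module.Flat (MvPolynomial (BlackPos l) k) (nailPart k b Ns l h) := by
  have hli := (linearIndependent_wordVec k hl).comp
    (Subtype.val : {c : LegalCode b Ns l // (nails c.1.word : ℤ) = h} → _) Subtype.val_injective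
  have : Module.Free (MvPolynomial (BlackPos l) k) (nailPart k b Ns l h) :=
    Module.Free.of_basis (Module.Basis.span hli)
  infer_instance

theorem nailPart_eq_bot {h : ℤ} (hh : ∀ c : LegalCode b Ns l, (nails c.1.word : ℤ) ≠ h) :
    nailPart k b Ns l h = ⊥ := by
  rw [nailPart, Submodule.span_eq_bot]
  rintro _ ⟨⟨c, hc⟩, rfl⟩
  exact absurd hc (hh c)

theorem nails_le_card [Fintype (BlackPos l)] (c : LegalCode b Ns l) :
    nails c.1.word ≤ Fintype.card (BlackPos l) := by
  obtain ⟨m, hm⟩ := Option.ne_none_iff_exists'.1 c.2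
  refine (nails_le c.1 hm).trans ?_
  rw [← Fintype.card_coe]
  exact Fintype.card_le_of_injective (fun i => ⟨i.1, (Finset.mem_filter.1 i.2).2⟩) fun i j h =>
    Subtype.ext (Subtype.mk.inj h)

theorem dgX_pow_mul_dgE (u v : List Strand) (m : ℕ) :
    dgX k b Ns u.length ^ m * dgE k b Ns (u ++ black :: v) = dots (dgPlain k b Ns) u m v := by
  induction m with
  | zero => simp [dots, dgE]
  | succ m ih =>
    rw [pow_succ', mul_assoc, ih, dots, ← dgE, ← mul_assoc, dgX_mul_dgE, dotAt_black rfl rfl, dots,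
      pow_succ', ← mul_assoc, ← dgE]
    congr 1
    exact (dgPlain_tgt_mul (dot u v)).symm

/-- A power of a dot on a black strand is a boundary. -/
theorem exists_pow_mem (i : BlackPos l) :
    ∃ m, dgX k b Ns i ^ m * dgE k b Ns l ∈ (D).degBoundaries := by
  obtain ⟨i, hi⟩ := i
  obtain ⟨h, hi⟩ := List.getElem?_eq_some_iff.1 hi
  obtain ⟨u, c, v, rfl, rfl⟩ := exists_split h
  obtain rfl : c = black := by simpa using hi
  obtain ⟨m, hm⟩ := exists_dots_mem (k := k) (b := b) (Ns := Ns) N u v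
  exact ⟨m, by rwa [dgX_pow_mul_dgE]⟩

/-- The column of `l` is exact in positive degrees: there are as many dots as black strands, and no
word has more nails. -/
theorem column_exact (hl : l ∈ seqs b Ns) {i : ℤ} (hi : 0 < i + 1) {z : Column k b Ns l}
    (hz : z ∈ nailPart k b Ns l (i + 1)) (hd : columnD N l z = 0) :
    ∃ y, columnD N l y = z := by
  classical
  have := Fintype.ofFinite (BlackPos l)
  let rs : List (MvPolynomial (BlackPos l) k) :=
    (Finset.univ : Finset (BlackPos l)).toList.map MvPolynomial.X
  have hrs : rs.length = Fintype.card (BlackPos l) := by simp [rs]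
  obtain ⟨y, hy⟩ := exact_of_isWeaklyRegular_of_nilpotent rs (fun i => nailPart k b Ns l i)
    (fun i => (columnD N l).restrict fun _ => columnD_mem N)
    (fun i x => Subtype.ext ((D).d_d ((toColumn l).symm x.1))) 0
    (fun i hi => by
      rw [hrs, zero_add] at hi
      have : nailPart k b Ns l i = ⊥ := nailPart_eq_bot fun c => by
        have := nails_le_card c
        omega
      rw [this]
      infer_instance)
    (fun i => by
      have := flat_nailPart (k := k) hl i
      exact (MvPolynomial.isWeaklyRegular_map_X _ (Finset.nodup_toList _)).of_flat_module)
    (fun r hr i z hz => by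
      obtain ⟨j, -, rfl⟩ := List.mem_map.1 hr
      obtain ⟨m, hm⟩ := exists_pow_mem (k := k) (b := b) (Ns := Ns) N j
      obtain ⟨z, hz'⟩ := z
      obtain ⟨a, ha, ha', rfl⟩ := exists_of_mem_nailPart N hz'
      obtain ⟨y, hy, e⟩ := DGAlgebra.exists_d_eq_mul ha (congrArg Subtype.val hz) hm
      refine ⟨m, ⟨_, mem_nailPart N hy⟩, Subtype.ext ?_⟩
      change _ • toColumn l a = columnD N l (toColumn l (y * dgE k b Ns l))
      have c := dgC_comm (pow_mem (dgX_mem (k := k) (b := b) (Ns := Ns) j) m) (dgE_mem l)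
      rw [columnD_toColumn, d_mul_dgE, e, smul_toColumn, map_pow, dgPoly_X, c, ← mul_assoc a, ha',
        mul_assoc, c, ← mul_assoc, ha'])
    i hi ⟨z, hz⟩ (Subtype.ext hd)
  exact ⟨y.1, (congrArg Subtype.val hy).symm⟩

/-- The homology is concentrated in homological degree zero. -/
theorem dg_exact {h : ℤ} (hh : h ≠ 0) {a : DGAlg k b Ns} (ha : a ∈ (D).degPart h)
    (hd : (D).d a = 0) : ∃ y, (D).d y = a := by
  have key : ∀ l, ∃ y, l ∈ seqs b Ns → (D).d y = a * dgE k b Ns l := by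
    intro l
    by_cases hl : l ∈ seqs b Ns
    swap
    · exact ⟨0, fun h => absurd h hl⟩
    have hm := mem_nailPart (l := l) N ha
    rcases lt_or_gt_of_ne hh with hh | hh
    · -- no word has a negative number of nails
      have hbot : nailPart k b Ns l h = ⊥ := nailPart_eq_bot fun c => by omega
      rw [hbot] at hm
      exact ⟨0, fun _ => (map_zero _).trans hm.symm⟩
    · obtain ⟨i, rfl⟩ : ∃ i, h = i + 1 := ⟨h - 1, by ring⟩
      obtain ⟨y, hy⟩ := column_exact N hl hh hm (by
        rw [columnD_toColumn, d_mul_dgE, hd, zero_mul, map_zero])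
      exact ⟨y, fun _ => hy⟩
  choose y hy using key
  refine ⟨∑ l ∈ seqs b Ns, y l, ?_⟩
  rw [map_sum, Finset.sum_congr rfl hy]
  exact (mul_dgE_eq_sum a).symm

end

end KLRW

/-! ### Adding and removing a red strand on the left -/

namespace KLRW

open Strand Gen DGGen

section AddStrand

variable {A : Type*} [Ring A] {b N : ℕ} {Ns : List ℕ}

theorem isSeq_red_cons (l : List Strand) :
    IsSeq b (N :: Ns) (red N :: l) ↔ IsSeq b Ns l := by
  simp [IsSeq, Strand.label?]

theorem sum_seqs_cons (f : List Strand → A) (hf : ∀ v, f (black :: v) = 0) :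
    ∑ l ∈ seqs b (N :: Ns), f l = ∑ l ∈ seqs b Ns, f (red N :: l) := by
  cases b with
  | zero =>
    rw [seqs, Finset.sum_image (by simp)]
  | succ b =>
    rw [seqs, Finset.sum_union, Finset.sum_image (by simp), Finset.sum_image (by simp),
      Finset.sum_eq_zero fun l _ => hf l, zero_add]
    rw [Finset.disjoint_left]
    simp

/-- The local relations survive the addition of a red strand on the left of everything, if the
diagrams with a black strand on the left of this red strand vanish. -/
theorem LocalHolds.addLeft {x : Gen → A} (hx : LocalHolds b (N :: Ns) x)
    (hv : ∀ v, x (idem (black :: v)) = 0) :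
    LocalHolds b Ns fun g => x (g.addLeft [red N]) := by
  have ht : ∀ g : Gen, (g.addLeft [red N]).tgt = red N :: g.tgt := by
    intro g; cases g <;> rfl
  have hs : ∀ g : Gen, (g.addLeft [red N]).src = red N :: g.src := by
    intro g; cases g <;> rfl
  have hR : ∀ (g : Gen) w, (g.addRight w).addLeft [red N] = (g.addLeft [red N]).addRight w := by
    intro g w; cases g <;> rfl
  have hL : ∀ (g : Gen) w, (g.addLeft w).addLeft [red N] = g.addLeft (red N :: w) := by
    intro g w; cases g <;> rfl
  intro y z h
  cases h with
  | idem_mul_self l => exact hx (.idem_mul_self (red N :: l))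
  | idem_mul_ne l m hlm => exact hx (.idem_mul_ne (red N :: l) (red N :: m) (by simpa using hlm))
  | tgt_mul g =>
    exact (congrArg (fun l => x (idem l) * _) (ht g)).symm.trans (hx (.tgt_mul (g.addLeft [red N])))
  | mul_src g =>
    exact (congrArg (fun l => _ * x (idem l)) (hs g)).symm.trans (hx (.mul_src (g.addLeft [red N])))
  | one => exact (sum_seqs_cons _ hv).symm.trans (hx .one)
  | not_seq l hl => exact hx (.not_seq (red N :: l) (by rwa [isSeq_red_cons]))
  | interchange g h =>
    have := hx (.interchange (g.addLeft [red N]) h)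
    rwa [ht, hs, ← hR g, ← hR g, ← hL h, ← hL h] at this
  | bb_sq u v => exact hx (.bb_sq (red N :: u) v)
  | braid u v => exact hx (.braid (red N :: u) v)
  | bb_dot u v => exact hx (.bb_dot (red N :: u) v)
  | dot_bb u v => exact hx (.dot_bb (red N :: u) v)
  | dot_rb u n v => exact hx (.dot_rb (red N :: u) n v)
  | br_dot u n v => exact hx (.br_dot (red N :: u) n v)
  | br_rb u n v => exact hx (.br_rb (red N :: u) n v)
  | rb_br u n v => exact hx (.rb_br (red N :: u) n v)
  | bb_rb_rb u n v => exact hx (.bb_rb_rb (red N :: u) n v)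
  | br_br_bb u n v => exact hx (.br_br_bb (red N :: u) n v)
  | rb_bb_br u n v => exact hx (.rb_bb_br (red N :: u) n v)

/-- The values on the elementary diagrams `g` with a red strand `N` added on the left of
everything are those of `y` on `g`; the other diagrams are sent to zero. -/
def removeLeft (N : ℕ) (y : Gen → A) : Gen → A
  | idem (red n :: l) => if n = N then y (idem l) else 0
  | dot (red n :: u) v => if n = N then y (dot u v) else 0
  | bb (red n :: u) v => if n = N then y (bb u v) else 0
  | br (red n :: u) m v => if n = N then y (br u m v) else 0
  | rb (red n :: u) m v => if n = N then y (rb u m v) else 0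
  | _ => 0

theorem removeLeft_addLeft (y : Gen → A) (g : Gen) :
    removeLeft N y (g.addLeft [red N]) = y g := by
  cases g <;> simp [removeLeft, Gen.addLeft]

/-- An elementary diagram either has a straight red strand `N` on the left of everything, or its
top or its bottom does not begin with a red strand `N`. -/
theorem addLeft_or (N : ℕ) (g : Gen) : (∃ g', g = Gen.addLeft [red N] g') ∨
    (∀ (y : Gen → A) w, g ≠ idem [] → removeLeft N y (g.addRight w) = 0) ∧
      ((∀ l, g.src ≠ red N :: l) ∨ ∀ l, g.tgt ≠ red N :: l) := by
  cases g with
  | idem l =>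
    rcases l with _ | ⟨_ | n, l⟩
    · exact .inr ⟨by simp, .inl (by simp [src])⟩
    · exact .inr ⟨by simp [removeLeft, addRight], .inl (by simp [src])⟩
    · by_cases h : n = N
      · exact .inl ⟨idem l, by simp [Gen.addLeft, h]⟩
      · exact .inr ⟨by simp [removeLeft, addRight, h], .inl (by simp [src, h])⟩
  | dot l v =>
    rcases l with _ | ⟨_ | n, l⟩
    · exact .inr ⟨by simp [removeLeft, addRight], .inl (by simp [src])⟩
    · exact .inr ⟨by simp [removeLeft, addRight], .inl (by simp [src])⟩
    · by_cases h : n = N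
      · exact .inl ⟨dot l v, by simp [Gen.addLeft, h]⟩
      · exact .inr ⟨by simp [removeLeft, addRight, h], .inl (by simp [src, h])⟩
  | bb l v =>
    rcases l with _ | ⟨_ | n, l⟩
    · exact .inr ⟨by simp [removeLeft, addRight], .inl (by simp [src])⟩
    · exact .inr ⟨by simp [removeLeft, addRight], .inl (by simp [src])⟩
    · by_cases h : n = N
      · exact .inl ⟨bb l v, by simp [Gen.addLeft, h]⟩
      · exact .inr ⟨by simp [removeLeft, addRight, h], .inl (by simp [src, h])⟩
  | br l m v =>
    rcases l with _ | ⟨_ | n, l⟩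
    · exact .inr ⟨by simp [removeLeft, addRight], .inl (by simp [src])⟩
    · exact .inr ⟨by simp [removeLeft, addRight], .inl (by simp [src])⟩
    · by_cases h : n = N
      · exact .inl ⟨br l m v, by simp [Gen.addLeft, h]⟩
      · exact .inr ⟨by simp [removeLeft, addRight, h], .inl (by simp [src, h])⟩
  | rb l m v =>
    rcases l with _ | ⟨_ | n, l⟩
    · exact .inr ⟨by simp [removeLeft, addRight], .inr (by simp [tgt])⟩
    · exact .inr ⟨by simp [removeLeft, addRight], .inr (by simp [tgt])⟩
    · by_cases h : n = N
      · exact .inl ⟨rb l m v, by simp [Gen.addLeft, h]⟩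
      · exact .inr ⟨by simp [removeLeft, addRight, h], .inl (by simp [src, h])⟩

theorem addRight_nil (g : Gen) : g.addRight [] = g := by
  cases g <;> simp [addRight]

/-- The local relations survive the removal of a red strand `N` on the left of everything, if `N`
dots on the leftmost strand vanish: these dots are the double crossing of the leftmost black strand
with the red strand. -/
theorem LocalHolds.removeLeft {y : Gen → A} (hy : LocalHolds b Ns y)
    (h0 : ∀ v, dots y [] N v = 0) : LocalHolds b (N :: Ns) (removeLeft N y) := by
  have ht : ∀ g : Gen, KLRW.removeLeft N y (idem g.tgt) * KLRW.removeLeft N y g =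
      KLRW.removeLeft N y g := by
    intro g
    rcases addLeft_or (A := A) N g with ⟨g, rfl⟩ | ⟨hg, -⟩
    · have e : (g.addLeft [red N]).tgt = red N :: g.tgt := by cases g <;> rfl
      have e' : KLRW.removeLeft N y (idem (red N :: g.tgt)) = y (idem g.tgt) :=
        removeLeft_addLeft y (idem g.tgt)
      rw [e, e', removeLeft_addLeft]
      exact hy (.tgt_mul g)
    · by_cases hg' : g = idem []
      · rw [hg']; exact mul_zero _
      · have := hg y [] hg'
        rw [addRight_nil] at this
        rw [this, mul_zero]
  have hs : ∀ g : Gen, KLRW.removeLeft N y g * KLRW.removeLeft N y (idem g.src) =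
      KLRW.removeLeft N y g := by
    intro g
    rcases addLeft_or (A := A) N g with ⟨g, rfl⟩ | ⟨hg, -⟩
    · have e : (g.addLeft [red N]).src = red N :: g.src := by cases g <;> rfl
      have e' : KLRW.removeLeft N y (idem (red N :: g.src)) = y (idem g.src) :=
        removeLeft_addLeft y (idem g.src)
      rw [e, e', removeLeft_addLeft]
      exact hy (.mul_src g)
    · by_cases hg' : g = idem []
      · rw [hg']; exact mul_zero _
      · have := hg y [] hg'
        rw [addRight_nil] at this
        rw [this, zero_mul]
  intro _ _ h
  cases h with
  | idem_mul_self l => exact ht (idem l)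
  | idem_mul_ne l m hlm =>
    rcases l with _ | ⟨_ | n, l⟩ <;> rcases m with _ | ⟨_ | n', m⟩ <;> simp [KLRW.removeLeft]
    rintro rfl rfl
    exact hy (.idem_mul_ne l m (by simpa using hlm))
  | tgt_mul g => exact ht g
  | mul_src g => exact hs g
  | one =>
    rw [sum_seqs_cons _ fun _ => rfl]
    simpa [KLRW.removeLeft] using hy .one
  | not_seq l hl =>
    rcases l with _ | ⟨_ | n, l⟩
    · rfl
    · rfl
    · by_cases h : n = N
      · subst h
        rw [isSeq_red_cons] at hl
        simpa [KLRW.removeLeft] using hy (.not_seq l hl)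
      · simp [KLRW.removeLeft, h]
  | interchange g h =>
    rcases addLeft_or (A := A) N g with ⟨g, rfl⟩ | ⟨hg, -⟩
    · have e₁ : (g.addLeft [red N]).src = red N :: g.src := by cases g <;> rfl
      have e₂ : (g.addLeft [red N]).tgt = red N :: g.tgt := by cases g <;> rfl
      have e₃ : ∀ w, (g.addLeft [red N]).addRight w = (g.addRight w).addLeft [red N] := by
        intro w; cases g <;> rfl
      have e₄ : ∀ w, h.addLeft (red N :: w) = (h.addLeft w).addLeft [red N] := by
        intro w; cases h <;> rfl
      rw [e₁, e₂, e₃, e₃, e₄, e₄]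
      simp only [removeLeft_addLeft]
      exact hy (.interchange g h)
    · by_cases hg' : g = idem []
      · subst hg'
        have e : h.addLeft [] = h := by cases h <;> rfl
        change KLRW.removeLeft N y (idem ([] ++ h.tgt)) * KLRW.removeLeft N y (h.addLeft []) =
          KLRW.removeLeft N y (h.addLeft []) * KLRW.removeLeft N y (idem ([] ++ h.src))
        rw [e, List.nil_append, List.nil_append, ht, hs]
      · rw [hg y _ hg', hg y _ hg', zero_mul, mul_zero]
  | bb_sq u v =>
    rcases u with _ | ⟨_ | m, u⟩
    · simp [KLRW.removeLeft]
    · simp [KLRW.removeLeft]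
    · by_cases h : m = N
      · simpa [KLRW.removeLeft, h] using hy (.bb_sq u v)
      · simp [KLRW.removeLeft, h]
  | braid u v =>
    rcases u with _ | ⟨_ | m, u⟩
    · simp [KLRW.removeLeft]
    · simp [KLRW.removeLeft]
    · by_cases h : m = N
      · simpa [KLRW.removeLeft, h] using hy (.braid u v)
      · simp [KLRW.removeLeft, h]
  | bb_dot u v =>
    rcases u with _ | ⟨_ | m, u⟩
    · simp [KLRW.removeLeft]
    · simp [KLRW.removeLeft]
    · by_cases h : m = N
      · simpa [KLRW.removeLeft, h] using hy (.bb_dot u v)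
      · simp [KLRW.removeLeft, h]
  | dot_bb u v =>
    rcases u with _ | ⟨_ | m, u⟩
    · simp [KLRW.removeLeft]
    · simp [KLRW.removeLeft]
    · by_cases h : m = N
      · simpa [KLRW.removeLeft, h] using hy (.dot_bb u v)
      · simp [KLRW.removeLeft, h]
  | dot_rb u n v =>
    rcases u with _ | ⟨_ | m, u⟩
    · simp [KLRW.removeLeft]
    · simp [KLRW.removeLeft]
    · by_cases h : m = N
      · simpa [KLRW.removeLeft, h] using hy (.dot_rb u n v)
      · simp [KLRW.removeLeft, h]
  | br_dot u n v =>
    rcases u with _ | ⟨_ | m, u⟩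
    · simp [KLRW.removeLeft]
    · simp [KLRW.removeLeft]
    · by_cases h : m = N
      · simpa [KLRW.removeLeft, h] using hy (.br_dot u n v)
      · simp [KLRW.removeLeft, h]
  | br_rb u n v => 
    rcases u with _ | ⟨_ | m, u⟩
    · by_cases h : n = N
      · subst h; simpa [KLRW.removeLeft, dots] using (h0 v).symm
      · simp [KLRW.removeLeft, h, dots]
    · simp [KLRW.removeLeft, dots]
    · by_cases h : m = N
      · simpa [KLRW.removeLeft, h, dots] using hy (.br_rb u n v)
      · simp [KLRW.removeLeft, h, dots]
  | rb_br u n v =>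
    rcases u with _ | ⟨_ | m, u⟩
    · simp [KLRW.removeLeft, dots]
    · simp [KLRW.removeLeft, dots]
    · by_cases h : m = N
      · simpa [KLRW.removeLeft, h, dots] using hy (.rb_br u n v)
      · simp [KLRW.removeLeft, h, dots]
  | bb_rb_rb u n v =>
    rcases u with _ | ⟨_ | m, u⟩
    · simp [KLRW.removeLeft]
    · simp [KLRW.removeLeft]
    · by_cases h : m = N
      · simpa [KLRW.removeLeft, h] using hy (.bb_rb_rb u n v)
      · simp [KLRW.removeLeft, h]
  | br_br_bb u n v =>
    rcases u with _ | ⟨_ | m, u⟩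
    · simp [KLRW.removeLeft]
    · simp [KLRW.removeLeft]
    · by_cases h : m = N
      · simpa [KLRW.removeLeft, h] using hy (.br_br_bb u n v)
      · simp [KLRW.removeLeft, h]
  | rb_bb_br u n v =>
    rcases u with _ | ⟨_ | m, u⟩
    · simp [KLRW.removeLeft, dots]
    · simp [KLRW.removeLeft, dots]
    · by_cases h : m = N
      · simpa [KLRW.removeLeft, h, dots] using hy (.rb_bb_br u n v)
      · simp [KLRW.removeLeft, h, dots]

end AddStrand

end KLRW

/-! ### Comparison of the homology with the KLRW algebra -/

/-- A map of dg-algebras to the homology that sends each cycle to its class is a quasi-isomorphism.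
-/
theorem DGAlgebra.isQuasiIso_of_cycle {k A : Type*} [CommRing k] [Ring A] [Algebra k A]
    {D : DGAlgebra k A} (f : Hom D D.homologyDG)
    (hf : ∀ z : D.cycles, f.toAlgHom (z : A) = Ideal.Quotient.mk _ z) : f.IsQuasiIso := by
  constructor
  · intro x y hxy
    obtain ⟨z, rfl⟩ := Ideal.Quotient.mk_surjective x
    obtain ⟨w, rfl⟩ := Ideal.Quotient.mk_surjective y
    have h : Ideal.Quotient.mk D.homologyDG.boundaries (f.cyclesMap z) =
      Ideal.Quotient.mk D.homologyDG.boundaries (f.cyclesMap w) := hxy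
    obtain ⟨u, hu⟩ := (mem_boundaries _).1 (Ideal.Quotient.eq.1 h)
    have h' : (0 : D.Homology) = f.toAlgHom (z : A) - f.toAlgHom (w : A) := hu
    rw [hf, hf] at h'
    exact sub_eq_zero.1 h'.symm
  · intro x
    obtain ⟨⟨y, hy⟩, rfl⟩ := Ideal.Quotient.mk_surjective x
    obtain ⟨z, rfl⟩ := Ideal.Quotient.mk_surjective y
    exact ⟨Ideal.Quotient.mk _ z, congrArg (Ideal.Quotient.mk _) (Subtype.ext (hf z))⟩

namespace KLRW

open Strand Gen DGGen

section Comparison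

variable {k : Type*} [CommRing k] {b N : ℕ} {Ns : List ℕ}

theorem localHolds_gen : LocalHolds b Ns (Pres.gen (Rel k b Ns)) := by
  intro y z h
  obtain ⟨y', z', h', rfl, rfl⟩ := LocalRel.exists_of_map
    (Pres.mk (Rel k b Ns) : FreeAlgebra k Gen →+* Alg k b Ns) (x := FreeAlgebra.ι k) h
  exact Pres.mk_rel (Rel.loc h')

theorem gen_violating (v : List Strand) : Pres.gen (Rel k b Ns) (idem (black :: v)) = 0 :=
  (Pres.mk_rel (Rel.violating v)).trans (map_zero _)

theorem gen_of_src {g : Gen} (h : Pres.gen (Rel k b Ns) (idem g.src) = 0) :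
    Pres.gen (Rel k b Ns) g = 0 := by
  rw [← localHolds_gen (.mul_src g), h, mul_zero]

theorem gen_of_tgt {g : Gen} (h : Pres.gen (Rel k b Ns) (idem g.tgt) = 0) :
    Pres.gen (Rel k b Ns) g = 0 := by
  rw [← localHolds_gen (.tgt_mul g), h, zero_mul]

theorem gen_idem_of_ne {l : List Strand} (h : ∀ m, l ≠ red N :: m) :
    Pres.gen (Rel k b (N :: Ns)) (idem l) = 0 := by
  rcases l with _ | ⟨_ | n, l⟩
  · exact localHolds_gen (.not_seq _ (by simp [IsSeq]))
  · exact gen_violating l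
  · refine localHolds_gen (.not_seq _ fun hl => ?_)
    have := hl.2
    simp [Strand.label?] at this
    exact h l (by rw [this.1])

theorem localHolds_addLeft :
    LocalHolds b Ns fun g => Pres.gen (Rel k b (N :: Ns)) (g.addLeft [red N]) :=
  localHolds_gen.addLeft gen_violating

/-- In the KLRW algebra, `N` dots on the black strand next to the leftmost red strand `N` are a
double crossing of these strands, whose middle has a black strand on the left of all red strands. -/
theorem gen_dots_addLeft (v : List Strand) :
    dots (fun g => Pres.gen (Rel k b (N :: Ns)) (g.addLeft [red N])) [] N v = 0 := by
  have h : dots (Pres.gen (Rel k b (N :: Ns))) [red N] N v = 0 := by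
    refine (localHolds_gen (.br_rb [] N v)).symm.trans ?_
    rw [gen_of_tgt (g := rb [] N v) (gen_violating _), mul_zero]
  exact h

variable (k b N Ns)

/-- The map to the KLRW algebra that replaces the blue strand by a red strand labeled `N`, and is
zero on the nails. -/
def toAlg : DGAlg k b Ns →ₐ[k] Alg k b (N :: Ns) :=
  Pres.lift (FreeAlgebra.lift k fun
    | plain g => Pres.gen (Rel k b (N :: Ns)) (g.addLeft [red N])
    | nail _ => 0) (by
    intro y z h
    cases h with
    | loc h =>
      have h' := LocalRel.map (FreeAlgebra.lift k (A := Alg k b (N :: Ns)) fun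
        | plain g => Pres.gen (Rel k b (N :: Ns)) (g.addLeft [red N])
        | nail _ => 0).toRingHom h
      simp only [AlgHom.toRingHom_eq_coe, RingHom.coe_coe, FreeAlgebra.lift_ι_apply] at h'
      exact localHolds_addLeft h'
    | _ => simp)

theorem toAlg_dgPlain (g : Gen) :
    toAlg k b N Ns (dgPlain k b Ns g) = Pres.gen (Rel k b (N :: Ns)) (g.addLeft [red N]) := by
  rw [toAlg, dgPlain, Pres.lift_gen, FreeAlgebra.lift_ι_apply]

theorem toAlg_dgNail (v : List Strand) : toAlg k b N Ns (dgNail k b Ns v) = 0 := by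
  rw [toAlg, dgNail, Pres.lift_gen, FreeAlgebra.lift_ι_apply]

variable {k b N Ns}

/-- The added red strand is not crossed, so it does not change the degree of a diagram, and nails
are sent to zero. -/
theorem toAlg_mem {i : ℤ × ℤ} {a : DGAlg k b Ns} (ha : a ∈ dgGr k b Ns N i) :
    toAlg k b N Ns a ∈ gr k b (N :: Ns) i := by
  have hw : ∀ l : List DGGen, toAlg k b N Ns (l.map (Pres.gen (DGRel k b Ns))).prod ∈
      gr k b (N :: Ns) (l.map (DGGen.deg N)).sum := by
    intro l
    induction l with
    | nil =>
      rw [List.map_nil, List.map_nil, List.prod_nil, map_one]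
      exact SetLike.GradedOne.one_mem
    | cons g l ih =>
      rw [List.map_cons, List.map_cons, List.prod_cons, map_mul, List.sum_cons]
      refine SetLike.GradedMul.mul_mem ?_ ih
      cases g with
      | plain g =>
        have e : DGGen.deg N (plain g) = deg (g.addLeft [red N]) := by
          cases g <;> simp [DGGen.deg, deg, degH, degQL, Gen.addLeft, degQ]
        rw [e]
        exact (toAlg_dgPlain k b N Ns g).symm ▸ gen_mem_wordGr _ _ _
      | nail v => exact (toAlg_dgNail k b N Ns v).symm ▸ zero_mem _
  induction ha using Submodule.span_induction with
  | mem a ha =>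
    obtain ⟨l, rfl, rfl⟩ := ha
    exact hw l
  | zero => rw [map_zero]; exact zero_mem _
  | add x y _ _ hx hy => rw [map_add]; exact add_mem hx hy
  | smul c x _ hx => rw [map_smul]; exact Submodule.smul_mem _ c hx

/-- Boundaries vanish in the KLRW algebra. -/
theorem toAlg_d (a : DGAlg k b Ns) : toAlg k b N Ns ((dgKLRW k b Ns N).d a) = 0 := by
  have hg : ∀ g, toAlg k b N Ns ((dgKLRW k b Ns N).d (Pres.gen (DGRel k b Ns) g)) = 0 := by
    intro g
    cases g with
    | plain g => exact (congrArg _ (dgD_plain N g)).trans (map_zero _)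
    | nail v =>
      refine (congrArg _ (dgD_nail N v)).trans ?_
      have := gen_dots_addLeft (k := k) (b := b) (N := N) (Ns := Ns) v
      simpa only [dots, map_mul, map_pow, toAlg_dgPlain] using this
  have hm : ∀ x y, toAlg k b N Ns ((dgKLRW k b Ns N).d x) = 0 →
      toAlg k b N Ns ((dgKLRW k b Ns N).d y) = 0 →
      toAlg k b N Ns ((dgKLRW k b Ns N).d (x * y)) = 0 := by
    intro x y hx hy
    rw [DGAlgebra.leibniz', map_add, map_mul, map_mul, hx, hy, zero_mul, mul_zero, add_zero]
  have ha : a ∈ Algebra.adjoin k (Set.range (Pres.gen (DGRel k b Ns))) := by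
    rw [Pres.adjoin_range_gen]; trivial
  induction ha using Algebra.adjoin_induction with
  | mem x hx => obtain ⟨g, rfl⟩ := hx; exact hg g
  | algebraMap r =>
    rw [Algebra.algebraMap_eq_smul_one, map_smul, DGAlgebra.d_one, smul_zero, map_zero]
  | add x y _ _ hx hy => rw [map_add, map_add, hx, hy, add_zero]
  | mul x y _ _ hx hy => exact hm x y hx hy

variable (k b N Ns) in
/-- The map from the homology to the KLRW algebra. -/
def homologyToAlg : (dgKLRW k b Ns N).Homology →ₐ[k] Alg k b (N :: Ns) :=
  Ideal.Quotient.liftₐ _ ((toAlg k b N Ns).comp (dgKLRW k b Ns N).cycles.val) (by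
    rintro ⟨_, h⟩ ⟨a, rfl⟩
    exact toAlg_d a)

theorem homologyToAlg_mk (z : (dgKLRW k b Ns N).cycles) :
    homologyToAlg k b N Ns (Ideal.Quotient.mk _ z) = toAlg k b N Ns z := rfl

variable (k b N Ns) in
/-- The homology class of an elementary diagram without nails. -/
def homologyGen (g : Gen) : (dgKLRW k b Ns N).Homology :=
  Ideal.Quotient.mk _ ⟨dgPlain k b Ns g, d_dgPlain N g⟩

theorem localHolds_cycles : LocalHolds b Ns fun g =>
    (⟨dgPlain k b Ns g, d_dgPlain N g⟩ : (dgKLRW k b Ns N).cycles) := by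
  intro y z h
  exact Subtype.ext (localHolds_dgPlain
    (LocalRel.map ((dgKLRW k b Ns N).cycles.val : (dgKLRW k b Ns N).cycles →+* DGAlg k b Ns) h))

theorem localHolds_homologyGen : LocalHolds b Ns (homologyGen k b N Ns) := by
  intro y z h
  obtain ⟨y', z', h', rfl, rfl⟩ := LocalRel.exists_of_map
    (Ideal.Quotient.mk (dgKLRW k b Ns N).boundaries) h
  rw [localHolds_cycles h']

/-- In the homology, `N` dots on the leftmost strand vanish, as they are the boundary of a nail. -/
theorem dots_homologyGen (v : List Strand) : dots (homologyGen k b N Ns) [] N v = 0 := by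
  have e : dots (homologyGen k b N Ns) [] N v = Ideal.Quotient.mk _
      (dots (fun g => (⟨dgPlain k b Ns g, d_dgPlain N g⟩ : (dgKLRW k b Ns N).cycles)) [] N v) := by
    simp only [dots, map_mul, map_pow]
    rfl
  rw [e, Ideal.Quotient.eq_zero_iff_mem]
  exact ⟨dgNail k b Ns v, (dgD_nail N v).trans (by simp [dots])⟩

variable (k b N Ns) in
/-- The map from the KLRW algebra to the homology that replaces the leftmost red strand by the blue
strand. -/
def algToHomology : Alg k b (N :: Ns) →ₐ[k] (dgKLRW k b Ns N).Homology :=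
  Pres.lift (FreeAlgebra.lift k (removeLeft N (homologyGen k b N Ns))) (by
    intro y z h
    cases h with
    | loc h =>
      have h' := LocalRel.map (FreeAlgebra.lift k (removeLeft N (homologyGen k b N Ns))).toRingHom h
      simp only [AlgHom.toRingHom_eq_coe, RingHom.coe_coe, FreeAlgebra.lift_ι_apply] at h'
      exact localHolds_homologyGen.removeLeft dots_homologyGen h'
    | violating v => rw [FreeAlgebra.lift_ι_apply, map_zero]; rfl)

theorem algToHomology_gen (g : Gen) : algToHomology k b N Ns (Pres.gen _ g) =
    removeLeft N (homologyGen k b N Ns) g := by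
  rw [algToHomology, Pres.lift_gen, FreeAlgebra.lift_ι_apply]

theorem algToHomology_mem {i : ℤ × ℤ} {a : Alg k b (N :: Ns)} (ha : a ∈ gr k b (N :: Ns) i) :
    algToHomology k b N Ns a ∈ (dgKLRW k b Ns N).homologyGr i := by
  have hw : ∀ l : List Gen, algToHomology k b N Ns (l.map (Pres.gen (Rel k b (N :: Ns)))).prod ∈
      (dgKLRW k b Ns N).homologyGr (l.map deg).sum := by
    intro l
    induction l with
    | nil =>
      rw [List.map_nil, List.map_nil, List.prod_nil, map_one]
      exact SetLike.GradedOne.one_mem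
    | cons g l ih =>
      rw [List.map_cons, List.map_cons, List.prod_cons, map_mul, List.sum_cons, algToHomology_gen]
      refine SetLike.GradedMul.mul_mem ?_ ih
      rcases addLeft_or (A := (dgKLRW k b Ns N).Homology) N g with ⟨g, rfl⟩ | ⟨hg, -⟩
      · rw [removeLeft_addLeft]
        have e : deg (g.addLeft [red N]) = deg g := by cases g <;> rfl
        exact (DGAlgebra.mem_homologyGr _).2 ⟨_, e ▸ dgPlain_mem N g, rfl⟩
      · by_cases hg' : g = idem []
        · rw [hg']; exact zero_mem _
        · have := hg (homologyGen k b N Ns) [] hg'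
          rw [addRight_nil] at this
          rw [this]; exact zero_mem _
  induction ha using Submodule.span_induction with
  | mem a ha =>
    obtain ⟨l, rfl, rfl⟩ := ha
    exact hw l
  | zero => rw [map_zero]; exact zero_mem _
  | add x y _ _ hx hy => rw [map_add]; exact add_mem hx hy
  | smul c x _ hx => rw [map_smul]; exact Submodule.smul_mem _ c hx

/-- It suffices to compare generators; those in which the leftmost red strand `N` is not straight
are zero in the KLRW algebra. -/
theorem homologyToAlg_algToHomology (a : Alg k b (N :: Ns)) :
    homologyToAlg k b N Ns (algToHomology k b N Ns a) = a := by
  have h : (homologyToAlg k b N Ns).comp (algToHomology k b N Ns) = AlgHom.id k _ := by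
    apply Pres.hom_ext
    intro g
    rw [AlgHom.comp_apply, AlgHom.id_apply, algToHomology_gen]
    rcases addLeft_or (A := (dgKLRW k b Ns N).Homology) N g with ⟨g, rfl⟩ | ⟨hg, hg₂⟩
    · rw [removeLeft_addLeft, homologyGen, homologyToAlg_mk, toAlg_dgPlain]
    · have h0 : Pres.gen (Rel k b (N :: Ns)) g = 0 := by
        rcases hg₂ with h | h
        · exact gen_of_src (gen_idem_of_ne h)
        · exact gen_of_tgt (gen_idem_of_ne h)
      rw [h0]
      by_cases hg' : g = idem []
      · rw [hg']; exact map_zero _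
      · have := hg (homologyGen k b N Ns) [] hg'
        rw [addRight_nil] at this
        rw [this, map_zero]
  exact DFunLike.congr_fun h a

/-- The elements of homological degree zero are combinations of diagrams without nails, so they are
cycles whose classes come from the KLRW algebra. -/
theorem exists_of_mem_gr_zero {q : ℤ} {a : DGAlg k b Ns} (ha : a ∈ dgGr k b Ns N (0, q)) :
    ∃ z : (dgKLRW k b Ns N).cycles, z = a ∧
      Ideal.Quotient.mk _ z ∈ (algToHomology k b N Ns).range := by
  have hdeg : ∀ l : List DGGen, 0 ≤ (l.map (DGGen.deg N)).sum.1 := by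
    intro l
    induction l with
    | nil => simp
    | cons g l ih =>
      rw [List.map_cons, List.sum_cons, Prod.fst_add]
      cases g <;> simp only [DGGen.deg, degH] <;> omega
  have hw : ∀ l : List DGGen, (l.map (DGGen.deg N)).sum.1 = 0 →
      ∃ z : (dgKLRW k b Ns N).cycles, z = (l.map (Pres.gen (DGRel k b Ns))).prod ∧
        Ideal.Quotient.mk _ z ∈ (algToHomology k b N Ns).range := by
    intro l hl
    induction l with
    | nil => exact ⟨1, rfl, by rw [map_one]; exact one_mem _⟩
    | cons g l ih =>
      rw [List.map_cons, List.sum_cons, Prod.fst_add] at hl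
      have := hdeg l
      cases g with
      | nail v => simp only [DGGen.deg, degH] at hl; omega
      | plain g =>
        simp only [DGGen.deg, degH, zero_add] at hl
        obtain ⟨z, hz, hz'⟩ := ih hl
        refine ⟨⟨dgPlain k b Ns g, d_dgPlain N g⟩ * z, ?_, ?_⟩
        · rw [List.map_cons, List.prod_cons, ← hz]; rfl
        · rw [map_mul]
          refine MulMemClass.mul_mem ⟨Pres.gen _ (g.addLeft [red N]), ?_⟩ hz'
          exact (algToHomology_gen _).trans (removeLeft_addLeft _ _)
  induction ha using Submodule.span_induction with
  | mem a ha =>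
    obtain ⟨l, hl, rfl⟩ := ha
    exact hw l (congrArg Prod.fst hl)
  | zero => exact ⟨0, rfl, by rw [map_zero]; exact zero_mem _⟩
  | add x y _ _ hx hy =>
    obtain ⟨z, rfl, hz⟩ := hx
    obtain ⟨w, rfl, hw⟩ := hy
    exact ⟨z + w, rfl, by rw [map_add]; exact add_mem hz hw⟩
  | smul c x _ hx =>
    obtain ⟨z, rfl, hz⟩ := hx
    exact ⟨c • z, rfl, Subalgebra.smul_mem _ hz c⟩

/-- The homology consists of classes of homological degree zero, which come from diagrams without
nails. -/
theorem algToHomology_surjective : Function.Surjective (algToHomology k b N Ns) := by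
  have hc : ∀ i (z : (dgKLRW k b Ns N).cycles), (dgKLRW k b Ns N).d
      ((dgKLRW k b Ns N).proj i z) = 0 := by
    rintro ⟨h, q⟩ z
    rw [DGAlgebra.d_proj, (DGAlgebra.mem_cycles _).1 z.2, map_zero]
  intro x
  obtain ⟨z, rfl⟩ := Ideal.Quotient.mk_surjective x
  have key : ∀ i, Ideal.Quotient.mk _ (⟨(dgKLRW k b Ns N).proj i z, hc i z⟩ :
      (dgKLRW k b Ns N).cycles) ∈ (algToHomology k b N Ns).range := by
    rintro ⟨h, q⟩
    have hm := (dgKLRW k b Ns N).proj_mem (h, q) z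
    by_cases hh : h = 0
    · subst hh
      obtain ⟨w, hw, hw'⟩ := exists_of_mem_gr_zero hm
      rwa [show w = ⟨_, hc (0, q) z⟩ from Subtype.ext hw] at hw'
    · obtain ⟨y, hy⟩ := dg_exact N hh ((dgKLRW k b Ns N).gr_le_degPart h q hm) (hc (h, q) z)
      rw [Ideal.Quotient.eq_zero_iff_mem.2 ((DGAlgebra.mem_boundaries _).2 ⟨y, hy⟩)]
      exact zero_mem _
  obtain ⟨s, hs⟩ := (dgKLRW k b Ns N).sum_proj (z : DGAlg k b Ns)
  have e : z = ∑ i ∈ s, ⟨(dgKLRW k b Ns N).proj i z, hc i z⟩ := by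
    apply Subtype.ext
    rw [AddSubmonoidClass.coe_finsetSum]
    exact hs
  rw [e, map_sum]
  exact sum_mem fun i _ => key i

theorem algToHomology_homologyToAlg (x : (dgKLRW k b Ns N).Homology) :
    algToHomology k b N Ns (homologyToAlg k b N Ns x) = x := by
  obtain ⟨a, rfl⟩ := algToHomology_surjective x
  rw [homologyToAlg_algToHomology]

variable (k b N Ns) in
/-- The homology of the dg-enhanced KLRW algebra is the KLRW algebra with one more red strand. -/
def homologyEquiv : (dgKLRW k b Ns N).Homology ≃ₐ[k] Alg k b (N :: Ns) :=
  AlgEquiv.ofAlgHom (homologyToAlg k b N Ns) (algToHomology k b N Ns)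
    (AlgHom.ext homologyToAlg_algToHomology) (AlgHom.ext algToHomology_homologyToAlg)

theorem mem_homologyGr_iff (i : ℤ × ℤ) (x : (dgKLRW k b Ns N).Homology) :
    x ∈ (dgKLRW k b Ns N).homologyGr i ↔ homologyEquiv k b N Ns x ∈ gr k b (N :: Ns) i := by
  constructor
  · intro hx
    obtain ⟨z, hz, rfl⟩ := (DGAlgebra.mem_homologyGr _).1 hx
    exact toAlg_mem hz
  · intro hx
    exact algToHomology_homologyToAlg x ▸ algToHomology_mem hx

variable (k b N Ns) in
/-- The projection of the dg-enhanced KLRW algebra to its homology, which factors through the KLRW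
algebra. -/
def toHomology : DGAlgebra.Hom (dgKLRW k b Ns N) (dgKLRW k b Ns N).homologyDG where
  toAlgHom := (algToHomology k b N Ns).comp (toAlg k b N Ns)
  map_gr _ _ ha := algToHomology_mem (toAlg_mem ha)
  map_d a := (congrArg (algToHomology k b N Ns) (toAlg_d a)).trans (map_zero _)

theorem toHomology_cycle (z : (dgKLRW k b Ns N).cycles) :
    (toHomology k b N Ns).toAlgHom (z : DGAlg k b Ns) = Ideal.Quotient.mk _ z :=
  algToHomology_homologyToAlg (N := N) (Ideal.Quotient.mk _ z)

theorem toHomology_isQuasiIso : (toHomology k b N Ns).IsQuasiIso :=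
  DGAlgebra.isQuasiIso_of_cycle _ toHomology_cycle

end Comparison

end KLRW

theorem mainTheorem3 (k : Type*) [CommRing k] (b N : ℕ) (Ns : List ℕ) :
    (KLRW.dgKLRW k b Ns N).Formal ∧
    ∃ φ : (KLRW.dgKLRW k b Ns N).Homology ≃ₐ[k] KLRW.Alg k b (N :: Ns),
      ∀ (i : ℤ × ℤ) (x : (KLRW.dgKLRW k b Ns N).Homology),
        x ∈ (KLRW.dgKLRW k b Ns N).homologyGr i ↔ φ x ∈ KLRW.gr k b (N :: Ns) i :=
  ⟨⟨KLRW.toHomology k b N Ns, KLRW.toHomology_isQuasiIso⟩,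
    KLRW.homologyEquiv k b N Ns, KLRW.mem_homologyGr_iff⟩
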